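/- **Setting.** Identify $\mathbb R^3$ with the pure vector quaternions, with units $\mathbf i,\mathbf j,\mathbf k$; $\mathcal A^*$ is the conjugate and $|\cdot|$ the Euclidean norm. For a nonzero vector $\mathbf d$ put $\mathcal S(\mathbf d)=\sqrt{|\mathbf d|}\,\dfrac{\mathbf i+\mathbf d/|\mathbf d|}{\big|\mathbf i+\mathbf d/|\mathbf d|\big|}$ (and $\mathcal S(\mathbf d)=\sqrt{|\mathbf d|}\,\mathbf j$ if $\mathbf d/|\mathbf d|=-\mathbf i$), so that $\mathcal S(\mathbf d)\,\mathbf i\,\mathcal S(\mathbf d)^*=\mathbf d$. Write $e^{\mathbf i\theta}=\cos\theta+\mathbf i\sin\theta$, and let $B^n_j$ be the Bernstein polynomials of degree $n$. Let data $\mathbf p_i,\mathbf p_f,\mathbf v_i,\mathbf v_f,\mathbf w_i\in\mathbb R^3$ on $[u_i,u_f]$ be given, with $h=(u_f-u_i)/2$ and $u_m=u_i+h$. *Reference curve (PH quintic Hermite interpolant with the CC criterion).* Let $\Delta\mathbf p=\mathbf p_f-\mathbf p_i$, $\mathbf d_0=2h\mathbf v_i$, $\mathbf d_1=2h\mathbf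 v_f$. For angles $\varphi_0,\varphi_2$ let $\mathcal V_0=\mathcal S(\mathbf d_0)e^{\mathbf i\varphi_0}$, $\mathcal V_2=\mathcal S(\mathbf d_1)e^{\mathbf i\varphi_2}$ and $\mathcal V_1=-\tfrac34(\mathcal V_0+\mathcal V_2)+\tfrac14\mathcal S(\mathbf m)$ with $\mathbf m=120\Delta\mathbf p-15(\mathbf d_0+\mathbf d_1)+5(\mathcal V_0\mathbf i\mathcal V_2^*+\mathcal V_2\mathbf i\mathcal V_0^*)$. Let $\boldsymbol\delta_0=\mathbf d_0/|\mathbf d_0|$, $\boldsymbol\delta_1=\mathbf d_1/|\mathbf d_1|$, $\mathbf w=3\Delta\mathbf p-\mathbf d_0-\mathbf d_1$, $\mathbf u=\frac{\boldsymbol\delta_0+\boldsymbol\delta_1}{|\boldsymbol\delta_0+\boldsymbol\delta_1|}$, $\mathbf z=\frac{\boldsymbol\delta_0\times\boldsymbol\delta_1}{|\boldsymbol\delta_0+\boldsymbol\delta_1|}$, $\mu=\mathbf w\cdot\mathbf u$, and $\nu=\mathbf w\cdot\mathbf z/|\mathbf z|^2$ ($\nu=0$ if $\mathbf z=0$). The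 angles $(\varphi_0,\varphi_2)$ are *CC angles* if $$\mathcal V_0\mathbf i\mathcal V_2^*+\mathcal V_2\mathbf i\mathcal V_0^*=\frac{2\sqrt{|\mathbf d_0||\mathbf d_1|}}{\sqrt{\mu^2+\nu^2}}\,(\mu\,\mathbf u+\nu\,\mathbf z)$$ and, among all pairs $(\varphi_0+\theta,\varphi_2+\theta)$, $\theta\in\mathbb R$, the pair $(\varphi_0,\varphi_2)$ minimizes $|\mathcal V_0-2\mathcal V_1+\mathcal V_2|$. *Biarc.* For CC angles let $\mathcal A_0=\frac{1}{\sqrt2}\mathcal V_0$, $\mathcal B_2=\frac1{\sqrt2}\mathcal V_2$, $\mathcal A_1^H=\frac1{2\sqrt2}(\mathcal V_0+\mathcal V_1)$, $\mathcal A_2^H=\frac1{4\sqrt2}(\mathcal V_0+2\mathcal V_1+\mathcal V_2)$. Let $\mathbf d=\frac h4(h\mathbf w_i+4\mathbf v_i)$ and $$\mathcal A_1=-\frac{(a_1+\mathbf d)\,\mathcal A_0\,\mathbf i}{|\mathcal A_0|^2},\qquad a_1=\tfrac12|\mathcal A_0|\big(\mathcal U\mathcal A_1^{H*}+\mathcal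 A_1^H\mathcal U^*\big),\quad \mathcal U=-\frac{\mathcal A_0\mathbf i}{|\mathcal A_0|}$$ ($a_1\in\mathbb R$ minimizes $|\mathcal A_1-\mathcal A_1^H|$). Let $\mathcal G=\mathcal A_0-8\mathcal A_1+7\mathcal B_2$, $\mathbf c=\Delta\mathbf p-\frac h5(\mathbf v_f+\mathbf v_i)-\frac1{20}(h^2\mathbf w_i+4h\mathbf v_i)$, $$\mathbf b=\tfrac34\mathbf c-\tfrac15\mathcal A_1\mathbf i\mathcal A_1^*+\tfrac3{40}(\mathcal A_1\mathbf i\mathcal B_2^*+\mathcal B_2\mathbf i\mathcal A_1^*)+\tfrac1{1600}\mathcal G\mathbf i\mathcal G^*,\qquad \mathbf q=\mathcal S(\mathbf b),$$ and $\mathcal A_2=-\frac1{40}\mathcal G+\mathbf q\,e^{\mathbf i\alpha_2}$ with $\alpha_2=\pi+\operatorname{atan2}(f_2,f_1)$, where $$f_1=\tfrac1{40}(\mathcal G\mathbf q-\mathbf q\mathcal G^*)-(\mathbf q\mathcal A_2^{H*}-\mathcal A_2^H\mathbf q),\qquad f_2=-\tfrac1{40}(\mathcal G\mathbf i\mathbf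 q+\mathbf q\mathbf i\mathcal G^*)-(\mathbf q\mathbf i\mathcal A_2^{H*}+\mathcal A_2^H\mathbf i\mathbf q)$$ ($\alpha_2$ minimizes $|\mathcal A_2-\mathcal A_2^H|$). Let $\mathcal B_0=\mathcal A_2$, $\mathcal B_1=2\mathcal A_2-\mathcal A_1$. The biarc is the quintic in $\tau=(u-u_i)/h$ with initial point $\mathbf p_i$ and hodograph $\mathcal A\,\mathbf i\,\mathcal A^*$, $\mathcal A=\sum_{j=0}^2\mathcal A_jB_j^2(\tau)$, for $u\in[u_i,u_m]$, and the quintic in $\eta=(u-u_m)/h$ with final point $\mathbf p_f$ and hodograph $\mathcal B\,\mathbf i\,\mathcal B^*$, $\mathcal B=\sum_{j=0}^2\mathcal B_jB_j^2(\eta)$, for $u\in(u_m,u_f]$. **Proposition 2.** Let $\mathbf r:[0,L]\to\mathbb R^3$, $L>0$, be a $C^{10}$ curve parametrized by arc length. Assume that $\mathbf r^{(k)}(0)\ne0$ for some $2\le k\le9$, or that $\mathbf r$ is a straight segment on $[0,\rho]$ for some $\rho\in(0,L]$. For every $K\in\mathbb R$ there are constants $C$ and $\delta\in(0,L]$ such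 that the following holds for all $0<\Delta s\le\delta$ and all $\mathbf w_i\in\mathbb R^3$ with $\|\mathbf w_i-\mathbf r''(0)\|\le K\Delta s^2$. For the data $\mathbf p_i=\mathbf r(0)$, $\mathbf p_f=\mathbf r(\Delta s)$, $\mathbf v_i=\mathbf r'(0)$, $\mathbf v_f=\mathbf r'(\Delta s)$ and $\mathbf w_i$ on $[0,\Delta s]$, CC angles exist, and for all CC angles the biarc $\mathbf x$ satisfies, with $\mathbf x(t)$, $t\in[0,1]$, denoting its point at the parameter value $u=t\Delta s$, $$\|\mathbf x(t)-\mathbf r(t\Delta s)\|\le C\,\Delta s^4\quad\text{for all }t\in[0,1],\qquad \Big\|\frac{d^2\mathbf x}{ds^2}(\Delta s)-\mathbf r''(\Delta s)\Big\|\le C\,\Delta s^2 ,$$ where $d^2\mathbf x/ds^2$ is the derivative with respect to the parameter $u=s\in[0,\Delta s]$. -/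

import Mathlib

open scoped Quaternion

noncomputable section

namespace PHBiarc

/-- Euclidean three-space. -/
abbrev E3 := EuclideanSpace ℝ (Fin 3)

/-- A vector of three-space as a pure vector quaternion. -/
def toQuat (v : E3) : ℍ[ℝ] := ⟨0, v 0, v 1, v 2⟩

/-- The vector part of a quaternion. -/
def vecPart (q : ℍ[ℝ]) : E3 := !₂[q.imI, q.imJ, q.imK]

/-- The quaternion unit `i`. -/
def qI : ℍ[ℝ] := ⟨0, 1, 0, 0⟩

/-- The quaternion unit `j`. -/
def qJ : ℍ[ℝ] := ⟨0, 0, 1, 0⟩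

/-- `cos θ + i sin θ`. -/
def expI (θ : ℝ) : ℍ[ℝ] := ⟨Real.cos θ, Real.sin θ, 0, 0⟩

/-- `atan2 (y, x)`: the angle in `(-π, π]` of the point `(x, y)`. -/
def atan2 (y x : ℝ) : ℝ := Complex.arg ⟨x, y⟩

/-- `x / |x|`. -/
def dir (x : ℍ[ℝ]) : ℍ[ℝ] := ‖x‖⁻¹ • x

/-- The Hermitian-type product `X i Y*`. -/
def prodI (X Y : ℍ[ℝ]) : ℍ[ℝ] := X * qI * star Y

/-- `X i Y* + Y i X*`. -/
def symI (X Y : ℍ[ℝ]) : ℍ[ℝ] := prodI X Y + prodI Y X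

open Classical in
/-- The standard solution `√|d| (i + d/|d|) / |i + d/|d||` of `V i V* = d`, for a nonzero pure
vector `d`. If `d` is a negative multiple of `i`, where this expression is undefined, the solution
`√|d| j` is taken. All solutions are `vroot d * expI θ` with `θ` real. -/
def vroot (d : ℍ[ℝ]) : ℍ[ℝ] :=
  √‖d‖ • (if qI + dir d = 0 then qJ else dir (qI + dir d))

/-! ### The interpolation data -/

/-- End points, first derivatives at both ends, and the second derivative at the left end, for an
interpolant on the parameter interval `[ui, uf]`. -/
structure HermiteData where
  ui : ℝ
  uf : ℝ
  pi : E3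
  pf : E3
  vi : E3
  vf : E3
  wi : E3

namespace HermiteData

variable (H : HermiteData)

/-- Half of the length of the parameter interval. -/
def h : ℝ := (H.uf - H.ui) / 2

/-- The joint parameter, at the midpoint. -/
def um : ℝ := H.ui + H.h

/-! ### The reference PH quintic with the CC (cubic-cubic) criterion

The reference curve `xᴴ(t)`, `t ∈ [0, 1]`, has the hodograph `V(t) i V(t)*` with
`V = V₀ B₀² + V₁ B₁² + V₂ B₂²`, and interpolates the end points and the end derivatives
`di = 2 h vi`, `df = 2 h vf` with respect to `t`. -/

def Δp : ℍ[ℝ] := toQuat H.pf - toQuat H.pi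
def di : ℍ[ℝ] := (2 * H.h) • toQuat H.vi
def df : ℍ[ℝ] := (2 * H.h) • toQuat H.vf

/-- Solutions of `V₀ i V₀* = di`. -/
def V0 (φ₀ : ℝ) : ℍ[ℝ] := vroot H.di * expI φ₀

/-- Solutions of `V₂ i V₂* = df`. -/
def V2 (φ₂ : ℝ) : ℍ[ℝ] := vroot H.df * expI φ₂

def cH (φ₀ φ₂ : ℝ) : ℍ[ℝ] :=
  (120 : ℝ) • H.Δp - (15 : ℝ) • (H.di + H.df) + (5 : ℝ) • symI (H.V0 φ₀) (H.V2 φ₂)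

/-- The middle coefficient that makes the integral of `V i V*` over `[0, 1]` equal to `Δp`; its
own angular parameter is chosen equal to zero. -/
def V1 (φ₀ φ₂ : ℝ) : ℍ[ℝ] :=
  (-(3 / 4) : ℝ) • (H.V0 φ₀ + H.V2 φ₂) + (1 / 4 : ℝ) • vroot (H.cH φ₀ φ₂)

def deltai : ℍ[ℝ] := dir H.di
def deltaf : ℍ[ℝ] := dir H.df

/-- The inner coefficient, in the Bernstein basis of degree two, of the hodograph of the ordinary
cubic Hermite interpolant; the outer ones are `di` and `df`. -/
def wC : ℍ[ℝ] := (3 : ℝ) • H.Δp - (H.di + H.df)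

/-- The direction of the bisector of `deltai` and `deltaf`. -/
def uC : ℍ[ℝ] := dir (H.deltai + H.deltaf)

/-- `(deltai × deltaf) / |deltai + deltaf|`. It is orthogonal to `uC`. -/
def zC : ℍ[ℝ] :=
  ‖H.deltai + H.deltaf‖⁻¹ •
    ((1 / 2 : ℝ) • (H.deltai * H.deltaf - H.deltaf * H.deltai))

def projU : ℝ := inner ℝ H.wC H.uC

/-- The coefficient of `zC` in the orthogonal projection of `wC` on the span of `uC` and `zC`
(zero if `zC = 0`). -/
def projZ : ℝ := inner ℝ H.wC H.zC / ‖H.zC‖ ^ 2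

/-- The CC criterion for the angles of the reference curve. As the angles vary, the vector
`(V₀ i V₂* + V₂ i V₀*) / 2` depends only on `φ₂ - φ₀` and runs through the ellipse
`√(|di| |df|) (cos ψ uC - sin ψ zC)`. If the ordinary cubic interpolant is PH, it is this vector
for a PH cubic that equals `wC`.

First condition: `φ₂ - φ₀` is such that this vector points in the direction of the orthogonal
projection of `wC` on the plane of the ellipse.

Second condition: among the angles with the same difference, `φ₀` and `φ₂` minimize
`|V₀ - 2 V₁ + V₂|`, the distance of the preimage from a linear one (that is, of the curve from a
PH cubic). -/
def IsCC (φ₀ φ₂ : ℝ) : Prop :=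
  symI (H.V0 φ₀) (H.V2 φ₂) =
      (2 * √(‖H.di‖ * ‖H.df‖) / √(H.projU ^ 2 + H.projZ ^ 2)) •
        (H.projU • H.uC + H.projZ • H.zC) ∧
    ∀ θ : ℝ,
      ‖H.V0 φ₀ - (2 : ℝ) • H.V1 φ₀ φ₂ + H.V2 φ₂‖ ≤
        ‖H.V0 (φ₀ + θ) - (2 : ℝ) • H.V1 (φ₀ + θ) (φ₂ + θ) + H.V2 (φ₂ + θ)‖

/-! ### The reference curve in biarc form

Coefficients of the preimage of the reference curve after subdivision at `t = 1/2`. -/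

def A0H (φ₀ : ℝ) : ℍ[ℝ] := (1 / √2) • H.V0 φ₀

def A1H (φ₀ φ₂ : ℝ) : ℍ[ℝ] := (1 / (2 * √2)) • (H.V0 φ₀ + H.V1 φ₀ φ₂)

def A2H (φ₀ φ₂ : ℝ) : ℍ[ℝ] :=
  (1 / (4 * √2)) • (H.V0 φ₀ + (2 : ℝ) • H.V1 φ₀ φ₂ + H.V2 φ₂)

def B2H (φ₂ : ℝ) : ℍ[ℝ] := (1 / √2) • H.V2 φ₂

/-! ### The biarc for the selected parameters

The preimages of the two arcs are `A₀ B₀² + A₁ B₁² + A₂ B₂²` and `B₀ B₀² + B₁ B₁² + B₂ B₂²`.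
The outer coefficients are those of the reference curve. -/

def A0 (φ₀ : ℝ) : ℍ[ℝ] := H.A0H φ₀

def B2 (φ₂ : ℝ) : ℍ[ℝ] := H.B2H φ₂

def dvec : ℍ[ℝ] := (H.h / 4) • (H.h • toQuat H.wi + (4 : ℝ) • toQuat H.vi)

/-- `- (a + dvec) A₀ i / |A₀|²`, with a real parameter `a`. -/
def A1of (φ₀ a : ℝ) : ℍ[ℝ] :=
  -((‖H.A0 φ₀‖ ^ 2)⁻¹ • (((a : ℍ[ℝ]) + H.dvec) * H.A0 φ₀ * qI))

/-- `- A₀ i / |A₀|`. -/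
def UU (φ₀ : ℝ) : ℍ[ℝ] := -(‖H.A0 φ₀‖⁻¹ • (H.A0 φ₀ * qI))

/-- The selected value `(|A₀| / 2) (U A₁ᴴ* + A₁ᴴ U*)` of the parameter `a`, which minimizes
`|A₁ - A₁ᴴ|`. The quaternion whose real part is taken is real. -/
def a1 (φ₀ φ₂ : ℝ) : ℝ :=
  (1 / 2) * ‖H.A0 φ₀‖ *
    (H.UU φ₀ * star (H.A1H φ₀ φ₂) + H.A1H φ₀ φ₂ * star (H.UU φ₀)).re

def A1 (φ₀ φ₂ : ℝ) : ℍ[ℝ] := H.A1of φ₀ (H.a1 φ₀ φ₂)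

def G (φ₀ φ₂ : ℝ) : ℍ[ℝ] :=
  H.A0 φ₀ - (8 : ℝ) • H.A1 φ₀ φ₂ + (7 : ℝ) • H.B2 φ₂

def c : ℍ[ℝ] :=
  H.Δp - (H.h / 5) • (toQuat H.vf + toQuat H.vi)
    - (1 / 20 : ℝ) • ((H.h ^ 2) • toQuat H.wi + (4 * H.h) • toQuat H.vi)

def b (φ₀ φ₂ : ℝ) : ℍ[ℝ] :=
  (15 / 20 : ℝ) • H.c - (2 / 10 : ℝ) • prodI (H.A1 φ₀ φ₂) (H.A1 φ₀ φ₂)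
    + (3 / 40 : ℝ) • symI (H.A1 φ₀ φ₂) (H.B2 φ₂)
    + (1 / 1600 : ℝ) • prodI (H.G φ₀ φ₂) (H.G φ₀ φ₂)

def q (φ₀ φ₂ : ℝ) : ℍ[ℝ] := vroot (H.b φ₀ φ₂)

/-- `- G / 40 + q (cos α + i sin α)`: the solutions `A₂` of
`(A₂ + G / 40) i (A₂ + G / 40)* = b`. -/
def A2of (φ₀ φ₂ α : ℝ) : ℍ[ℝ] :=
  -((1 / 40 : ℝ) • H.G φ₀ φ₂) + H.q φ₀ φ₂ * expI α

/-- With `f2`: `|A₂ - A₂ᴴ|² = f1 cos α + f2 sin α + const`. The quaternions whose real parts are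
taken here and in `f2` are real. -/
def f1 (φ₀ φ₂ : ℝ) : ℝ :=
  ((1 / 40 : ℝ) • (H.G φ₀ φ₂ * H.q φ₀ φ₂ - H.q φ₀ φ₂ * star (H.G φ₀ φ₂))
    - (H.q φ₀ φ₂ * star (H.A2H φ₀ φ₂) - H.A2H φ₀ φ₂ * H.q φ₀ φ₂)).re

def f2 (φ₀ φ₂ : ℝ) : ℝ :=
  (-((1 / 40 : ℝ) • (H.G φ₀ φ₂ * qI * H.q φ₀ φ₂ + H.q φ₀ φ₂ * qI * star (H.G φ₀ φ₂)))
    - (H.q φ₀ φ₂ * qI * star (H.A2H φ₀ φ₂) + H.A2H φ₀ φ₂ * qI * H.q φ₀ φ₂)).re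

/-- The selected angle, which minimizes `|A₂ - A₂ᴴ|`. -/
def alpha2 (φ₀ φ₂ : ℝ) : ℝ := Real.pi + atan2 (H.f2 φ₀ φ₂) (H.f1 φ₀ φ₂)

def A2 (φ₀ φ₂ : ℝ) : ℍ[ℝ] := H.A2of φ₀ φ₂ (H.alpha2 φ₀ φ₂)

def B0 (φ₀ φ₂ : ℝ) : ℍ[ℝ] := H.A2 φ₀ φ₂

def B1 (φ₀ φ₂ : ℝ) : ℍ[ℝ] := (2 : ℝ) • H.A2 φ₀ φ₂ - H.A1 φ₀ φ₂

end HermiteData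

/-- The Bézier control points of the quintic with initial point `p` and with the hodograph
generated by the preimage with Bernstein coefficients `A₀, A₁, A₂`. -/
def ctrlInitial (p A₀ A₁ A₂ : ℍ[ℝ]) : Fin 6 → ℍ[ℝ] :=
  let q0 := p
  let q1 := q0 + (1 / 5 : ℝ) • prodI A₀ A₀
  let q2 := q1 + (1 / 10 : ℝ) • symI A₀ A₁
  let q3 := q2 + (1 / 30 : ℝ) • (symI A₀ A₂ + (4 : ℝ) • prodI A₁ A₁)
  let q4 := q3 + (1 / 10 : ℝ) • symI A₁ A₂
  let q5 := q4 + (1 / 5 : ℝ) • prodI A₂ A₂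
  ![q0, q1, q2, q3, q4, q5]

/-- The same for the quintic with final point `p`. -/
def ctrlFinal (p B₀ B₁ B₂ : ℍ[ℝ]) : Fin 6 → ℍ[ℝ] :=
  let q5 := p
  let q4 := q5 - (1 / 5 : ℝ) • prodI B₂ B₂
  let q3 := q4 - (1 / 10 : ℝ) • symI B₁ B₂
  let q2 := q3 - (1 / 30 : ℝ) • (symI B₀ B₂ + (4 : ℝ) • prodI B₁ B₁)
  let q1 := q2 - (1 / 10 : ℝ) • symI B₀ B₁
  let q0 := q1 - (1 / 5 : ℝ) • prodI B₀ B₀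
  ![q0, q1, q2, q3, q4, q5]

/-- The quintic curve with given Bézier control points. -/
def bezier5 (P : Fin 6 → ℍ[ℝ]) (τ : ℝ) : E3 :=
  ∑ j : Fin 6, (bernsteinPolynomial ℝ 5 j).eval τ • vecPart (P j)

namespace HermiteData

/-- The PH quintic biarc for the data `H`, constructed from the reference curve with the angles
`φ₀, φ₂`, in the global parameter `u ∈ [ui, uf]`. -/
def biarc (H : HermiteData) (φ₀ φ₂ : ℝ) (u : ℝ) : E3 :=
  if u ≤ H.um then
    bezier5 (ctrlInitial (toQuat H.pi) (H.A0 φ₀) (H.A1 φ₀ φ₂) (H.A2 φ₀ φ₂))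
      ((u - H.ui) / H.h)
  else
    bezier5 (ctrlFinal (toQuat H.pf) (H.B0 φ₀ φ₂) (H.B1 φ₀ φ₂) (H.B2 φ₂))
      ((u - H.um) / H.h)

end HermiteData

/-- Data sampled from the curve `r`, parametrized on `[0, L]`, at the ends of `[0, Δs]`, with the
vector `w` as left second derivative. -/
def sampledData (r : ℝ → E3) (L Δs : ℝ) (w : E3) : HermiteData where
  ui := 0
  uf := Δs
  pi := r 0
  pf := r Δs
  vi := derivWithin r (Set.Icc 0 L) 0
  vf := derivWithin r (Set.Icc 0 L) Δs
  wi := w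

end PHBiarc

end

namespace PHBiarc

/-! ### Algebra of the products `X i Y*` -/

/-! Divide every preimage coefficient by `√h`, write `s` for `Δs`, and expand `r' = T + s k + s² c +
O(s³)` with `k = r''(0)`, `c = r'''(0)/2`. The outer coefficients become unit quaternions `P`, `Q`.
A quadratic preimage `P + x s P₁ + x² s² P₂` reproduces this expansion up to `O(s³)` as soon as
`symI P₁ P = k` and `symI P₂ P = c - P₁ i P₁*`. The kernel of `D ↦ symI D P` is spanned by `P i`, so
`P₁` has one free multiple of `P i`; it is used to match `Q` (`ScaledBiarc.P₁`,
`ScaledBiarc.prodI_quad`).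

The coefficients of the biarc are compared with this model. They agree with it only to `O(s²)`, but
the error is `O(s³)` apart from a multiple of `P i` (`Near`). By `X i X* - Y i Y* = symI (X - Y) (X
+ Y) / 2`, that multiple affects the hodograph only at third order (`Near.prodI_sub_prodI`). For `Q`
the closeness comes from the end derivative, for `a₁` from the prescribed second derivative, and for
`a₂` from the closing equation, which the model satisfies up to `O(s³)` (`Q_near`, `a₁_near`,
`a₂_near`). The reference curve serves only to select among solutions, for which `O(s²)` accuracy is
enough. Scaled hodographs are then correct to `O(s³)` (`prodI_first`, `prodI_second`), and
integration over a length `O(s)` gives `O(s⁴)`. At the right end the scaled second derivative has an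
error `O(s³)` (`symI_last`), multiplied by `4 / s` on scaling back.

The CC criterion has to supply `Q - P = O(s)` and a second difference `E = O(s²)` of the reference
preimage (`scaledBiarc`). The first follows from `ν / μ = O(s)`, that is, from `ν = O(s²)`. Since
`ν` divides by `|z|²` and `|z| = |v_f - v_i| / 2` may be tiny, this needs the hypothesis at the left
end: if the first nonvanishing derivative beyond the first has order `n`, the deviation of the chord
from the tangent is `(s / n) (v_f - v_i)` up to a factor `O(s²)` relative to `v_f - v_i`
(`exists_norm_sub_smul_le`), and `z` is orthogonal to `v_f - v_i`. The second follows from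
minimality, by comparison with the nearest solution of `V i V* = m` (`norm_sub_mul_expI_le`).

Uniformity in `w_i` and in the angles is obtained by indexing over all admissible tuples and letting
only `s` tend to zero (`exists_forall_norm_le`). -/

@[simp] lemma qI_re : qI.re = 0 := rfl
@[simp] lemma qI_imI : qI.imI = 1 := rfl
@[simp] lemma qI_imJ : qI.imJ = 0 := rfl
@[simp] lemma qI_imK : qI.imK = 0 := rfl
@[simp] lemma qJ_re : qJ.re = 0 := rfl
@[simp] lemma qJ_imI : qJ.imI = 0 := rfl
@[simp] lemma qJ_imJ : qJ.imJ = 1 := rfl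
@[simp] lemma qJ_imK : qJ.imK = 0 := rfl
@[simp] lemma expI_re (θ : ℝ) : (expI θ).re = Real.cos θ := rfl
@[simp] lemma expI_imI (θ : ℝ) : (expI θ).imI = Real.sin θ := rfl
@[simp] lemma expI_imJ (θ : ℝ) : (expI θ).imJ = 0 := rfl
@[simp] lemma expI_imK (θ : ℝ) : (expI θ).imK = 0 := rfl
@[simp] lemma toQuat_re (v : E3) : (toQuat v).re = 0 := rfl
@[simp] lemma toQuat_imI (v : E3) : (toQuat v).imI = v 0 := rfl
@[simp] lemma toQuat_imJ (v : E3) : (toQuat v).imJ = v 1 := rfl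
@[simp] lemma toQuat_imK (v : E3) : (toQuat v).imK = v 2 := rfl

lemma norm_sq_eq (q : ℍ[ℝ]) : ‖q‖ ^ 2 = q.re ^ 2 + q.imI ^ 2 + q.imJ ^ 2 + q.imK ^ 2 := by
  rw [sq, ← Quaternion.normSq_eq_norm_mul_self, Quaternion.normSq_def']

lemma inner_eq (p q : ℍ[ℝ]) :
    inner ℝ p q = p.re * q.re + p.imI * q.imI + p.imJ * q.imJ + p.imK * q.imK := by
  rw [Quaternion.inner_def]; simp

lemma norm_eq_one_of_sq {x : ℍ[ℝ]} (h : ‖x‖ ^ 2 = 1) : ‖x‖ = 1 := by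
  nlinarith [norm_nonneg x]

@[simp] lemma norm_qI : ‖qI‖ = 1 := norm_eq_one_of_sq (by simp [norm_sq_eq])

@[simp] lemma norm_qJ : ‖qJ‖ = 1 := norm_eq_one_of_sq (by simp [norm_sq_eq])

@[simp] lemma norm_expI (θ : ℝ) : ‖expI θ‖ = 1 :=
  norm_eq_one_of_sq (by simp [norm_sq_eq])

@[simp] lemma norm_prodI (X Y : ℍ[ℝ]) : ‖prodI X Y‖ = ‖X‖ * ‖Y‖ := by
  simp [prodI]

@[simp] lemma prodI_self_re (X : ℍ[ℝ]) : (prodI X X).re = 0 := by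
  simp [prodI]; ring

@[simp] lemma symI_re (X Y : ℍ[ℝ]) : (symI X Y).re = 0 := by
  simp [symI, prodI]; ring

lemma symI_comm (X Y : ℍ[ℝ]) : symI X Y = symI Y X := add_comm _ _

lemma prodI_add_left (X Y Z : ℍ[ℝ]) : prodI (X + Y) Z = prodI X Z + prodI Y Z := by
  simp [prodI, add_mul]

lemma prodI_add_right (X Y Z : ℍ[ℝ]) : prodI X (Y + Z) = prodI X Y + prodI X Z := by
  simp [prodI, mul_add]

lemma prodI_smul_left (c : ℝ) (X Y : ℍ[ℝ]) : prodI (c • X) Y = c • prodI X Y := by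
  simp [prodI]

lemma prodI_smul_right (c : ℝ) (X Y : ℍ[ℝ]) : prodI X (c • Y) = c • prodI X Y := by
  simp [prodI]

lemma prodI_sub_left (X Y Z : ℍ[ℝ]) : prodI (X - Y) Z = prodI X Z - prodI Y Z := by
  simp [prodI, sub_mul]

lemma prodI_sub_right (X Y Z : ℍ[ℝ]) : prodI X (Y - Z) = prodI X Y - prodI X Z := by
  simp [prodI, mul_sub]

lemma symI_add_left (X Y Z : ℍ[ℝ]) : symI (X + Y) Z = symI X Z + symI Y Z := by
  simp only [symI, prodI_add_left, prodI_add_right]; abel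

lemma symI_add_right (X Y Z : ℍ[ℝ]) : symI X (Y + Z) = symI X Y + symI X Z := by
  simp only [symI, prodI_add_left, prodI_add_right]; abel

lemma symI_sub_left (X Y Z : ℍ[ℝ]) : symI (X - Y) Z = symI X Z - symI Y Z := by
  simp only [symI, prodI_sub_left, prodI_sub_right]; abel

lemma symI_sub_right (X Y Z : ℍ[ℝ]) : symI X (Y - Z) = symI X Y - symI X Z := by
  simp only [symI, prodI_sub_left, prodI_sub_right]; abel

lemma symI_smul_left (c : ℝ) (X Y : ℍ[ℝ]) : symI (c • X) Y = c • symI X Y := by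
  simp only [symI, prodI_smul_left, prodI_smul_right, smul_add]

lemma symI_smul_right (c : ℝ) (X Y : ℍ[ℝ]) : symI X (c • Y) = c • symI X Y := by
  simp only [symI, prodI_smul_left, prodI_smul_right, smul_add]

lemma norm_symI_le (X Y : ℍ[ℝ]) : ‖symI X Y‖ ≤ 2 * (‖X‖ * ‖Y‖) := by
  refine (norm_add_le _ _).trans (le_of_eq ?_)
  simp only [norm_prodI]; ring

/-- Difference of squares for the quadratic map `X ↦ X i X*`; every comparison of hodographs rests
on it. -/
lemma prodI_sub_prodI (X Y : ℍ[ℝ]) :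
    prodI X X - prodI Y Y = (1 / 2 : ℝ) • symI (X - Y) (X + Y) := by
  simp only [symI, prodI_sub_left, prodI_sub_right, prodI_add_left, prodI_add_right]
  module

/-- `symI D P` determines `D` up to a multiple of `P i`. -/
lemma norm_sq_symI_add (D P : ℍ[ℝ]) :
    ‖symI D P‖ ^ 2 + 4 * inner ℝ D (P * qI) ^ 2 = 4 * ‖P‖ ^ 2 * ‖D‖ ^ 2 := by
  simp only [norm_sq_eq, inner_eq]
  simp [symI, prodI]; ring

/-- `P i` is orthogonal to `x P i` for a pure vector `x`. -/
lemma inner_mul_qI (x P : ℍ[ℝ]) (hx : x.re = 0) : inner ℝ (x * P * qI) (P * qI) = 0 := by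
  simp only [inner_eq]
  simp [hx]; ring

/-- Explicit inversion of `D ↦ symI D P` on pure vectors. With `symI_self_mul_qI` for the kernel, it
produces `A₁` and the coefficients `P₁`, `P₂` of the model. -/
lemma symI_mul_qI (x P : ℍ[ℝ]) (hx : x.re = 0) :
    symI (x * P * qI) P = -(2 * ‖P‖ ^ 2) • x := by
  rw [norm_sq_eq]
  ext <;> simp [symI, prodI, hx] <;> ring

lemma symI_self_mul_qI (P : ℍ[ℝ]) : symI (P * qI) P = 0 := by
  ext <;> simp [symI, prodI] <;> ring

lemma prodI_mul_expI (X Y : ℍ[ℝ]) (θ : ℝ) :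
    prodI (X * expI θ) (Y * expI θ) = prodI X Y := by
  have h := Real.cos_sq_add_sin_sq θ
  have : expI θ * qI * star (expI θ) = qI := by
    ext <;> simp  <;> nlinarith
  calc prodI (X * expI θ) (Y * expI θ) = X * (expI θ * qI * star (expI θ)) * star Y := by
        simp only [prodI, star_mul, mul_assoc]
    _ = _ := by rw [this, prodI]

lemma symI_mul_expI (X Y : ℍ[ℝ]) (θ : ℝ) :
    symI (X * expI θ) (Y * expI θ) = symI X Y := by
  simp only [symI, prodI_mul_expI]

lemma expI_add (θ φ : ℝ) : expI (θ + φ) = expI θ * expI φ := by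
  ext <;> simp [Real.cos_add, Real.sin_add]; ring

lemma expI_zero : expI 0 = 1 := by
  ext <;> simp

lemma mul_expI (X : ℍ[ℝ]) (θ : ℝ) : X * expI θ = Real.cos θ • X + Real.sin θ • (X * qI) := by
  ext <;> simp  <;> ring

/-! ### Solutions of `V i V* = d` and the solution nearest to a given quaternion. -/

lemma norm_dir {x : ℍ[ℝ]} (hx : x ≠ 0) : ‖dir x‖ = 1 := by
  simp [dir, norm_smul, hx]

lemma norm_smul_dir (x : ℍ[ℝ]) : ‖x‖ • dir x = x := by
  by_cases hx : x = 0
  · simp [hx, dir]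
  · simp [dir, smul_smul, hx]

lemma dir_smul_of_pos {c : ℝ} (hc : 0 < c) (x : ℍ[ℝ]) : dir (c • x) = dir x := by
  rw [dir, dir, norm_smul, smul_smul, Real.norm_of_nonneg hc.le, mul_inv, mul_right_comm,
    inv_mul_cancel₀ hc.ne', one_mul]

lemma dir_of_norm_eq_one {x : ℍ[ℝ]} (hx : ‖x‖ = 1) : dir x = x := by simp [dir, hx]

/-- Reflection of a pure vector in the line spanned by the unit pure vector. -/
lemma conj_dir_add (e d : ℍ[ℝ]) (he : e.re = 0) (hd : d.re = 0) (hn : ‖e‖ = ‖d‖)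
    (h : e + d ≠ 0) : dir (e + d) * e * star (dir (e + d)) = d := by
  have h1 : ‖e + d‖ ≠ 0 := by simpa using h
  have h2 : ‖e + d‖ ^ 2 • d = (e + d) * e * star (e + d) := by
    have hn2 : e.imI ^ 2 + e.imJ ^ 2 + e.imK ^ 2 = d.imI ^ 2 + d.imJ ^ 2 + d.imK ^ 2 := by
      have := congrArg (· ^ 2) hn
      simpa [norm_sq_eq, he, hd] using this
    rw [norm_sq_eq]
    ext
    · simp [he, hd]; ring
    · simp [he, hd]; linear_combination -(d.imI + e.imI) * hn2
    · simp [he, hd]; linear_combination -(d.imJ + e.imJ) * hn2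
    · simp [he, hd]; linear_combination -(d.imK + e.imK) * hn2
  have h3 : dir (e + d) * e * star (dir (e + d))
      = (‖e + d‖⁻¹ * ‖e + d‖⁻¹) • ((e + d) * e * star (e + d)) := by
    simp only [dir]
    generalize e + d = x
    simp [smul_smul]
  rw [h3, ← h2, smul_smul, show ‖e + d‖⁻¹ * ‖e + d‖⁻¹ * ‖e + d‖ ^ 2 = 1 by field_simp, one_smul]

lemma prodI_vroot (d : ℍ[ℝ]) (hd : d.re = 0) : prodI (vroot d) (vroot d) = d := by
  have key : ∀ x : ℍ[ℝ], prodI x x = dir d → prodI (√‖d‖ • x) (√‖d‖ • x) = d := by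
    intro x hx
    rw [prodI_smul_left, prodI_smul_right, smul_smul, Real.mul_self_sqrt (norm_nonneg d), hx,
      norm_smul_dir]
  by_cases h0 : d = 0
  · simp [h0, vroot, prodI]
  have hre : (dir d).re = 0 := by simp [dir, hd]
  unfold vroot
  apply key
  -- In the exceptional case `d` points along `-i`, and `j i j* = -i`.
  split_ifs with h
  · rw [← neg_eq_of_add_eq_zero_right h]
    ext <;> simp [prodI]
  · exact conj_dir_add qI (dir d) rfl hre (by rw [norm_qI, norm_dir h0]) h

lemma vroot_re (d : ℍ[ℝ]) (hd : d.re = 0) : (vroot d).re = 0 := by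
  unfold vroot
  split_ifs <;> simp [dir, hd]

lemma norm_sq_of_prodI {V d : ℍ[ℝ]} (h : prodI V V = d) : ‖V‖ ^ 2 = ‖d‖ := by
  rw [← h, norm_prodI, sq]

/-- All solutions of `V i V* = d`. -/
lemma exists_eq_vroot_mul_expI {V d : ℍ[ℝ]} (h : prodI V V = d) :
    ∃ φ, V = vroot d * expI φ := by
  have hd : d.re = 0 := by rw [← h]; simp
  set S := vroot d with hS
  have hSd : prodI S S = d := prodI_vroot d hd
  by_cases h0 : d = 0
  · have h1 : V = 0 := by
      have := norm_sq_of_prodI h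
      rw [h0] at this; simpa using this
    have h2 : S = 0 := by
      have := norm_sq_of_prodI hSd
      rw [h0] at this; simpa using this
    exact ⟨0, by simp [h1, h2]⟩
  have hd0 : 0 < ‖d‖ := norm_pos_iff.2 h0
  have hVn := norm_sq_of_prodI h
  have hSn := norm_sq_of_prodI hSd
  have hS0 : S ≠ 0 := by
    rintro h1; rw [h1] at hSn; simp at hSn; exact h0 (norm_eq_zero.1 hSn.symm)
  have hV0 : V ≠ 0 := by
    rintro h1; rw [h1] at hVn; simp at hVn; exact h0 (norm_eq_zero.1 hVn.symm)
  set W := S⁻¹ * V with hW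
  have hVW : V = S * W := by rw [hW, mul_inv_cancel_left₀ hS0]
  have hWn : ‖W‖ = 1 := by
    rw [hW, norm_mul, norm_inv]
    have : ‖S‖ = ‖V‖ := by
      have := hSn.trans hVn.symm
      exact (sq_eq_sq₀ (norm_nonneg _) (norm_nonneg _)).1 this
    rw [this]; exact inv_mul_cancel₀ (norm_ne_zero_iff.2 hV0)
  have hWI : W * qI * star W = qI := by
    have h1 : S * (W * qI * star W) * star S = S * qI * star S := by
      have : prodI V V = prodI S S := h.trans hSd.symm
      rw [hVW] at this
      simpa only [prodI, star_mul, mul_assoc] using this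
    have h2 := mul_right_cancel₀ (star_ne_zero.2 hS0) h1
    exact mul_left_cancel₀ hS0 h2
  -- `W` is a unit quaternion whose rotation fixes `i`. Comparing the `i`-component of `W i W*` with
  -- `|W|² = 1` removes the `j` and `k` parts, so `W = e^{iφ}`.
  have hn := norm_sq_eq W
  rw [hWn] at hn
  have hI := congrArg (fun q : ℍ[ℝ] => q.imI) hWI
  simp at hI
  have hJ : W.imJ = 0 := by nlinarith [sq_nonneg W.imJ, sq_nonneg W.imK]
  have hK : W.imK = 0 := by nlinarith [sq_nonneg W.imJ, sq_nonneg W.imK]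
  rw [hJ, hK] at hn
  refine ⟨Complex.arg ⟨W.re, W.imI⟩, ?_⟩
  have hz : ‖(⟨W.re, W.imI⟩ : ℂ)‖ = 1 := by
    have : ‖(⟨W.re, W.imI⟩ : ℂ)‖ ^ 2 = 1 := by
      rw [← Complex.normSq_eq_norm_sq, Complex.normSq_mk]; linarith
    nlinarith [norm_nonneg (⟨W.re, W.imI⟩ : ℂ)]
  have hc := Complex.norm_mul_cos_arg (⟨W.re, W.imI⟩ : ℂ)
  have hs := Complex.norm_mul_sin_arg (⟨W.re, W.imI⟩ : ℂ)
  rw [hz, one_mul] at hc hs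
  rw [hVW]
  congr 1
  ext <;> simp [hc, hs, hJ, hK]

lemma norm_sub_mul_expI_sq (X S : ℍ[ℝ]) (θ : ℝ) :
    ‖X - S * expI θ‖ ^ 2 = ‖X‖ ^ 2 + ‖S‖ ^ 2
      - 2 * (Real.cos θ * inner ℝ X S + Real.sin θ * inner ℝ X (S * qI)) := by
  rw [norm_sub_sq_real, mul_expI, inner_add_right, real_inner_smul_right, real_inner_smul_right,
    ← mul_expI, norm_mul, norm_expI]
  ring

/-- The distance of `X` from the solutions of `S i S* = d`. -/
lemma norm_sub_mul_expI_le {X S : ℍ[ℝ]} {θ ρ : ℝ} (hX : X ≠ 0) (hρ : 0 ≤ ρ)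
    (hc : ρ * Real.cos θ = inner ℝ X S) (hs : ρ * Real.sin θ = inner ℝ X (S * qI)) :
    ‖X - S * expI θ‖ ≤ ‖prodI X X - prodI S S‖ / ‖X‖ := by
  have hX' : 0 < ‖X‖ := norm_pos_iff.2 hX
  have h1 := norm_sub_mul_expI_sq X S θ
  have hcs := Real.cos_sq_add_sin_sq θ
  have h2 : ‖X - S * expI θ‖ ^ 2 = ‖X‖ ^ 2 + ‖S‖ ^ 2 - 2 * ρ := by
    rw [h1, ← hc, ← hs]; linear_combination (-2 * ρ) * hcs
  -- At this angle the squared distance is `|X|² + |S|² - 2ρ`. Its product with `|X|² + |S|² + 2ρ ≥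
  -- |X|²` is the squared distance of the two images, which gives the bound.
  have h3 : (‖X‖ ^ 2 + ‖S‖ ^ 2) ^ 2 - ‖prodI X X - prodI S S‖ ^ 2 = 4 * ρ ^ 2 := by
    have : ρ ^ 2 = inner ℝ X S ^ 2 + inner ℝ X (S * qI) ^ 2 := by
      rw [← hc, ← hs]; linear_combination (-ρ ^ 2) * hcs
    rw [this]
    simp only [norm_sq_eq, inner_eq]
    simp [prodI]; ring
  rw [le_div_iff₀ hX']
  refine abs_le_of_sq_le_sq' ?_ (norm_nonneg _) |>.2
  have h4 : (‖X‖ ^ 2 + ‖S‖ ^ 2 - 2 * ρ) * (‖X‖ ^ 2 + ‖S‖ ^ 2 + 2 * ρ)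
      = ‖prodI X X - prodI S S‖ ^ 2 := by linear_combination h3
  have h5 : 0 ≤ ‖X‖ ^ 2 + ‖S‖ ^ 2 - 2 * ρ := by rw [← h2]; positivity
  rw [mul_pow, h2, ← h4]
  apply mul_le_mul_of_nonneg_left _ h5
  nlinarith [sq_nonneg ‖S‖]

lemma exists_cos_sin (x y : ℝ) :
    ∃ θ ρ : ℝ, 0 ≤ ρ ∧ ρ * Real.cos θ = x ∧ ρ * Real.sin θ = y ∧ ρ ^ 2 = x ^ 2 + y ^ 2 :=
  ⟨Complex.arg ⟨x, y⟩, ‖(⟨x, y⟩ : ℂ)‖, norm_nonneg _, Complex.norm_mul_cos_arg _,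
    Complex.norm_mul_sin_arg _, by
      rw [← Complex.normSq_eq_norm_sq, Complex.normSq_mk]; ring⟩

/-! ### Vectors as quaternions -/

lemma toQuat_add (v w : E3) : toQuat (v + w) = toQuat v + toQuat w := by
  ext <;> simp

lemma toQuat_sub (v w : E3) : toQuat (v - w) = toQuat v - toQuat w := by
  ext <;> simp

lemma toQuat_smul (c : ℝ) (v : E3) : toQuat (c • v) = c • toQuat v := by
  ext <;> simp

@[simp] lemma norm_toQuat (v : E3) : ‖toQuat v‖ = ‖v‖ := by
  rw [← sq_eq_sq₀ (norm_nonneg _) (norm_nonneg _), norm_sq_eq, EuclideanSpace.norm_sq_eq,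
    Fin.sum_univ_three]
  simp

lemma vecPart_add (p q : ℍ[ℝ]) : vecPart (p + q) = vecPart p + vecPart q := by
  ext i; fin_cases i <;> simp [vecPart]

lemma vecPart_sub (p q : ℍ[ℝ]) : vecPart (p - q) = vecPart p - vecPart q := by
  ext i; fin_cases i <;> simp [vecPart]

lemma vecPart_smul (c : ℝ) (q : ℍ[ℝ]) : vecPart (c • q) = c • vecPart q := by
  ext i; fin_cases i <;> simp [vecPart]

@[simp] lemma vecPart_toQuat (v : E3) : vecPart (toQuat v) = v := by
  ext i; fin_cases i <;> simp [vecPart]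

lemma norm_vecPart_le (q : ℍ[ℝ]) : ‖vecPart q‖ ≤ ‖q‖ := by
  refine abs_le_of_sq_le_sq' ?_ (norm_nonneg _) |>.2
  rw [norm_sq_eq, EuclideanSpace.norm_sq_eq, Fin.sum_univ_three]
  simp [vecPart]
  nlinarith [sq_nonneg q.re]

end PHBiarc

namespace PHBiarc

open Filter Asymptotics Topology

/-! ### Orders of magnitude -/

section Order

variable {ι : Type*} {l : Filter ι} {s : ι → ℝ} {E : Type*} [NormedAddCommGroup E]

/-- `f = O(s ^ n)` along the filter `l`. -/
def Ord (l : Filter ι) (s : ι → ℝ) (n : ℕ) (f : ι → E) : Prop := f =O[l] fun i => s i ^ n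

lemma Ord.add {n : ℕ} {f g : ι → E} (hf : Ord l s n f) (hg : Ord l s n g) :
    Ord l s n (fun i => f i + g i) := IsBigO.add hf hg

lemma Ord.sub {n : ℕ} {f g : ι → E} (hf : Ord l s n f) (hg : Ord l s n g) :
    Ord l s n (fun i => f i - g i) := IsBigO.sub hf hg

lemma Ord.neg {n : ℕ} {f : ι → E} (hf : Ord l s n f) :
    Ord l s n (fun i => -f i) := IsBigO.neg_left hf

lemma Ord.smul [NormedSpace ℝ E] {n m : ℕ} {c : ι → ℝ} {f : ι → E} (hc : Ord l s m c) (hf : Ord l s n f) :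
    Ord l s (m + n) (fun i => c i • f i) := by
  have := IsBigO.smul hc hf
  simpa only [Ord, smul_eq_mul, ← pow_add] using this

lemma Ord.const_smul [NormedSpace ℝ E] {n : ℕ} {f : ι → E} (c : ℝ) (hf : Ord l s n f) :
    Ord l s n (fun i => c • f i) := IsBigO.const_smul_left hf c

lemma ord_const (x : E) : Ord l s 0 (fun _ => x) := by
  simpa [Ord] using isBigO_const_const x (one_ne_zero (α := ℝ)) l

lemma ord_zero (n : ℕ) : Ord l s n (fun _ => (0 : E)) := isBigO_zero _ _

lemma ord_pow (n : ℕ) : Ord l s n (fun i => s i ^ n) := isBigO_refl _ _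

lemma ord_self : Ord l s 1 s := by simpa [Ord] using isBigO_refl s l

lemma Ord.mono {n m : ℕ} {f : ι → E} (hs : Tendsto s l (𝓝 0)) (hf : Ord l s m f) (h : n ≤ m) :
    Ord l s n f := by
  obtain ⟨k, rfl⟩ := Nat.exists_eq_add_of_le h
  refine IsBigO.trans hf ?_
  have h1 : (fun i => s i ^ k) =O[l] fun _ => (1 : ℝ) := (hs.pow k).isBigO_one ℝ
  simpa [pow_add] using (isBigO_refl (fun i => s i ^ n) l).mul h1

lemma Ord.of_le {n : ℕ} {f : ι → E} (C : ℝ) (h : ∀ᶠ i in l, ‖f i‖ ≤ C * |s i| ^ n) :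
    Ord l s n f := IsBigO.of_bound C (by simpa using h)

lemma Ord.trans_le {n : ℕ} {F : Type*} [NormedAddCommGroup F] {f : ι → E} {g : ι → F}
    (hg : Ord l s n g) (C : ℝ) (h : ∀ᶠ i in l, ‖f i‖ ≤ C * ‖g i‖) :
    Ord l s n f := (IsBigO.of_bound C h).trans hg

lemma Ord.congr {n : ℕ} {f g : ι → E} (hf : Ord l s n f) (h : ∀ i, f i = g i) : Ord l s n g := by
  have : f = g := funext h
  rwa [← this]

lemma Ord.tendsto {f : ι → E} (hs : Tendsto s l (𝓝 0)) (hf : Ord l s 1 f) :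
    Tendsto f l (𝓝 0) := by
  refine IsBigO.trans_tendsto hf ?_
  simpa using hs

lemma ord_of_norm_le {f : ι → E} (C : ℝ) (h : ∀ i, ‖f i‖ ≤ C) : Ord l s 0 f :=
  Ord.of_le C (Eventually.of_forall (by simpa using h))

lemma Ord.symI {n m : ℕ} {f g : ι → ℍ[ℝ]} (hf : Ord l s n f) (hg : Ord l s m g) :
    Ord l s (n + m) (fun i => symI (f i) (g i)) := by
  have h1 : (fun i => PHBiarc.symI (f i) (g i)) =O[l] fun i => ‖f i‖ * ‖g i‖ :=
    IsBigO.of_bound 2 (Eventually.of_forall fun i => by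
      simpa using norm_symI_le (f i) (g i))
  have h2 := h1.trans (hf.norm_left.mul hg.norm_left)
  simpa only [Ord, ← pow_add] using h2

lemma Ord.prodI {n m : ℕ} {f g : ι → ℍ[ℝ]} (hf : Ord l s n f) (hg : Ord l s m g) :
    Ord l s (n + m) (fun i => prodI (f i) (g i)) := by
  have h1 : (fun i => PHBiarc.prodI (f i) (g i)) =O[l] fun i => ‖f i‖ * ‖g i‖ :=
    IsBigO.of_bound 1 (Eventually.of_forall fun i => by simp)
  have h2 := h1.trans (hf.norm_left.mul hg.norm_left)
  simpa only [Ord, ← pow_add] using h2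

/-- `D` is small of second order, and of third order up to a multiple of `P i`. -/
def Near (l : Filter ι) (s : ι → ℝ) (P D : ι → ℍ[ℝ]) : Prop :=
  Ord l s 2 D ∧ Ord l s 3 (fun i => symI (D i) (P i))

variable {P D X Y M : ι → ℍ[ℝ]}

lemma Near.add (hX : Near l s P X) (hY : Near l s P Y) : Near l s P (fun i => X i + Y i) :=
  ⟨hX.1.add hY.1, (hX.2.add hY.2).congr fun i => by rw [symI_add_left]⟩

lemma Near.sub (hX : Near l s P X) (hY : Near l s P Y) : Near l s P (fun i => X i - Y i) :=
  ⟨hX.1.sub hY.1, (hX.2.sub hY.2).congr fun i => by rw [symI_sub_left]⟩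

lemma Near.smul {c : ι → ℝ} (hc : Ord l s 0 c) (hX : Near l s P X) :
    Near l s P (fun i => c i • X i) :=
  ⟨by simpa using hc.smul hX.1, by simpa [symI_smul_left] using hc.smul hX.2⟩

lemma Near.const_smul (c : ℝ) (hX : Near l s P X) : Near l s P (fun i => c • X i) :=
  Near.smul (ord_const c) hX

lemma Near.congr (hX : Near l s P X) (h : ∀ i, X i = Y i) : Near l s P Y := by
  have : X = Y := funext h
  rwa [← this]

lemma Near.symI (hD : Near l s P D) (hM : Ord l s 1 (fun i => M i - P i)) :
    Ord l s 3 (fun i => symI (D i) (M i)) :=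
  (hD.2.add (hD.1.symI hM)).congr fun i => by rw [← symI_add_right]; congr 1; abel

/-- The part of `D` along `P i` is only of second order, but it is annihilated by `symI · P`;
replacing `P` by `X` or `Y` costs a further factor `O(s)`. -/
lemma Near.prodI_sub_prodI (hD : Near l s P (fun i => X i - Y i))
    (hX : Ord l s 1 (fun i => X i - P i)) (hY : Ord l s 1 (fun i => Y i - P i)) :
    Ord l s 3 (fun i => prodI (X i) (X i) - prodI (Y i) (Y i)) :=
  (((hD.symI hX).add (hD.symI hY)).const_smul (1 / 2 : ℝ)).congr fun i => by
    rw [PHBiarc.prodI_sub_prodI, ← symI_add_right]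

/-- Converse of `Near.prodI_sub_prodI`: third-order agreement of the images upgrades a second-order
estimate to `Near`. -/
lemma Near.of_prodI_sub_prodI (h2 : Ord l s 2 (fun i => X i - Y i))
    (h3 : Ord l s 3 (fun i => prodI (X i) (X i) - prodI (Y i) (Y i)))
    (hX : Ord l s 1 (fun i => X i - P i)) (hY : Ord l s 1 (fun i => Y i - P i)) :
    Near l s P (fun i => X i - Y i) :=
  ⟨h2, (h3.sub ((h2.symI (hX.add hY)).const_smul (1 / 2 : ℝ))).congr fun i => by
    rw [PHBiarc.prodI_sub_prodI]
    simp only [symI_add_right, symI_sub_right]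
    module⟩

/-- `symI D P` and the component along `P i` together control `D`, by `norm_sq_symI_add`. -/
lemma ord_of_symI {n : ℕ} (hP : ∀ i, ‖P i‖ = 1) (h : Ord l s n (fun i => symI (D i) (P i)))
    (h' : Ord l s n (fun i => (inner ℝ (D i) (P i * qI) : ℝ))) : Ord l s n D := by
  have h1 := h.norm_left.add h'.norm_left
  refine Ord.trans_le (g := fun i => ‖PHBiarc.symI (D i) (P i)‖ + ‖(inner ℝ (D i) (P i * qI) : ℝ)‖)
    h1 1 (Eventually.of_forall fun i => ?_)
  have h2 := norm_sq_symI_add (D i) (P i)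
  rw [hP i] at h2
  rw [Real.norm_of_nonneg (by positivity), one_mul]
  refine abs_le_of_sq_le_sq' ?_ (by positivity) |>.2
  have h3 := Real.norm_eq_abs (inner ℝ (D i) (P i * qI) : ℝ)
  have h4 := sq_abs (inner ℝ (D i) (P i * qI) : ℝ)
  rw [← h3] at h4
  nlinarith [norm_nonneg (PHBiarc.symI (D i) (P i)), norm_nonneg (inner ℝ (D i) (P i * qI) : ℝ),
    mul_nonneg (norm_nonneg (PHBiarc.symI (D i) (P i)))
      (norm_nonneg (inner ℝ (D i) (P i * qI) : ℝ))]

end Order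

/-! ### The quadratic model of the preimage -/

section Model

variable {ι : Type*} {l : Filter ι} {s : ι → ℝ}

/-- Scaled coefficients of the reference curve and of the biarc for data sampled from a curve with
the derivative `T + s k + s² c + O(s³)`, where `s` is the length of the parameter interval. -/
structure ScaledBiarc (l : Filter ι) (s : ι → ℝ) where
  tendsto : Tendsto s l (𝓝 0)
  T : ℍ[ℝ]
  k : ℍ[ℝ]
  c : ℍ[ℝ]
  hk : k.re = 0
  hc : c.re = 0
  pos : ∀ i, 0 < s i
  P : ι → ℍ[ℝ]
  Q : ι → ℍ[ℝ]
  E : ι → ℍ[ℝ]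
  a₁ : ι → ℍ[ℝ]
  a₂ : ι → ℍ[ℝ]
  w : ι → ℍ[ℝ]
  T₁ : ι → ℍ[ℝ]
  Δ : ι → ℍ[ℝ]
  norm_P : ∀ i, ‖P i‖ = 1
  prodI_P : ∀ i, prodI (P i) (P i) = T
  prodI_Q : ∀ i, prodI (Q i) (Q i) = T₁ i
  T₁_ord : Ord l s 3 (fun i => T₁ i - (T + s i • k + s i ^ 2 • c))
  Δ_ord : Ord l s 3 (fun i => Δ i - (T + (s i / 2) • k + (s i ^ 2 / 3) • c))
  w_ord : Ord l s 2 (fun i => w i - k)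
  Q_ord : Ord l s 1 (fun i => Q i - P i)
  E_ord : Ord l s 2 E
  -- The prescribed second derivative fixes `a₁` up to a multiple of `P i`; the next field takes
  -- that multiple from the subdivided reference curve.
  symI_a₁ : ∀ i, symI (a₁ i) (P i) = (2 : ℝ) • T + (s i / 4) • w i
  inner_a₁ : ∀ i, inner ℝ (a₁ i) (P i * qI)
    = inner ℝ ((3 / 4 : ℝ) • P i + (1 / 4 : ℝ) • Q i - (1 / 4 : ℝ) • E i) (P i * qI)
  prodI_a₂ : ∀ i, prodI (a₂ i + (1 / 40 : ℝ) • (P i - (8 : ℝ) • a₁ i + (7 : ℝ) • Q i))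
      (a₂ i + (1 / 40 : ℝ) • (P i - (8 : ℝ) • a₁ i + (7 : ℝ) • Q i))
    = (3 / 4 : ℝ) • ((2 : ℝ) • Δ i - (1 / 5 : ℝ) • (T₁ i + T)
        - (1 / 20 : ℝ) • ((s i / 2) • w i + (4 : ℝ) • T))
      - (1 / 5 : ℝ) • prodI (a₁ i) (a₁ i) + (3 / 40 : ℝ) • symI (a₁ i) (Q i)
      + (1 / 1600 : ℝ) • prodI (P i - (8 : ℝ) • a₁ i + (7 : ℝ) • Q i)
          (P i - (8 : ℝ) • a₁ i + (7 : ℝ) • Q i)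
  -- The bound of `norm_sub_mul_expI_le` for the solution nearest to the reference coefficient,
  -- multiplied out so that no denominator has to be nonzero.
  norm_a₂ : ∀ i, ‖a₂ i - ((1 / 2 : ℝ) • (P i + Q i) - (1 / 4 : ℝ) • E i)‖ *
      ‖(1 / 2 : ℝ) • (P i + Q i) - (1 / 4 : ℝ) • E i
        + (1 / 40 : ℝ) • (P i - (8 : ℝ) • a₁ i + (7 : ℝ) • Q i)‖
    ≤ ‖prodI ((1 / 2 : ℝ) • (P i + Q i) - (1 / 4 : ℝ) • E i
          + (1 / 40 : ℝ) • (P i - (8 : ℝ) • a₁ i + (7 : ℝ) • Q i))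
        ((1 / 2 : ℝ) • (P i + Q i) - (1 / 4 : ℝ) • E i
          + (1 / 40 : ℝ) • (P i - (8 : ℝ) • a₁ i + (7 : ℝ) • Q i))
      - prodI (a₂ i + (1 / 40 : ℝ) • (P i - (8 : ℝ) • a₁ i + (7 : ℝ) • Q i))
          (a₂ i + (1 / 40 : ℝ) • (P i - (8 : ℝ) • a₁ i + (7 : ℝ) • Q i))‖

namespace ScaledBiarc

variable (B : ScaledBiarc l s)

/-- First coefficient of the quadratic model. -/
noncomputable def P₁ (i : ι) : ℍ[ℝ] :=
  -((1 / 2 : ℝ) • (B.k * B.P i * qI)) +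
    (inner ℝ (B.Q i - B.P i) (B.P i * qI) / s i) • (B.P i * qI)

/-- Second coefficient of the quadratic model. -/
noncomputable def P₂ (i : ι) : ℍ[ℝ] :=
  -((1 / 2 : ℝ) • ((B.c - prodI (B.P₁ i) (B.P₁ i)) * B.P i * qI))

/-- The quadratic model of the preimage, at the parameter value `x s`. -/
noncomputable def quad (x : ℝ) (i : ι) : ℍ[ℝ] := B.P i + (x * s i) • B.P₁ i + (x ^ 2 * s i ^ 2) • B.P₂ i

lemma norm_P_mul_qI (i : ι) : ‖B.P i * qI‖ = 1 := by simp [B.norm_P]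

lemma symI_P₁ (i : ι) : symI (B.P₁ i) (B.P i) = B.k := by
  have h := symI_mul_qI B.k (B.P i) B.hk
  rw [P₁, ← neg_smul, symI_add_left, symI_smul_left, symI_smul_left, symI_self_mul_qI, h,
    B.norm_P]
  module

lemma symI_P₂ (i : ι) : symI (B.P₂ i) (B.P i) = B.c - prodI (B.P₁ i) (B.P₁ i) := by
  have h := symI_mul_qI (B.c - prodI (B.P₁ i) (B.P₁ i)) (B.P i) (by simp [B.hc])
  rw [P₂, ← neg_smul, symI_smul_left, h, B.norm_P]
  module

/-- The second summand of `P₁` is designed for this: `Q - P - s P₁` has no component along `P i`. -/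
lemma inner_P₁ (i : ι) :
    s i * inner ℝ (B.P₁ i) (B.P i * qI) = inner ℝ (B.Q i - B.P i) (B.P i * qI) := by
  have h := inner_mul_qI B.k (B.P i) B.hk
  have hs := (B.pos i).ne'
  rw [P₁, inner_add_left, inner_neg_left, real_inner_smul_left, real_inner_smul_left, h,
    real_inner_self_eq_norm_sq, B.norm_P_mul_qI]
  field_simp
  ring

lemma P_ord : Ord l s 0 B.P := ord_of_norm_le 1 fun i => (B.norm_P i).le

lemma P₁_ord : Ord l s 0 B.P₁ := by
  refine Ord.add (Ord.neg (Ord.const_smul _ (ord_of_norm_le ‖B.k‖ fun i => by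
    simp [B.norm_P]))) ?_
  -- Boundedness of the free multiple of `P i` is where `Q - P = O(s)` is indispensable.
  have h : Ord l s 0 (fun i => (inner ℝ (B.Q i - B.P i) (B.P i * qI) / s i : ℝ)) := by
    obtain ⟨C, hC⟩ := IsBigO.bound B.Q_ord
    refine Ord.of_le C (hC.mono fun i hi => ?_)
    have hs := B.pos i
    rw [norm_div, Real.norm_of_nonneg hs.le, pow_zero, mul_one, div_le_iff₀ hs]
    refine (abs_real_inner_le_norm _ _).trans ?_
    rw [B.norm_P_mul_qI, mul_one]
    simpa [abs_of_pos hs] using hi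
  simpa using h.smul (ord_of_norm_le 1 fun i => (B.norm_P_mul_qI i).le)

lemma P₂_ord : Ord l s 0 B.P₂ := by
  refine Ord.neg (Ord.const_smul _ ?_)
  have h : Ord l s 0 (fun i => B.c - prodI (B.P₁ i) (B.P₁ i)) :=
    (ord_const _).sub (B.P₁_ord.prodI B.P₁_ord)
  exact h.trans_le 1 (Eventually.of_forall fun i => by simp [B.norm_P])

lemma quad_sub {x : ι → ℝ} (hx : Ord l s 0 x) : Ord l s 1 (fun i => B.quad (x i) i - B.P i) := by
  have h1 : Ord l s 1 (fun i => (x i * s i) • B.P₁ i) :=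
    (hx.smul (ord_self (s := s))).smul B.P₁_ord
  have h2 : Ord l s 2 (fun i => (x i ^ 2 * s i ^ 2) • B.P₂ i) := by
    have := ((hx.smul hx).smul (ord_pow (s := s) 2)).smul B.P₂_ord
    simpa [sq] using this
  exact (h1.add (h2.mono B.tendsto one_le_two)).congr fun i => by rw [quad]; abel

/-- The terms of orders zero to two agree by `prodI_P`, `symI_P₁` and `symI_P₂`; only the cubic and
quartic terms remain. -/
lemma prodI_quad {x : ι → ℝ} (hx : Ord l s 0 x) : Ord l s 3 (fun i =>
    prodI (B.quad (x i) i) (B.quad (x i) i)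
      - (B.T + (x i * s i) • B.k + (x i ^ 2 * s i ^ 2) • B.c)) := by
  have h3 : Ord l s 3 (fun i => (x i ^ 3 * s i ^ 3) • symI (B.P₁ i) (B.P₂ i)) := by
    have := ((hx.smul (hx.smul hx)).smul (ord_pow (s := s) 3)).smul (B.P₁_ord.symI B.P₂_ord)
    simpa [pow_succ, mul_assoc] using this
  have h4 : Ord l s 4 (fun i => (x i ^ 4 * s i ^ 4) • prodI (B.P₂ i) (B.P₂ i)) := by
    have := ((hx.smul (hx.smul (hx.smul hx))).smul (ord_pow (s := s) 4)).smul
      (B.P₂_ord.prodI B.P₂_ord)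
    simpa [pow_succ, mul_assoc] using this
  refine (h3.add (h4.mono B.tendsto (by norm_num))).congr fun i => ?_
  have hc : B.c = symI (B.P₂ i) (B.P i) + prodI (B.P₁ i) (B.P₁ i) := by rw [symI_P₂]; abel
  rw [hc, ← B.symI_P₁ i, ← B.prodI_P i]
  simp only [quad, symI, prodI_add_left, prodI_add_right, prodI_smul_left, prodI_smul_right]
  module

lemma ord_of_symI_of_inner {n : ℕ} {f : ι → ℍ[ℝ]}
    (h : Ord l s n (fun i => symI (f i) (B.P i)))
    (h' : Ord l s n (fun i => (inner ℝ (f i) (B.P i * qI) : ℝ))) : Ord l s n f :=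
  ord_of_symI B.norm_P h h'

/-- The two components are treated separately: the one seen by `symI · P` comes from `T₁ - T`, and
the one along `P i` vanishes by the choice of `P₁`. -/
lemma Q_sub_linear : Ord l s 2 (fun i => B.Q i - B.P i - s i • B.P₁ i) := by
  refine B.ord_of_symI_of_inner ?_ ?_
  · have h1 := B.T₁_ord.mono B.tendsto (show 2 ≤ 3 by norm_num)
    have h2 : Ord l s 2 (fun i => s i ^ 2 • B.c) := (ord_pow 2).smul (ord_const B.c)
    refine ((h1.add h2).sub ((B.Q_ord.symI B.Q_ord).const_smul (1 / 2 : ℝ))).congr fun i => ?_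
    have h3 := PHBiarc.prodI_sub_prodI (B.Q i) (B.P i)
    rw [B.prodI_Q, B.prodI_P] at h3
    have h4 : B.T₁ i = B.T + (1 / 2 : ℝ) • symI (B.Q i - B.P i) (B.Q i + B.P i) := by
      rw [← h3]; abel
    rw [h4, ← B.symI_P₁ i]
    simp only [symI, prodI_add_left, prodI_add_right, prodI_sub_left, prodI_sub_right,
      prodI_smul_left, prodI_smul_right]
    module
  · refine (ord_zero 2).congr fun i => ?_
    rw [inner_sub_left, real_inner_smul_left, B.inner_P₁, sub_self]

lemma Q_near : Near l s B.P (fun i => B.Q i - B.quad 1 i) := by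
  refine Near.of_prodI_sub_prodI ?_ ?_ B.Q_ord (B.quad_sub (x := fun _ => 1) (ord_const 1))
  · have h2 : Ord l s 2 (fun i => s i ^ 2 • B.P₂ i) := (ord_pow 2).smul B.P₂_ord
    refine (B.Q_sub_linear.sub h2).congr fun i => ?_
    simp only [quad]; module
  · refine (B.T₁_ord.sub (B.prodI_quad (x := fun _ => 1) (ord_const 1))).congr fun i => ?_
    rw [B.prodI_Q]; module

/-- The first inner coefficient of the quadratic model on the first half of the interval. -/
noncomputable def lin (i : ι) : ℍ[ℝ] := B.P i + (s i / 4) • B.P₁ i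

lemma lin_sub : Ord l s 1 (fun i => B.lin i - B.P i) := by
  refine (((ord_self (l := l) (s := s)).smul B.P₁_ord).const_smul (1 / 4 : ℝ)).congr fun i => ?_
  simp only [lin]; module

/-- The error of `w` enters with the factor `s / 4`, hence at third order. The component along `P i`
is inherited from the reference curve and is correct only to second order, which `Near` allows. -/
lemma a₁_near : Near l s B.P (fun i => B.a₁ i - B.lin i) := by
  have h3 : Ord l s 3 (fun i => symI (B.a₁ i - B.lin i) (B.P i)) := by
    refine (((ord_self (l := l) (s := s)).smul B.w_ord).const_smul (1 / 4 : ℝ)).congr fun i => ?_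
    rw [symI_sub_left, B.symI_a₁, lin, symI_add_left, symI_smul_left, B.symI_P₁, symI, B.prodI_P]
    module
  refine ⟨B.ord_of_symI_of_inner (h3.mono B.tendsto (by norm_num)) ?_, h3⟩
  have h4 := (B.Q_sub_linear.sub B.E_ord).const_smul (1 / 4 : ℝ)
  refine h4.trans_le 1 (Eventually.of_forall fun i => ?_)
  have h5 : inner ℝ (B.a₁ i - B.lin i) (B.P i * qI)
      = inner ℝ ((1 / 4 : ℝ) • (B.Q i - B.P i - s i • B.P₁ i - B.E i)) (B.P i * qI) := by
    rw [inner_sub_left, B.inner_a₁, ← inner_sub_left]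
    congr 1
    simp only [lin]; module
  rw [h5, one_mul]
  simpa [B.norm_P_mul_qI] using norm_inner_le_norm (𝕜 := ℝ)
    ((1 / 4 : ℝ) • (B.Q i - B.P i - s i • B.P₁ i - B.E i)) (B.P i * qI)

noncomputable def g (i : ι) : ℍ[ℝ] := B.P i - (8 : ℝ) • B.a₁ i + (7 : ℝ) • B.Q i

noncomputable def gq (i : ι) : ℍ[ℝ] := B.P i - (8 : ℝ) • B.lin i + (7 : ℝ) • B.quad 1 i

noncomputable def a₂H (i : ι) : ℍ[ℝ] := (1 / 2 : ℝ) • (B.P i + B.Q i) - (1 / 4 : ℝ) • B.E i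

lemma a₁_ord : Ord l s 1 (fun i => B.a₁ i - B.P i) :=
  ((B.a₁_near.1.mono B.tendsto one_le_two).add B.lin_sub).congr fun i => by abel

lemma g_near : Near l s B.P (fun i => B.g i - B.gq i) :=
  ((B.Q_near.const_smul 7).sub (B.a₁_near.const_smul 8)).congr fun i => by
    simp only [g, gq]; module

/-- The weights `1, -8, 7` sum to zero. -/
lemma g_ord : Ord l s 1 B.g :=
  ((B.Q_ord.const_smul (7 : ℝ)).sub (B.a₁_ord.const_smul (8 : ℝ))).congr fun i => by
    simp only [g]; module

lemma gq_ord : Ord l s 1 B.gq :=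
  (B.g_ord.sub (B.g_near.1.mono B.tendsto one_le_two)).congr fun i => by abel

lemma a₂H_ord : Ord l s 2 (fun i => B.a₂H i - B.quad (1 / 2) i) := by
  have h2 : Ord l s 2 (fun i => s i ^ 2 • B.P₂ i) := (ord_pow 2).smul B.P₂_ord
  refine (((B.Q_sub_linear.const_smul (1 / 2 : ℝ)).sub (B.E_ord.const_smul (1 / 4 : ℝ))).sub
    (h2.const_smul (1 / 4 : ℝ))).congr fun i => ?_
  simp only [a₂H, quad]; module

lemma quad_ord (x : ℝ) : Ord l s 1 (fun i => B.quad x i - B.P i) :=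
  B.quad_sub (x := fun _ => x) (ord_const x)

/-- The quadratic model satisfies the equation for `a₂` up to third order. -/
lemma prodI_quad_add_gq : Ord l s 3 (fun i =>
    prodI (B.a₂ i + (1 / 40 : ℝ) • B.g i) (B.a₂ i + (1 / 40 : ℝ) • B.g i)
      - prodI (B.quad (1 / 2) i + (1 / 40 : ℝ) • B.gq i)
          (B.quad (1 / 2) i + (1 / 40 : ℝ) • B.gq i)) := by
  -- The equation for `a₂` holds exactly for the model if `Δ` and `T₁` are those of its hodograph.
  -- These contain cubic and quartic terms absent from the Taylor polynomials, with total weights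
  -- `3/2 · 1/4 - 3/20 = 9/40` and `3/2 · 1/5 - 3/20 = 3/20`.
  have h3 : Ord l s 3 (fun i => s i ^ 3 • symI (B.P₁ i) (B.P₂ i)) :=
    (ord_pow 3).smul (B.P₁_ord.symI B.P₂_ord)
  have h4 : Ord l s 3 (fun i => s i ^ 4 • prodI (B.P₂ i) (B.P₂ i)) :=
    ((ord_pow 4).smul (B.P₂_ord.prodI B.P₂_ord)).mono B.tendsto (by norm_num)
  have e1 := B.Δ_ord
  have e2 := B.T₁_ord
  have e3 := (ord_self (l := l) (s := s)).smul B.w_ord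
  have n1 := B.a₁_near.prodI_sub_prodI B.a₁_ord B.lin_sub
  have n2 := B.a₁_near.symI B.Q_ord
  have n3 := B.Q_near.symI B.lin_sub
  have n4 := ((B.g_near.1.symI (B.g_ord.add B.gq_ord)).const_smul (1 / 2 : ℝ)).congr fun i =>
    (PHBiarc.prodI_sub_prodI (B.g i) (B.gq i)).symm
  have hsum := (((((((e1.const_smul (3 / 2 : ℝ)).sub (e2.const_smul (3 / 20 : ℝ))).sub
    (e3.const_smul (3 / 160 : ℝ))).sub (n1.const_smul (1 / 5 : ℝ))).add
    ((n2.add n3).const_smul (3 / 40 : ℝ))).add (n4.const_smul (1 / 1600 : ℝ))).sub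
    (h3.const_smul (9 / 40 : ℝ))).sub (h4.const_smul (3 / 20 : ℝ))
  refine hsum.congr fun i => ?_
  have hc : B.c = symI (B.P₂ i) (B.P i) + prodI (B.P₁ i) (B.P₁ i) := by rw [symI_P₂]; abel
  have ha : prodI (B.a₂ i + (1 / 40 : ℝ) • B.g i) (B.a₂ i + (1 / 40 : ℝ) • B.g i) = _ :=
    B.prodI_a₂ i
  rw [ha, hc, ← B.symI_P₁ i, ← B.prodI_P i, ← g]
  generalize hg : B.g i = g
  simp only [gq, quad, lin, symI, prodI_add_left, prodI_add_right, prodI_sub_left, prodI_sub_right,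
    prodI_smul_left, prodI_smul_right]
  module

/-- `X` solves the closing equation, the model `Y` solves it to third order, and the reference
quantity `Z` is within `O(s²)` of `Y`. Since `X` is the solution nearest to `Z`, it is within
`O(s²)` of `Y` too, and `Near.of_prodI_sub_prodI` improves this to `Near`; finally the contribution
of `g` is removed. -/
lemma a₂_near : Near l s B.P (fun i => B.a₂ i - B.quad (1 / 2) i) := by
  set Z : ι → ℍ[ℝ] := fun i => B.a₂H i + (1 / 40 : ℝ) • B.g i with hZ
  set X : ι → ℍ[ℝ] := fun i => B.a₂ i + (1 / 40 : ℝ) • B.g i with hX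
  set Y : ι → ℍ[ℝ] := fun i => B.quad (1 / 2) i + (1 / 40 : ℝ) • B.gq i with hY
  have hXY : Ord l s 3 (fun i => prodI (X i) (X i) - prodI (Y i) (Y i)) := B.prodI_quad_add_gq
  have hZY : Ord l s 2 (fun i => Z i - Y i) :=
    (B.a₂H_ord.add (B.g_near.1.const_smul (1 / 40 : ℝ))).congr fun i => by
      simp only [hZ, hY]; module
  have hYP : Ord l s 1 (fun i => Y i - B.P i) :=
    ((B.quad_ord (1 / 2)).add (B.gq_ord.const_smul (1 / 40 : ℝ))).congr fun i => by
      simp only [hY]; module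
  have hZP : Ord l s 1 (fun i => Z i - B.P i) :=
    ((hZY.mono B.tendsto one_le_two).add hYP).congr fun i => by abel
  have hY0 : Ord l s 0 (fun i => Z i + Y i) :=
    (((hZP.add hYP).mono B.tendsto zero_le_one).add
      (B.P_ord.const_smul (2 : ℝ))).congr fun i => by module
  have hZX : Ord l s 2 (fun i => prodI (Z i) (Z i) - prodI (X i) (X i)) :=
    (((hZY.symI hY0).const_smul (1 / 2 : ℝ)).sub (hXY.mono B.tendsto (by norm_num))).congr
      fun i => by rw [← PHBiarc.prodI_sub_prodI]; abel
  have hZn : ∀ᶠ i in l, 1 / 2 ≤ ‖Z i‖ := by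
    have := (hZP.tendsto B.tendsto).norm
    rw [norm_zero] at this
    filter_upwards [this.eventually_lt_const (show (0 : ℝ) < 1 / 2 by norm_num)] with i hi
    have h1 := norm_sub_norm_le (B.P i) (Z i)
    rw [norm_sub_rev, B.norm_P] at h1
    linarith
  have hd : Ord l s 2 (fun i => B.a₂ i - B.a₂H i) := by
    refine hZX.trans_le 2 ?_
    filter_upwards [hZn] with i hi
    have h1 : ‖B.a₂ i - B.a₂H i‖ * ‖Z i‖ ≤ ‖prodI (Z i) (Z i) - prodI (X i) (X i)‖ := B.norm_a₂ i
    nlinarith [norm_nonneg (B.a₂ i - B.a₂H i)]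
  have hXY2 : Ord l s 2 (fun i => X i - Y i) :=
    (hd.add hZY).congr fun i => by simp only [hX, hZ]; module
  have hXP : Ord l s 1 (fun i => X i - B.P i) :=
    ((hXY2.mono B.tendsto one_le_two).add hYP).congr fun i => by abel
  refine ((Near.of_prodI_sub_prodI hXY2 hXY hXP hYP).sub
    (B.g_near.const_smul (1 / 40))).congr fun i => ?_
  simp only [hX, hY]; module

lemma prodI_first {τ : ι → ℝ} (hτ : ∀ i, τ i ∈ Set.Icc (0 : ℝ) 1) :
    Ord l s 3 (fun i =>
      prodI ((1 - τ i) ^ 2 • B.P i + (2 * τ i * (1 - τ i)) • B.a₁ i + τ i ^ 2 • B.a₂ i)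
        ((1 - τ i) ^ 2 • B.P i + (2 * τ i * (1 - τ i)) • B.a₁ i + τ i ^ 2 • B.a₂ i)
      - (B.T + (τ i / 2 * s i) • B.k + ((τ i / 2) ^ 2 * s i ^ 2) • B.c)) := by
  have ht : Ord l s 0 τ := ord_of_norm_le 1 fun i => by
    rw [Real.norm_eq_abs, abs_le]; constructor <;> linarith [(hτ i).1, (hτ i).2]
  have ht1 : Ord l s 0 (fun i => 1 - τ i) := (ord_const 1).sub ht
  have hx : Ord l s 0 (fun i => τ i / 2) :=
    (ht.const_smul (1 / 2 : ℝ)).congr fun i => by simp; ring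
  have c1 : Ord l s 0 (fun i => 2 * τ i * (1 - τ i)) :=
    ((ht.smul ht1).const_smul (2 : ℝ)).congr fun i => by simp; ring
  have c2 : Ord l s 0 (fun i => τ i ^ 2) := (ht.smul ht).congr fun i => by simp; ring
  -- On the first half the model has the Bernstein coefficients `P`, `lin`, `quad (1/2)`.
  have hN : Near l s B.P (fun i =>
      ((1 - τ i) ^ 2 • B.P i + (2 * τ i * (1 - τ i)) • B.a₁ i + τ i ^ 2 • B.a₂ i)
        - B.quad (τ i / 2) i) :=
    ((B.a₁_near.smul c1).add (B.a₂_near.smul c2)).congr fun i => by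
      simp only [lin, quad]; module
  have hq := B.quad_sub hx
  have hA := ((hN.1.mono B.tendsto one_le_two).add hq).congr fun i => sub_add_sub_cancel _ _ _
  exact ((hN.prodI_sub_prodI hA hq).add (B.prodI_quad hx)).congr fun i =>
    sub_add_sub_cancel _ _ _

lemma prodI_second {τ : ι → ℝ} (hτ : ∀ i, τ i ∈ Set.Icc (0 : ℝ) 1) :
    Ord l s 3 (fun i =>
      prodI ((1 - τ i) ^ 2 • B.a₂ i + (2 * τ i * (1 - τ i)) • ((2 : ℝ) • B.a₂ i - B.a₁ i)
          + τ i ^ 2 • B.Q i)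
        ((1 - τ i) ^ 2 • B.a₂ i + (2 * τ i * (1 - τ i)) • ((2 : ℝ) • B.a₂ i - B.a₁ i)
          + τ i ^ 2 • B.Q i)
      - (B.T + ((1 + τ i) / 2 * s i) • B.k + (((1 + τ i) / 2) ^ 2 * s i ^ 2) • B.c)) := by
  have ht : Ord l s 0 τ := ord_of_norm_le 1 fun i => by
    rw [Real.norm_eq_abs, abs_le]; constructor <;> linarith [(hτ i).1, (hτ i).2]
  have ht1 : Ord l s 0 (fun i => 1 - τ i) := (ord_const 1).sub ht
  have hx : Ord l s 0 (fun i => (1 + τ i) / 2) :=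
    (((ord_const (1 : ℝ)).add ht).const_smul (1 / 2 : ℝ)).congr fun i => by simp; ring
  have c0 : Ord l s 0 (fun i => (1 - τ i) ^ 2) := (ht1.smul ht1).congr fun i => by simp; ring
  have c1 : Ord l s 0 (fun i => 2 * τ i * (1 - τ i)) :=
    ((ht.smul ht1).const_smul (2 : ℝ)).congr fun i => by simp; ring
  have c2 : Ord l s 0 (fun i => τ i ^ 2) := (ht.smul ht).congr fun i => by simp; ring
  -- The model is a single quadratic across the joint, so its middle coefficient on the second half
  -- is `2 quad (1/2) - lin`, the same combination as in `B₁ = 2 A₂ - A₁`.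
  have hN : Near l s B.P (fun i =>
      ((1 - τ i) ^ 2 • B.a₂ i + (2 * τ i * (1 - τ i)) • ((2 : ℝ) • B.a₂ i - B.a₁ i)
          + τ i ^ 2 • B.Q i) - B.quad ((1 + τ i) / 2) i) :=
    (((B.a₂_near.smul c0).add (((B.a₂_near.const_smul 2).sub B.a₁_near).smul c1)).add
      (B.Q_near.smul c2)).congr fun i => by
      simp only [lin, quad]; module
  have hq := B.quad_sub hx
  have hA := ((hN.1.mono B.tendsto one_le_two).add hq).congr fun i => sub_add_sub_cancel _ _ _
  exact ((hN.prodI_sub_prodI hA hq).add (B.prodI_quad hx)).congr fun i =>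
    sub_add_sub_cancel _ _ _

/-- The scaled second derivative at the right end. -/
lemma symI_last : Ord l s 3 (fun i =>
    symI (B.Q i - ((2 : ℝ) • B.a₂ i - B.a₁ i)) (B.Q i)
      - ((s i / 4) • B.k + (s i ^ 2 / 2) • B.c)) := by
  have hN : Near l s B.P (fun i => (B.Q i - ((2 : ℝ) • B.a₂ i - B.a₁ i))
      - ((s i / 4) • B.P₁ i + (s i ^ 2 / 2) • B.P₂ i)) :=
    ((B.Q_near.sub (B.a₂_near.const_smul 2)).add B.a₁_near).congr fun i => by
      simp only [lin, quad]; module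
  have n1 := hN.symI B.Q_ord
  have m1 : Ord l s 1 (fun i => (s i / 4) • B.P₁ i + (s i ^ 2 / 2) • B.P₂ i) := by
    refine ((((ord_self (l := l) (s := s)).smul B.P₁_ord).const_smul (1 / 4 : ℝ)).add
      ((((ord_pow (l := l) (s := s) 2).smul B.P₂_ord).mono B.tendsto
        (show 1 ≤ 2 by norm_num)).const_smul (1 / 2 : ℝ))).congr fun i => ?_
    module
  have n2 : Ord l s 3 (fun i => symI (B.Q i - B.quad 1 i)
      ((s i / 4) • B.P₁ i + (s i ^ 2 / 2) • B.P₂ i)) := B.Q_near.1.symI m1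
  have h3 : Ord l s 3 (fun i => s i ^ 3 • symI (B.P₁ i) (B.P₂ i)) :=
    (ord_pow 3).smul (B.P₁_ord.symI B.P₂_ord)
  have h4 : Ord l s 3 (fun i => s i ^ 4 • prodI (B.P₂ i) (B.P₂ i)) :=
    ((ord_pow 4).smul (B.P₂_ord.prodI B.P₂_ord)).mono B.tendsto (by norm_num)
  refine (((n1.add n2).add (h3.const_smul (3 / 4 : ℝ))).add h4).congr fun i => ?_
  have hc : B.c = symI (B.P₂ i) (B.P i) + prodI (B.P₁ i) (B.P₁ i) := by rw [symI_P₂]; abel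
  rw [hc, ← B.symI_P₁ i]
  simp only [quad, symI, prodI_add_left, prodI_add_right, prodI_sub_left, prodI_sub_right,
    prodI_smul_left, prodI_smul_right]
  module

end ScaledBiarc
end Model
end PHBiarc

namespace PHBiarc

open Filter Asymptotics Topology Set

/-! ### Taylor expansions at the left end -/

section Taylor

variable {E : Type*} [NormedAddCommGroup E] [NormedSpace ℝ E] {L : ℝ} {r : ℝ → E}

lemma iteratedDerivWithin_iteratedDerivWithin (m n : ℕ) (S : Set ℝ) :
    iteratedDerivWithin n (iteratedDerivWithin m r S) S = iteratedDerivWithin (n + m) r S := by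
  have h : ∀ (p : ℕ) (f : ℝ → E),
      iteratedDerivWithin p f S = (fun g : ℝ → E => derivWithin g S)^[p] f :=
    fun p f => funext fun x => iteratedDerivWithin_eq_iterate
  rw [h, h, h, Function.iterate_add_apply]

lemma contDiffOn_iteratedDerivWithin (hL : 0 < L) (m : ℕ) {n : ℕ}
    (hr : ContDiffOn ℝ ((n + m : ℕ) : WithTop ℕ∞) r (Icc 0 L)) :
    ContDiffOn ℝ n (iteratedDerivWithin m r (Icc 0 L)) (Icc 0 L) := by
  induction m generalizing n with
  | zero => simpa [iteratedDerivWithin_zero] using hr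
  | succ m ih =>
    have h1 := ih (n := n + 1) (by rwa [show n + 1 + m = n + (m + 1) by ring])
    rw [show iteratedDerivWithin (m + 1) r (Icc 0 L)
      = derivWithin (iteratedDerivWithin m r (Icc 0 L)) (Icc 0 L) from
        iteratedDerivWithin_succ]
    exact h1.derivWithin (uniqueDiffOn_Icc hL) (by norm_cast)

/-- Taylor's formula for the `m`-th derivative. -/
lemma exists_taylor (hL : 0 < L) (m n : ℕ)
    (hr : ContDiffOn ℝ ((n + 1 + m : ℕ) : WithTop ℕ∞) r (Icc 0 L)) :
    ∃ C, ∀ x ∈ Icc 0 L, ‖iteratedDerivWithin m r (Icc 0 L) x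
      - ∑ j ∈ Finset.range (n + 1), ((j.factorial : ℝ)⁻¹ * x ^ j) •
          iteratedDerivWithin (j + m) r (Icc 0 L) 0‖ ≤ C * x ^ (n + 1) := by
  have h1 := contDiffOn_iteratedDerivWithin hL m hr
  obtain ⟨C, hC⟩ := exists_taylor_mean_remainder_bound hL.le (by exact_mod_cast h1)
  refine ⟨C, fun x hx => ?_⟩
  have := hC x hx
  simpa [taylor_within_apply, iteratedDerivWithin_iteratedDerivWithin] using this

/-- The deviation from the tangent has, up to higher order, the direction of its derivative. -/
lemma exists_norm_sub_smul_le (hL : 0 < L) (hr : ContDiffOn ℝ 10 r (Icc 0 L))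
    (hflat : (∃ k : ℕ, 2 ≤ k ∧ k ≤ 9 ∧ iteratedDerivWithin k r (Icc 0 L) 0 ≠ 0) ∨
      (∃ ρ ∈ Ioc 0 L, ∀ s ∈ Icc 0 ρ, r s = r 0 + s • derivWithin r (Icc 0 L) 0)) :
    ∃ C ε c : ℝ, 0 < ε ∧ ε ≤ L ∧ ∀ s, 0 < s → s ≤ ε →
      ‖r s - r 0 - s • derivWithin r (Icc 0 L) 0
        - (c * s) • (derivWithin r (Icc 0 L) s - derivWithin r (Icc 0 L) 0)‖
      ≤ C * s ^ 2 * ‖derivWithin r (Icc 0 L) s - derivWithin r (Icc 0 L) 0‖ := by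
  rcases hflat with h | ⟨ρ, hρ, h⟩
  · classical
    obtain ⟨n, ⟨hn2, hn9, hna⟩, hmin'⟩ : ∃ n : ℕ, (2 ≤ n ∧ n ≤ 9 ∧
        iteratedDerivWithin n r (Icc 0 L) 0 ≠ 0) ∧ ∀ j < n, ¬(2 ≤ j ∧ j ≤ 9 ∧
        iteratedDerivWithin j r (Icc 0 L) 0 ≠ 0) :=
      ⟨Nat.find h, Nat.find_spec h, fun j hj => Nat.find_min h hj⟩
    have hmin : ∀ j, 2 ≤ j → j < n → iteratedDerivWithin j r (Icc 0 L) 0 = 0 := by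
      intro j hj hjn
      by_contra h0
      exact hmin' j hjn ⟨hj, by omega, h0⟩
    obtain ⟨p, rfl⟩ := Nat.exists_eq_add_of_le' hn2
    set a := iteratedDerivWithin (p + 2) r (Icc 0 L) 0
    have hd : ∀ k : ℕ, k ≤ 10 → ContDiffOn ℝ (k : WithTop ℕ∞) r (Icc 0 L) := fun k hk =>
      hr.of_le (by exact_mod_cast hk)
    -- Both expansions use `p + 3` derivatives, one beyond the order `p + 2 ≤ 9` of the leading
    -- term; ten suffice.
    obtain ⟨C₀, hC₀⟩ := exists_taylor hL 0 (p + 2) (hd (p + 2 + 1 + 0) (by omega))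
    obtain ⟨C₁, hC₁⟩ := exists_taylor hL 1 (p + 1) (hd (p + 1 + 1 + 1) (by omega))
    have h0 : ∀ x ∈ Icc 0 L, ‖r x - r 0 - x • derivWithin r (Icc 0 L) 0
        - (((p + 2).factorial : ℝ)⁻¹ * x ^ (p + 2)) • a‖ ≤ C₀ * x ^ (p + 3) := by
      intro x hx
      have := hC₀ x hx
      rw [Finset.sum_range_succ, Finset.sum_range_succ', Finset.sum_range_succ',
        Finset.sum_eq_zero] at this
      · simpa [iteratedDerivWithin_zero, iteratedDerivWithin_one, sub_sub, add_assoc,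
          add_comm, add_left_comm] using this
      · intro j hj
        rw [add_zero, hmin _ (by omega) (by simp at hj; omega), smul_zero]
    have h1 : ∀ x ∈ Icc 0 L, ‖derivWithin r (Icc 0 L) x - derivWithin r (Icc 0 L) 0
        - (((p + 1).factorial : ℝ)⁻¹ * x ^ (p + 1)) • a‖ ≤ C₁ * x ^ (p + 2) := by
      intro x hx
      have := hC₁ x hx
      rw [Finset.sum_range_succ, Finset.sum_range_succ', Finset.sum_eq_zero] at this
      · simpa [iteratedDerivWithin_one, sub_sub] using this
      · intro j hj
        rw [hmin _ (by omega) (by simp at hj; omega), smul_zero]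
    set b := ((p + 1).factorial : ℝ)⁻¹ * ‖a‖ with hb
    have hb0 : 0 < b := by
      have := norm_pos_iff.2 hna
      positivity
    set C₁' := max C₁ 0 with hC₁'
    set C₀' := max C₀ 0 with hC₀'
    have hC₁0 : 0 ≤ C₁' := le_max_right _ _
    have hC₀0 : 0 ≤ C₀' := le_max_right _ _
    -- The factor `1 / (p + 2)` is the ratio of the leading coefficients of position and velocity.
    -- The bound on `s` makes the velocity remainder at most half of its leading term, so `‖e‖ ≥ (b
    -- / 2) s ^ (p + 1)`.
    refine ⟨(C₀' + C₁') / (b / 2), min L (b / (2 * (C₁' + 1))), 1 / (p + 2 : ℝ),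
      lt_min hL (by positivity), min_le_left _ _, fun s hs hsε => ?_⟩
    have hsL : s ∈ Icc 0 L := ⟨hs.le, hsε.trans (min_le_left _ _)⟩
    have hsb : s * (2 * (C₁' + 1)) ≤ b := by
      have := hsε.trans (min_le_right _ _)
      rwa [le_div_iff₀ (by positivity)] at this
    set f := r s - r 0 - s • derivWithin r (Icc 0 L) 0 with hf
    set e := derivWithin r (Icc 0 L) s - derivWithin r (Icc 0 L) 0 with he
    have h0' : ‖f - (((p + 2).factorial : ℝ)⁻¹ * s ^ (p + 2)) • a‖ ≤ C₀' * s ^ (p + 3) :=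
      (h0 s hsL).trans (by gcongr; exact le_max_left _ _)
    have h1' : ‖e - (((p + 1).factorial : ℝ)⁻¹ * s ^ (p + 1)) • a‖ ≤ C₁' * s ^ (p + 2) :=
      (h1 s hsL).trans (by gcongr; exact le_max_left _ _)
    clear_value f e
    have hep : b / 2 * s ^ (p + 1) ≤ ‖e‖ := by
      have h2 := norm_sub_norm_le ((((p + 1).factorial : ℝ)⁻¹ * s ^ (p + 1)) • a) e
      rw [norm_sub_rev _ e] at h2
      have h3 : ‖(((p + 1).factorial : ℝ)⁻¹ * s ^ (p + 1)) • a‖ = b * s ^ (p + 1) := by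
        rw [norm_smul, Real.norm_of_nonneg (by positivity), hb]; ring
      have h4 : C₁' * s ^ (p + 2) ≤ b / 2 * s ^ (p + 1) := by
        rw [pow_succ s (p + 1), mul_comm (s ^ (p + 1)), ← mul_assoc]
        gcongr
        nlinarith
      linarith
    have hfe : ‖f - (1 / (p + 2 : ℝ) * s) • e‖ ≤ (C₀' + C₁') * s ^ (p + 3) := by
      have e1 : f - (1 / (p + 2 : ℝ) * s) • e
          = (f - (((p + 2).factorial : ℝ)⁻¹ * s ^ (p + 2)) • a)
            - (1 / (p + 2 : ℝ) * s) • (e - (((p + 1).factorial : ℝ)⁻¹ * s ^ (p + 1)) • a) := by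
        rw [smul_sub, smul_smul, Nat.factorial_succ (p + 1)]
        have : (1 / (p + 2 : ℝ) * s) * (((p + 1).factorial : ℝ)⁻¹ * s ^ (p + 1))
          = (((p + 1 + 1) * (p + 1).factorial : ℕ) : ℝ)⁻¹ * s ^ (p + 2) := by
          push_cast
          field_simp
          ring
        rw [this]
        abel
      rw [e1]
      refine (norm_sub_le _ _).trans ?_
      rw [norm_smul, Real.norm_of_nonneg (by positivity), add_mul]
      refine add_le_add h0' ?_
      have h5 : 1 / (p + 2 : ℝ) ≤ 1 := by
        rw [div_le_one (by positivity)]; linarith [(Nat.cast_nonneg p : (0 : ℝ) ≤ p)]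
      calc 1 / (p + 2 : ℝ) * s * ‖e - (((p + 1).factorial : ℝ)⁻¹ * s ^ (p + 1)) • a‖
          ≤ 1 * s * (C₁' * s ^ (p + 2)) := by gcongr
        _ = C₁' * s ^ (p + 3) := by ring
    refine hfe.trans ?_
    calc (C₀' + C₁') * s ^ (p + 3)
        = (C₀' + C₁') / (b / 2) * s ^ 2 * (b / 2 * s ^ (p + 1)) := by field_simp; ring
      _ ≤ _ := by gcongr
  -- On a straight segment the deviation from the tangent vanishes identically.
  · refine ⟨0, ρ / 2, 0, half_pos hρ.1, by linarith [hρ.1, hρ.2], fun s hs hsε => ?_⟩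
    rw [h s ⟨hs.le, by linarith [hρ.1]⟩]
    simp

end Taylor

end PHBiarc

namespace PHBiarc

open Filter Asymptotics Topology

namespace HermiteData

variable (H : HermiteData)

/-! ### The angles of the reference curve -/

@[simp] lemma di_re : H.di.re = 0 := by simp [di]
@[simp] lemma df_re : H.df.re = 0 := by simp [df]
@[simp] lemma Δp_re : H.Δp.re = 0 := by simp [Δp]

lemma cH_re (φ₀ φ₂ : ℝ) : (H.cH φ₀ φ₂).re = 0 := by simp [cH]

lemma prodI_V0 (φ₀ : ℝ) : prodI (H.V0 φ₀) (H.V0 φ₀) = H.di := by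
  rw [V0, prodI_mul_expI, prodI_vroot _ H.di_re]

lemma prodI_V2 (φ₂ : ℝ) : prodI (H.V2 φ₂) (H.V2 φ₂) = H.df := by
  rw [V2, prodI_mul_expI, prodI_vroot _ H.df_re]

lemma V0_add (φ₀ θ : ℝ) : H.V0 (φ₀ + θ) = H.V0 φ₀ * expI θ := by
  rw [V0, V0, expI_add, mul_assoc]

lemma V2_add (φ₂ θ : ℝ) : H.V2 (φ₂ + θ) = H.V2 φ₂ * expI θ := by
  rw [V2, V2, expI_add, mul_assoc]

lemma cH_add (φ₀ φ₂ θ : ℝ) : H.cH (φ₀ + θ) (φ₂ + θ) = H.cH φ₀ φ₂ := by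
  rw [cH, cH, V0_add, V2_add, symI_mul_expI]

/-- The second difference of the coefficients of the reference preimage. -/
noncomputable def secondDiff (φ₀ φ₂ : ℝ) : ℍ[ℝ] := H.V0 φ₀ - (2 : ℝ) • H.V1 φ₀ φ₂ + H.V2 φ₂

lemma secondDiff_add (φ₀ φ₂ θ : ℝ) : H.secondDiff (φ₀ + θ) (φ₂ + θ) =
    (1 / 2 : ℝ) • ((5 : ℝ) • (H.V0 φ₀ + H.V2 φ₂) * expI θ - vroot (H.cH φ₀ φ₂)) := by
  rw [secondDiff, V1, V0_add, V2_add, cH_add, smul_mul_assoc, add_mul]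
  module

/-- A common shift of the angles rotates `V₀` and `V₂` by `e^{iθ}` and leaves `m` unchanged. The
second CC condition therefore asks for the solution of `V i V* = m` nearest to `5 (V₀ + V₂)`. -/
lemma norm_secondDiff_add (φ₀ φ₂ θ : ℝ) : ‖H.secondDiff (φ₀ + θ) (φ₂ + θ)‖ =
    (1 / 2) * ‖(5 : ℝ) • (H.V0 φ₀ + H.V2 φ₂) - vroot (H.cH φ₀ φ₂) * expI (-θ)‖ := by
  have h : expI θ * expI (-θ) = 1 := by rw [← expI_add, add_neg_cancel, expI_zero]
  have h2 : (5 : ℝ) • (H.V0 φ₀ + H.V2 φ₂) - vroot (H.cH φ₀ φ₂) * expI (-θ) =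
      ((5 : ℝ) • (H.V0 φ₀ + H.V2 φ₂) * expI θ - vroot (H.cH φ₀ φ₂)) * expI (-θ) := by
    rw [sub_mul, mul_assoc, h, mul_one]
  rw [h2, norm_mul, norm_expI, secondDiff_add, norm_smul]
  norm_num

/-- Up to the factor `120`, the right-hand side is the amount by which the linear preimage from `V₀`
to `V₂` misses the displacement `Δp`. -/
lemma prodI_sub_cH (φ₀ φ₂ : ℝ) :
    prodI ((5 : ℝ) • (H.V0 φ₀ + H.V2 φ₂)) ((5 : ℝ) • (H.V0 φ₀ + H.V2 φ₂)) - H.cH φ₀ φ₂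
      = (20 : ℝ) • ((2 : ℝ) • H.di + (2 : ℝ) • H.df + symI (H.V0 φ₀) (H.V2 φ₂)
        - (6 : ℝ) • H.Δp) := by
  rw [cH, ← H.prodI_V0 φ₀, ← H.prodI_V2 φ₂]
  simp only [symI, prodI_add_left, prodI_add_right, prodI_smul_left, prodI_smul_right]
  module

variable {H}

/-- The minimizer does at least as well as the explicit best angle, to which `norm_sub_mul_expI_le`
applies; the constant is `2 = (1/2) · 20 / 5`. -/
lemma IsCC.norm_secondDiff_mul_le {φ₀ φ₂ : ℝ} (h : H.IsCC φ₀ φ₂) :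
    ‖H.secondDiff φ₀ φ₂‖ * ‖H.V0 φ₀ + H.V2 φ₂‖ ≤
      2 * ‖(2 : ℝ) • H.di + (2 : ℝ) • H.df + symI (H.V0 φ₀) (H.V2 φ₂) - (6 : ℝ) • H.Δp‖ := by
  set X := (5 : ℝ) • (H.V0 φ₀ + H.V2 φ₂) with hX
  have hXn : ‖X‖ = 5 * ‖H.V0 φ₀ + H.V2 φ₂‖ := by rw [hX, norm_smul]; norm_num
  by_cases h0 : X = 0
  · rw [h0, norm_zero] at hXn
    have : ‖H.V0 φ₀ + H.V2 φ₂‖ = 0 := by linarith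
    rw [this, mul_zero]; positivity
  obtain ⟨θ, ρ, hρ, hc, hs, -⟩ :=
    exists_cos_sin (inner ℝ X (vroot (H.cH φ₀ φ₂))) (inner ℝ X (vroot (H.cH φ₀ φ₂) * qI))
  have h1 := norm_sub_mul_expI_le h0 hρ hc hs
  have h2 : ‖H.secondDiff φ₀ φ₂‖ ≤ ‖H.secondDiff (φ₀ + -θ) (φ₂ + -θ)‖ := h.2 (-θ)
  rw [norm_secondDiff_add, neg_neg] at h2
  rw [prodI_vroot _ (H.cH_re _ _), H.prodI_sub_cH, norm_smul, Real.norm_of_nonneg (by norm_num),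
    le_div_iff₀ (norm_pos_iff.2 h0)] at h1
  have h3 := norm_nonneg (H.V0 φ₀ + H.V2 φ₂)
  rw [hXn] at h1
  nlinarith [mul_le_mul_of_nonneg_right h2 h3]

lemma deltai_eq (hh : 0 < H.h) (hi : ‖H.vi‖ = 1) : H.deltai = toQuat H.vi := by
  rw [deltai, di, dir_smul_of_pos (by linarith), dir_of_norm_eq_one (by simpa)]

lemma deltaf_eq (hh : 0 < H.h) (hf : ‖H.vf‖ = 1) : H.deltaf = toQuat H.vf := by
  rw [deltaf, df, dir_smul_of_pos (by linarith), dir_of_norm_eq_one (by simpa)]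

lemma norm_di (hh : 0 < H.h) (hi : ‖H.vi‖ = 1) : ‖H.di‖ = 2 * H.h := by
  rw [di, norm_smul, norm_toQuat, hi, Real.norm_of_nonneg (by linarith), mul_one]

lemma norm_df (hh : 0 < H.h) (hf : ‖H.vf‖ = 1) : ‖H.df‖ = 2 * H.h := by
  rw [df, norm_smul, norm_toQuat, hf, Real.norm_of_nonneg (by linarith), mul_one]

lemma uC_re (hh : 0 < H.h) (hi : ‖H.vi‖ = 1) (hf : ‖H.vf‖ = 1) : H.uC.re = 0 := by
  rw [uC, deltai_eq hh hi, deltaf_eq hh hf]; simp [dir]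

lemma zC_eq (hh : 0 < H.h) (hi : ‖H.vi‖ = 1) (hf : ‖H.vf‖ = 1) :
    H.zC = ‖toQuat H.vi + toQuat H.vf‖⁻¹ •
      ((1 / 2 : ℝ) • (toQuat H.vi * toQuat H.vf - toQuat H.vf * toQuat H.vi)) := by
  rw [zC, deltai_eq hh hi, deltaf_eq hh hf]

lemma inner_uC_zC (hh : 0 < H.h) (hi : ‖H.vi‖ = 1) (hf : ‖H.vf‖ = 1) :
    inner ℝ H.uC H.zC = 0 := by
  rw [zC_eq hh hi hf, uC, dir, deltai_eq hh hi, deltaf_eq hh hf, real_inner_smul_left,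
    real_inner_smul_right, inner_eq]
  simp; right; ring

lemma inner_vi_zC (hh : 0 < H.h) (hi : ‖H.vi‖ = 1) (hf : ‖H.vf‖ = 1) :
    inner ℝ (toQuat H.vi) H.zC = 0 := by
  rw [zC_eq hh hi hf, real_inner_smul_right, inner_eq]
  simp; right; ring

lemma inner_vf_zC (hh : 0 < H.h) (hi : ‖H.vi‖ = 1) (hf : ‖H.vf‖ = 1) :
    inner ℝ (toQuat H.vf) H.zC = 0 := by
  rw [zC_eq hh hi hf, real_inner_smul_right, inner_eq]
  simp; right; ring

lemma norm_uC (hh : 0 < H.h) (hi : ‖H.vi‖ = 1) (hf : ‖H.vf‖ = 1)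
    (h0 : toQuat H.vi + toQuat H.vf ≠ 0) : ‖H.uC‖ = 1 := by
  rw [uC, deltai_eq hh hi, deltaf_eq hh hf, norm_dir h0]

/-- For an angle `θ` between the tangents, `sin θ / (2 cos (θ/2)) = sin (θ/2)`. -/
lemma norm_zC (hh : 0 < H.h) (hi : ‖H.vi‖ = 1) (hf : ‖H.vf‖ = 1)
    (h0 : toQuat H.vi + toQuat H.vf ≠ 0) :
    ‖H.zC‖ = (1 / 2) * ‖toQuat H.vf - toQuat H.vi‖ := by
  have h1 : ‖toQuat H.vi + toQuat H.vf‖ ≠ 0 := norm_ne_zero_iff.2 h0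
  rw [zC_eq hh hi hf, norm_smul, norm_inv, norm_norm, inv_mul_eq_iff_eq_mul₀ h1,
    ← sq_eq_sq₀ (norm_nonneg _) (by positivity)]
  rw [← norm_toQuat] at hi hf
  have hi2 := norm_sq_eq (toQuat H.vi)
  have hf2 := norm_sq_eq (toQuat H.vf)
  rw [hi] at hi2
  rw [hf] at hf2
  simp only [mul_pow, norm_sq_eq]
  simp at hi2 hf2 ⊢
  linear_combination (-(1 / 4) * ((H.vi 0 ^ 2 + H.vi 1 ^ 2 + H.vi 2 ^ 2)
    - (H.vf 0 ^ 2 + H.vf 1 ^ 2 + H.vf 2 ^ 2))) * (hf2 - hi2)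

lemma norm_sq_ellipse (hh : 0 < H.h) (hi : ‖H.vi‖ = 1) (hf : ‖H.vf‖ = 1)
    (h0 : toQuat H.vi + toQuat H.vf ≠ 0) (x y : ℝ) :
    ‖x • H.uC + y • H.zC‖ ^ 2 = x ^ 2 + y ^ 2 * ‖H.zC‖ ^ 2 := by
  rw [norm_add_sq_real, real_inner_smul_left, real_inner_smul_right, inner_uC_zC hh hi hf,
    norm_smul, norm_smul, norm_uC hh hi hf h0, mul_pow, mul_pow, Real.norm_eq_abs,
    Real.norm_eq_abs, sq_abs, sq_abs]
  ring

/-- For unit solutions the symmetric product runs through an ellipse. -/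
lemma exists_ellipse (hh : 0 < H.h) (hi : ‖H.vi‖ = 1) (hf : ‖H.vf‖ = 1)
    (h0 : toQuat H.vi + toQuat H.vf ≠ 0) {P : ℍ[ℝ]} (hP : prodI P P = toQuat H.vi) (ψ : ℝ) :
    ∃ Q, prodI Q Q = toQuat H.vf ∧
      symI P Q = (2 : ℝ) • (Real.cos ψ • H.uC - Real.sin ψ • H.zC) := by
  have hPn : ‖P‖ ^ 2 = 1 := by rw [norm_sq_of_prodI hP, norm_toQuat, hi]
  have hu := uC_re hh hi hf
  have hII : qI * qI = -1 := by ext <;> simp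
  have hstar : ∀ x : ℍ[ℝ], x.re = 0 → star x = -x := by
    intro x hx; ext <;> simp [hx]
  have hsI : star qI = -qI := hstar _ rfl
  set u := H.uC with hudef
  have hr : u * toQuat H.vi * star u = toQuat H.vf := by
    rw [hudef, uC, deltai_eq hh hi, deltaf_eq hh hf]
    exact conj_dir_add _ _ rfl rfl (by simp [hi, hf]) h0
  have hPI : P * qI * star P = toQuat H.vi := hP
  -- The half-turn about the bisector `u` carries `v_i` to `v_f`, so `u P i` is a solution for
  -- `v_f`. It and its product with `i` give the two axes `-2u` and `2z` of the ellipse; the minus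
  -- sign accounts for the shift by `π` below.
  set Q₀ := u * P * qI with hQ₀
  have hQQ : prodI Q₀ Q₀ = toQuat H.vf := by
    rw [← hr, ← hPI, prodI, hQ₀]
    simp only [star_mul, hsI, mul_assoc]
    congr 2
    rw [← mul_assoc qI qI, hII]
    simp
  have hs1 : symI P Q₀ = -(2 : ℝ) • u := by
    rw [symI_comm, hQ₀, symI_mul_qI u P hu, hPn, mul_one]
  have hs2 : symI P (Q₀ * qI) = (2 : ℝ) • H.zC := by
    have e1 : Q₀ * qI = -(u * P) := by
      rw [hQ₀, mul_assoc, hII, mul_neg_one]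
    have e2 : prodI P (Q₀ * qI) = toQuat H.vi * u := by
      rw [e1, prodI, star_neg, star_mul, hstar u hu, mul_neg, mul_neg, mul_neg, neg_neg,
        ← mul_assoc, hPI]
    have e3 : prodI (Q₀ * qI) P = -(u * toQuat H.vi) := by
      rw [e1, prodI, neg_mul, neg_mul, mul_assoc u, mul_assoc u, hPI]
    rw [symI, e2, e3, zC_eq hh hi hf, hudef, uC, dir, deltai_eq hh hi, deltaf_eq hh hf]
    simp only [mul_smul_comm, smul_mul_assoc, mul_add, add_mul]
    module
  refine ⟨Q₀ * expI (Real.pi + ψ), ?_, ?_⟩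
  · rw [prodI_mul_expI, hQQ]
  · rw [mul_expI, symI_add_right, symI_smul_right, symI_smul_right, hs1, hs2,
      add_comm Real.pi, Real.cos_add_pi, Real.sin_add_pi]
    module

/-- The polar angle of `(μ, -ν)` selects the required point of the ellipse and thus the difference
of the angles. A common shift does not move that point, so it remains free for the minimization. -/
lemma exists_isCC (hh : 0 < H.h) (hi : ‖H.vi‖ = 1) (hf : ‖H.vf‖ = 1)
    (h0 : toQuat H.vi + toQuat H.vf ≠ 0) (hU : 0 < H.projU) : ∃ φ₀ φ₂, H.IsCC φ₀ φ₂ := by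
  obtain ⟨ψ, ρ, hρ, hc, hs, hρ2⟩ := exists_cos_sin H.projU (-H.projZ)
  have hρ0 : 0 < ρ := by nlinarith [sq_nonneg H.projZ, sq_pos_of_pos hU]
  have hρs : √(H.projU ^ 2 + H.projZ ^ 2) = ρ := by
    rw [show H.projU ^ 2 + H.projZ ^ 2 = ρ ^ 2 by rw [hρ2]; ring, Real.sqrt_sq hρ]
  have h2h : 0 < 2 * H.h := by linarith
  have hsq : √(2 * H.h) * √(2 * H.h) = 2 * H.h := Real.mul_self_sqrt h2h.le
  have hsq0 : √(2 * H.h) ≠ 0 := (Real.sqrt_pos.2 h2h).ne'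
  have hP : prodI ((√(2 * H.h))⁻¹ • H.V0 0) ((√(2 * H.h))⁻¹ • H.V0 0) = toQuat H.vi := by
    rw [prodI_smul_left, prodI_smul_right, prodI_V0, di, smul_smul, smul_smul, ← mul_inv, hsq,
      inv_mul_cancel₀ h2h.ne', one_smul]
  obtain ⟨Q, hQ, hPQ⟩ := exists_ellipse hh hi hf h0 hP ψ
  have hQ2 : prodI (√(2 * H.h) • Q) (√(2 * H.h) • Q) = H.df := by
    rw [prodI_smul_left, prodI_smul_right, hQ, smul_smul, hsq, df]
  obtain ⟨φ, hφ⟩ := exists_eq_vroot_mul_expI hQ2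
  have hV2 : H.V2 φ = √(2 * H.h) • Q := hφ.symm
  have hsym : symI (H.V0 0) (H.V2 φ) = (2 * √(‖H.di‖ * ‖H.df‖) / √(H.projU ^ 2 + H.projZ ^ 2)) •
      (H.projU • H.uC + H.projZ • H.zC) := by
    have e : H.V0 0 = √(2 * H.h) • ((√(2 * H.h))⁻¹ • H.V0 0) := by
      rw [smul_smul, mul_inv_cancel₀ hsq0, one_smul]
    rw [e, hV2, symI_smul_left, symI_smul_right, hPQ, hρs, norm_di hh hi, norm_df hh hf,
      Real.sqrt_mul_self h2h.le, ← hc, show H.projZ = -(ρ * Real.sin ψ) by rw [hs, neg_neg],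
      smul_smul, hsq, smul_smul, smul_sub, smul_add, smul_smul, smul_smul, smul_smul, smul_smul,
      sub_eq_add_neg, ← neg_smul]
    congr 2 <;> field_simp
  obtain ⟨θ, ρ', hρ', hc', hs', -⟩ := exists_cos_sin
    (inner ℝ ((5 : ℝ) • (H.V0 0 + H.V2 φ)) (vroot (H.cH 0 φ)))
    (inner ℝ ((5 : ℝ) • (H.V0 0 + H.V2 φ)) (vroot (H.cH 0 φ) * qI))
  refine ⟨0 + -θ, φ + -θ, ?_, fun ξ => ?_⟩
  · rw [V0_add, V2_add, symI_mul_expI, hsym]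
  · change ‖H.secondDiff (0 + -θ) (φ + -θ)‖ ≤ ‖H.secondDiff (0 + -θ + ξ) (φ + -θ + ξ)‖
    rw [add_assoc 0, add_assoc φ, norm_secondDiff_add, norm_secondDiff_add, neg_neg]
    refine mul_le_mul_of_nonneg_left ?_ (by norm_num)
    refine abs_le_of_sq_le_sq' ?_ (norm_nonneg _) |>.2
    rw [norm_sub_mul_expI_sq, norm_sub_mul_expI_sq, ← hc', ← hs']
    have h1 : Real.cos θ * (ρ' * Real.cos θ) + Real.sin θ * (ρ' * Real.sin θ) = ρ' := by
      linear_combination ρ' * Real.cos_sq_add_sin_sq θ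
    have h2 : Real.cos (-(-θ + ξ)) * (ρ' * Real.cos θ) + Real.sin (-(-θ + ξ)) * (ρ' * Real.sin θ)
        = ρ' * Real.cos (-(-θ + ξ) - θ) := by
      rw [Real.cos_sub]; ring
    rw [h1, h2]
    nlinarith [Real.cos_le_one (-(-θ + ξ) - θ)]

end HermiteData
end PHBiarc

namespace PHBiarc

open Filter Asymptotics Topology

namespace HermiteData

variable (H : HermiteData)

/-! ### The coefficients of the biarc -/

lemma half_sqrt_two : (1 / √2 : ℝ) * (1 / √2) = 1 / 2 := by
  rw [div_mul_div_comm, Real.mul_self_sqrt (by norm_num), one_mul]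

/-- The scaled second difference of the reference preimage. -/
noncomputable def EH (φ₀ φ₂ : ℝ) : ℍ[ℝ] := (1 / √2) • H.secondDiff φ₀ φ₂

lemma A1H_eq (φ₀ φ₂ : ℝ) : H.A1H φ₀ φ₂ =
    (3 / 4 : ℝ) • H.A0 φ₀ + (1 / 4 : ℝ) • H.B2 φ₂ - (1 / 4 : ℝ) • H.EH φ₀ φ₂ := by
  have h : (1 / (2 * √2) : ℝ) = (1 / 2) * (1 / √2) := by rw [one_div_mul_one_div]
  rw [A1H, A0, B2, A0H, B2H, EH, secondDiff, h]
  module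

lemma A2H_eq (φ₀ φ₂ : ℝ) : H.A2H φ₀ φ₂ =
    (1 / 2 : ℝ) • (H.A0 φ₀ + H.B2 φ₂) - (1 / 4 : ℝ) • H.EH φ₀ φ₂ := by
  have h : (1 / (4 * √2) : ℝ) = (1 / 4) * (1 / √2) := by rw [one_div_mul_one_div]
  rw [A2H, A0, B2, A0H, B2H, EH, secondDiff, h]
  module

lemma prodI_A0 (φ₀ : ℝ) : prodI (H.A0 φ₀) (H.A0 φ₀) = H.h • toQuat H.vi := by
  rw [A0, A0H, prodI_smul_left, prodI_smul_right, smul_smul, half_sqrt_two, prodI_V0, di]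
  module

lemma prodI_B2 (φ₂ : ℝ) : prodI (H.B2 φ₂) (H.B2 φ₂) = H.h • toQuat H.vf := by
  rw [B2, B2H, prodI_smul_left, prodI_smul_right, smul_smul, half_sqrt_two, prodI_V2, df]
  module

lemma dvec_re : H.dvec.re = 0 := by simp [dvec]

variable {H}

lemma norm_sq_A0 (hh : 0 < H.h) (hi : ‖H.vi‖ = 1) (φ₀ : ℝ) : ‖H.A0 φ₀‖ ^ 2 = H.h := by
  rw [norm_sq_of_prodI (H.prodI_A0 φ₀), norm_smul, norm_toQuat, hi, mul_one,
    Real.norm_of_nonneg hh.le]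

lemma norm_sq_B2 (hh : 0 < H.h) (hf : ‖H.vf‖ = 1) (φ₂ : ℝ) : ‖H.B2 φ₂‖ ^ 2 = H.h := by
  rw [norm_sq_of_prodI (H.prodI_B2 φ₂), norm_smul, norm_toQuat, hf, mul_one,
    Real.norm_of_nonneg hh.le]

lemma A1of_eq (φ₀ a : ℝ) : H.A1of φ₀ a = -((‖H.A0 φ₀‖ ^ 2)⁻¹ •
    (a • (H.A0 φ₀ * qI) + H.dvec * H.A0 φ₀ * qI)) := by
  rw [A1of, add_mul, add_mul, Quaternion.coe_mul_eq_smul, smul_mul_assoc]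

lemma symI_A1 (hh : 0 < H.h) (hi : ‖H.vi‖ = 1) (φ₀ φ₂ : ℝ) :
    symI (H.A1 φ₀ φ₂) (H.A0 φ₀) = (2 : ℝ) • H.dvec := by
  have hn := norm_sq_A0 hh hi φ₀
  rw [A1, A1of_eq, ← neg_smul, symI_smul_left, symI_add_left, symI_smul_left, symI_self_mul_qI,
    symI_mul_qI _ _ H.dvec_re, hn, smul_zero, zero_add, smul_smul]
  congr 1
  field_simp

/-- The parameter `a` moves `A₁` along `A₀ i`, so the nearest choice to `A₁ᴴ` matches this
component. -/
lemma inner_A1 (hh : 0 < H.h) (hi : ‖H.vi‖ = 1) (φ₀ φ₂ : ℝ) :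
    inner ℝ (H.A1 φ₀ φ₂) (H.A0 φ₀ * qI) = inner ℝ (H.A1H φ₀ φ₂) (H.A0 φ₀ * qI) := by
  have hn := norm_sq_A0 hh hi φ₀
  have hn0 : ‖H.A0 φ₀‖ ≠ 0 := by
    intro h; rw [h] at hn; norm_num at hn; exact hh.ne hn
  have ha : H.a1 φ₀ φ₂ = -inner ℝ (H.A1H φ₀ φ₂) (H.A0 φ₀ * qI) := by
    have e : ∀ x y : ℍ[ℝ], (x * star y + y * star x).re = 2 * inner ℝ y x := by
      intro x y
      rw [inner_eq]; simp; ring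
    rw [a1, e, UU, inner_neg_right, real_inner_smul_right]
    field_simp
  rw [A1, A1of_eq, inner_neg_left, real_inner_smul_left, inner_add_left, real_inner_smul_left,
    inner_mul_qI _ _ H.dvec_re, real_inner_self_eq_norm_sq, norm_mul, norm_qI, ha]
  field_simp
  ring

lemma b_re (φ₀ φ₂ : ℝ) : (H.b φ₀ φ₂).re = 0 := by
  simp [b, c]

lemma A2_add (φ₀ φ₂ : ℝ) : H.A2 φ₀ φ₂ + (1 / 40 : ℝ) • H.G φ₀ φ₂ =
    H.q φ₀ φ₂ * expI (H.alpha2 φ₀ φ₂) := by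
  rw [A2, A2of]; abel

lemma prodI_A2 (φ₀ φ₂ : ℝ) : prodI (H.A2 φ₀ φ₂ + (1 / 40 : ℝ) • H.G φ₀ φ₂)
    (H.A2 φ₀ φ₂ + (1 / 40 : ℝ) • H.G φ₀ φ₂) = H.b φ₀ φ₂ := by
  rw [A2_add, prodI_mul_expI, q, prodI_vroot _ (b_re φ₀ φ₂)]

/-- With `X = A₂ᴴ + G / 40`, the pair `(-f₁, -f₂)` is twice the pair of inner products of `X` with
`q` and `q i`, because `q` is a pure vector. Hence `π + atan2 (f₂, f₁)` is the optimal angle of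
`norm_sub_mul_expI_le`. -/
lemma norm_A2_sub_mul_le (φ₀ φ₂ : ℝ) :
    ‖H.A2 φ₀ φ₂ - H.A2H φ₀ φ₂‖ * ‖H.A2H φ₀ φ₂ + (1 / 40 : ℝ) • H.G φ₀ φ₂‖ ≤
      ‖prodI (H.A2H φ₀ φ₂ + (1 / 40 : ℝ) • H.G φ₀ φ₂) (H.A2H φ₀ φ₂ + (1 / 40 : ℝ) • H.G φ₀ φ₂)
        - prodI (H.A2 φ₀ φ₂ + (1 / 40 : ℝ) • H.G φ₀ φ₂)
            (H.A2 φ₀ φ₂ + (1 / 40 : ℝ) • H.G φ₀ φ₂)‖ := by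
  set X := H.A2H φ₀ φ₂ + (1 / 40 : ℝ) • H.G φ₀ φ₂ with hX
  by_cases h0 : X = 0
  · rw [h0, norm_zero, mul_zero]; positivity
  have hq : (H.q φ₀ φ₂).re = 0 := vroot_re _ (b_re φ₀ φ₂)
  have h1 : inner ℝ X (H.q φ₀ φ₂) = -(1 / 2) * H.f1 φ₀ φ₂ := by
    rw [hX, f1, inner_eq]
    simp [hq]; ring
  have h2 : inner ℝ X (H.q φ₀ φ₂ * qI) = -(1 / 2) * H.f2 φ₀ φ₂ := by
    rw [hX, f2, inner_eq]
    simp [hq]; ring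
  have h3 := norm_sub_mul_expI_le (X := X) (S := H.q φ₀ φ₂) (θ := H.alpha2 φ₀ φ₂)
    (ρ := (1 / 2) * ‖(⟨H.f1 φ₀ φ₂, H.f2 φ₀ φ₂⟩ : ℂ)‖) h0 (by positivity)
    (by
      have := Complex.norm_mul_cos_arg (⟨H.f1 φ₀ φ₂, H.f2 φ₀ φ₂⟩ : ℂ)
      rw [h1, alpha2, atan2, add_comm, Real.cos_add_pi]
      linear_combination -(1 / 2) * this)
    (by
      have := Complex.norm_mul_sin_arg (⟨H.f1 φ₀ φ₂, H.f2 φ₀ φ₂⟩ : ℂ)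
      rw [h2, alpha2, atan2, add_comm, Real.sin_add_pi]
      linear_combination -(1 / 2) * this)
  rw [← A2_add, le_div_iff₀ (norm_pos_iff.2 h0)] at h3
  have e1 : X - (H.A2 φ₀ φ₂ + (1 / 40 : ℝ) • H.G φ₀ φ₂) = -(H.A2 φ₀ φ₂ - H.A2H φ₀ φ₂) := by
    rw [hX]; abel
  rw [e1, norm_neg] at h3
  rw [prodI_A2]
  rwa [q, prodI_vroot _ (b_re φ₀ φ₂)] at h3

/-! ### Consequences of the CC criterion -/

lemma IsCC.symI_eq {φ₀ φ₂ : ℝ} (h : H.IsCC φ₀ φ₂) (hh : 0 < H.h) (hi : ‖H.vi‖ = 1)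
    (hf : ‖H.vf‖ = 1) : symI (H.A0 φ₀) (H.B2 φ₂) =
      (2 * H.h / √(H.projU ^ 2 + H.projZ ^ 2)) • (H.projU • H.uC + H.projZ • H.zC) := by
  rw [A0, B2, A0H, B2H, symI_smul_left, symI_smul_right, smul_smul, half_sqrt_two, h.1,
    norm_di hh hi, norm_df hh hf, Real.sqrt_mul_self (by linarith), smul_smul]
  congr 1
  ring

/-- By `norm_sq_symI_add`, the norm of the CC point determines the component along `A₀ i`: its
square is `h² ν² (1 - |z|²) / (μ² + ν²)`. -/
lemma IsCC.inner_sq_mul_le {φ₀ φ₂ : ℝ} (h : H.IsCC φ₀ φ₂) (hh : 0 < H.h) (hi : ‖H.vi‖ = 1)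
    (hf : ‖H.vf‖ = 1) (h0 : toQuat H.vi + toQuat H.vf ≠ 0) (hU : 0 < H.projU) :
    |inner ℝ (H.B2 φ₂) (H.A0 φ₀ * qI)| * H.projU ≤ H.h * |H.projZ| := by
  have h1 := norm_sq_symI_add (H.B2 φ₂) (H.A0 φ₀)
  have hw : 0 < H.projU ^ 2 + H.projZ ^ 2 := by positivity
  rw [symI_comm, h.symI_eq hh hi hf, norm_smul, mul_pow, norm_sq_ellipse hh hi hf h0,
    norm_sq_A0 hh hi, norm_sq_B2 hh hf, Real.norm_eq_abs, sq_abs, div_pow,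
    Real.sq_sqrt hw.le] at h1
  rw [← abs_of_pos hU, ← abs_mul, ← abs_of_pos hh, ← abs_mul, ← sq_le_sq, mul_pow, mul_pow]
  field_simp at h1
  set x : ℝ := inner ℝ (H.B2 φ₂) (H.A0 φ₀ * qI)
  have h3 : x ^ 2 * (H.projU ^ 2 + H.projZ ^ 2) = H.h ^ 2 * H.projZ ^ 2 * (1 - ‖H.zC‖ ^ 2) := by
    nlinarith [h1]
  nlinarith [mul_nonneg (sq_nonneg x) (sq_nonneg H.projZ),
    mul_nonneg (mul_nonneg (sq_nonneg H.h) (sq_nonneg H.projZ)) (sq_nonneg ‖H.zC‖)]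

lemma IsCC.norm_EH_mul_le {φ₀ φ₂ : ℝ} (h : H.IsCC φ₀ φ₂) :
    ‖H.EH φ₀ φ₂‖ * ‖H.A0 φ₀ + H.B2 φ₂‖ ≤
      ‖(4 * H.h) • (toQuat H.vi + toQuat H.vf) + (2 : ℝ) • symI (H.A0 φ₀) (H.B2 φ₂)
        - (6 : ℝ) • H.Δp‖ := by
  have h1 := h.norm_secondDiff_mul_le
  have h2 : ‖H.A0 φ₀ + H.B2 φ₂‖ = (1 / √2) * ‖H.V0 φ₀ + H.V2 φ₂‖ := by
    rw [A0, B2, A0H, B2H, ← smul_add, norm_smul, Real.norm_of_nonneg (by positivity)]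
  have h3 : ‖H.EH φ₀ φ₂‖ = (1 / √2) * ‖H.secondDiff φ₀ φ₂‖ := by
    rw [EH, norm_smul, Real.norm_of_nonneg (by positivity)]
  have h4 : symI (H.A0 φ₀) (H.B2 φ₂) = (1 / 2 : ℝ) • symI (H.V0 φ₀) (H.V2 φ₂) := by
    rw [A0, B2, A0H, B2H, symI_smul_left, symI_smul_right, smul_smul, half_sqrt_two]
  have h5 : (4 * H.h) • (toQuat H.vi + toQuat H.vf) + (2 : ℝ) • symI (H.A0 φ₀) (H.B2 φ₂)
      - (6 : ℝ) • H.Δp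
      = (2 : ℝ) • H.di + (2 : ℝ) • H.df + symI (H.V0 φ₀) (H.V2 φ₂) - (6 : ℝ) • H.Δp := by
    rw [h4, di, df]; module
  rw [h5, h2, h3]
  have := half_sqrt_two
  calc (1 / √2) * ‖H.secondDiff φ₀ φ₂‖ * ((1 / √2) * ‖H.V0 φ₀ + H.V2 φ₂‖)
      = (1 / √2 * (1 / √2)) * (‖H.secondDiff φ₀ φ₂‖ * ‖H.V0 φ₀ + H.V2 φ₂‖) := by ring
    _ ≤ _ := by rw [this]; linarith

end HermiteData
end PHBiarc

namespace PHBiarc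

open Filter Asymptotics Topology Set

/-! ### Derivatives of the quintic curves -/

/-- The quadratic polynomial with Bernstein coefficients `A₀, A₁, A₂`. -/
noncomputable def preimage (A₀ A₁ A₂ : ℍ[ℝ]) (τ : ℝ) : ℍ[ℝ] :=
  (1 - τ) ^ 2 • A₀ + (2 * τ * (1 - τ)) • A₁ + τ ^ 2 • A₂

lemma preimage_smul (c : ℝ) (A₀ A₁ A₂ : ℍ[ℝ]) (τ : ℝ) :
    preimage (c • A₀) (c • A₁) (c • A₂) τ = c • preimage A₀ A₁ A₂ τ := by
  simp only [preimage]; module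

lemma bezier5_eq (P : Fin 6 → ℍ[ℝ]) (τ : ℝ) : bezier5 P τ =
    (1 - τ) ^ 5 • vecPart (P 0) + (5 * τ * (1 - τ) ^ 4) • vecPart (P 1)
      + (10 * τ ^ 2 * (1 - τ) ^ 3) • vecPart (P 2) + (10 * τ ^ 3 * (1 - τ) ^ 2) • vecPart (P 3)
      + (5 * τ ^ 4 * (1 - τ)) • vecPart (P 4) + τ ^ 5 • vecPart (P 5) := by
  simp [bezier5, Fin.sum_univ_six, bernsteinPolynomial, Nat.choose]

lemma bezier5_zero (P : Fin 6 → ℍ[ℝ]) : bezier5 P 0 = vecPart (P 0) := by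
  rw [bezier5_eq]; simp

lemma bezier5_one (P : Fin 6 → ℍ[ℝ]) : bezier5 P 1 = vecPart (P 5) := by
  rw [bezier5_eq]; simp

lemma hasDerivAt_bezier5 (P : Fin 6 → ℍ[ℝ]) (τ : ℝ) : HasDerivAt (bezier5 P)
    ((5 * (1 - τ) ^ 4) • (vecPart (P 1) - vecPart (P 0))
      + (20 * τ * (1 - τ) ^ 3) • (vecPart (P 2) - vecPart (P 1))
      + (30 * τ ^ 2 * (1 - τ) ^ 2) • (vecPart (P 3) - vecPart (P 2))
      + (20 * τ ^ 3 * (1 - τ)) • (vecPart (P 4) - vecPart (P 3))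
      + (5 * τ ^ 4) • (vecPart (P 5) - vecPart (P 4))) τ := by
  have h := HasDerivAt.fun_sum (u := (Finset.univ : Finset (Fin 6)))
    (fun j _ => ((bernsteinPolynomial ℝ 5 j).hasDerivAt τ).smul_const (vecPart (P j)))
  refine h.congr_deriv ?_
  simp [Fin.sum_univ_six, bernsteinPolynomial, Nat.choose, Polynomial.derivative_pow]
  module

/-- Reduces curves given by their final point to those given by their initial point, so that one
hodograph computation serves both arcs. -/
lemma ctrlFinal_eq (p B₀ B₁ B₂ : ℍ[ℝ]) :
    ctrlFinal p B₀ B₁ B₂ = ctrlInitial (ctrlFinal p B₀ B₁ B₂ 0) B₀ B₁ B₂ := by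
  funext j
  fin_cases j <;> simp [ctrlFinal, ctrlInitial]

lemma hasDerivAt_ctrlInitial (p A₀ A₁ A₂ : ℍ[ℝ]) (τ : ℝ) :
    HasDerivAt (bezier5 (ctrlInitial p A₀ A₁ A₂))
      (vecPart (prodI (preimage A₀ A₁ A₂ τ) (preimage A₀ A₁ A₂ τ))) τ := by
  refine (hasDerivAt_bezier5 _ τ).congr_deriv ?_
  simp only [← vecPart_sub, ← vecPart_smul, ← vecPart_add]
  congr 1
  simp only [ctrlInitial, preimage, symI, prodI_add_left, prodI_add_right, prodI_smul_left,
    prodI_smul_right]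
  simp
  module

lemma hasDerivAt_ctrlFinal (p B₀ B₁ B₂ : ℍ[ℝ]) (τ : ℝ) :
    HasDerivAt (bezier5 (ctrlFinal p B₀ B₁ B₂))
      (vecPart (prodI (preimage B₀ B₁ B₂ τ) (preimage B₀ B₁ B₂ τ))) τ := by
  rw [ctrlFinal_eq]; exact hasDerivAt_ctrlInitial _ _ _ _ _

/-- The second derivative of the second arc at its end. -/
lemma hasDerivAt_hodograph_one (B₀ B₁ B₂ : ℍ[ℝ]) :
    HasDerivAt (fun τ => vecPart (prodI (preimage B₀ B₁ B₂ τ) (preimage B₀ B₁ B₂ τ)))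
      (vecPart ((2 : ℝ) • symI (B₂ - B₁) B₂)) 1 := by
  have key : (fun τ : ℝ => vecPart (prodI (preimage B₀ B₁ B₂ τ) (preimage B₀ B₁ B₂ τ))) =
      fun τ : ℝ => (1 - τ) ^ 4 • vecPart (prodI B₀ B₀) + (2 * τ * (1 - τ) ^ 3) • vecPart (symI B₀ B₁)
        + (τ ^ 2 * (1 - τ) ^ 2) • vecPart (symI B₀ B₂ + (4 : ℝ) • prodI B₁ B₁)
        + (2 * τ ^ 3 * (1 - τ)) • vecPart (symI B₁ B₂) + τ ^ 4 • vecPart (prodI B₂ B₂) := by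
    funext τ
    simp only [← vecPart_smul, ← vecPart_add]
    congr 1
    simp only [preimage, symI, prodI_add_left, prodI_add_right, prodI_smul_left, prodI_smul_right]
    module
  rw [key]
  have h0 : HasDerivAt (fun τ : ℝ => 1 - τ) (-1) 1 := by
    simpa using (hasDerivAt_id (1 : ℝ)).const_sub 1
  have hid := hasDerivAt_id' (1 : ℝ)
  have d0 := (h0.fun_pow 4).smul_const (vecPart (prodI B₀ B₀))
  have d1 := ((hid.const_mul 2).fun_mul (h0.fun_pow 3)).smul_const (vecPart (symI B₀ B₁))
  have d2 := ((hid.fun_pow 2).fun_mul (h0.fun_pow 2)).smul_const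
    (vecPart (symI B₀ B₂ + (4 : ℝ) • prodI B₁ B₁))
  have d3 := (((hid.fun_pow 3).const_mul 2).fun_mul h0).smul_const (vecPart (symI B₁ B₂))
  have d4 := (hid.fun_pow 4).smul_const (vecPart (prodI B₂ B₂))
  refine ((((d0.fun_add d1).fun_add d2).fun_add d3).fun_add d4).congr_deriv ?_
  simp only [← vecPart_smul, ← vecPart_add]
  congr 1
  simp only [symI, prodI_sub_left, prodI_sub_right]
  norm_num
  module

end PHBiarc

namespace PHBiarc

open Filter Asymptotics Topology Set

/-! ### Scaling by the square root of the parameter length -/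

section Scaling

variable {h : ℝ} (hh : 0 < h)
include hh

lemma sqrt_inv_mul_self : (√h)⁻¹ * (√h)⁻¹ = h⁻¹ := by
  rw [← mul_inv, Real.mul_self_sqrt hh.le]

lemma prodI_scaled (X Y : ℍ[ℝ]) :
    prodI ((√h)⁻¹ • X) ((√h)⁻¹ • Y) = h⁻¹ • prodI X Y := by
  rw [prodI_smul_left, prodI_smul_right, smul_smul, sqrt_inv_mul_self hh]

lemma symI_scaled (X Y : ℍ[ℝ]) :
    symI ((√h)⁻¹ • X) ((√h)⁻¹ • Y) = h⁻¹ • symI X Y := by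
  rw [symI_smul_left, symI_smul_right, smul_smul, sqrt_inv_mul_self hh]

lemma inner_scaled (X Y : ℍ[ℝ]) :
    inner ℝ ((√h)⁻¹ • X) ((√h)⁻¹ • Y * qI) = h⁻¹ * inner ℝ X (Y * qI) := by
  rw [smul_mul_assoc, real_inner_smul_left, real_inner_smul_right, ← mul_assoc,
    sqrt_inv_mul_self hh]

lemma norm_scaled_mul (X Y : ℍ[ℝ]) :
    ‖(√h)⁻¹ • X‖ * ‖(√h)⁻¹ • Y‖ = h⁻¹ * (‖X‖ * ‖Y‖) := by
  rw [norm_smul, norm_smul, Real.norm_of_nonneg (by positivity), ← sqrt_inv_mul_self hh]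
  ring

end Scaling

namespace HermiteData

variable {H : HermiteData}

/-! ### Estimates for the CC criterion with nearly parallel end tangents. -/

lemma norm_uC_sub_le (hh : 0 < H.h) (hi : ‖H.vi‖ = 1) (hf : ‖H.vf‖ = 1)
    (h0 : toQuat H.vi + toQuat H.vf ≠ 0) :
    ‖H.uC - toQuat H.vi‖ ≤ ‖toQuat H.vf - toQuat H.vi‖ := by
  set V := toQuat H.vi with hV
  set W := toQuat H.vf with hW
  have hVn : ‖V‖ = 1 := by simpa [hV]
  have hWn : ‖W‖ = 1 := by simpa [hW]
  have hu : ‖V + W‖ • H.uC = V + W := by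
    rw [uC, deltai_eq hh hi, deltaf_eq hh hf, norm_smul_dir]
  have hun : ‖H.uC‖ = 1 := norm_uC hh hi hf h0
  have e : H.uC - V = (1 - ‖V + W‖ / 2) • H.uC + (1 / 2 : ℝ) • (W - V) := by
    have : (1 / 2 : ℝ) • (‖V + W‖ • H.uC) = (1 / 2 : ℝ) • (V + W) := by rw [hu]
    calc H.uC - V = H.uC - (1 / 2 : ℝ) • (V + W) + (1 / 2 : ℝ) • (W - V) := by module
      _ = _ := by rw [← this]; module
  have h1 : ‖V + W‖ ≤ 2 := by
    refine (norm_add_le _ _).trans ?_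
    rw [hVn, hWn]; norm_num
  have h2 : 2 - ‖W - V‖ ≤ ‖V + W‖ := by
    have := norm_sub_norm_le ((2 : ℝ) • V) (V - W)
    rw [norm_smul, hVn, norm_sub_rev V W, show (2 : ℝ) • V - (V - W) = V + W by module] at this
    norm_num at this ⊢
    linarith
  rw [e]
  refine (norm_add_le _ _).trans ?_
  rw [norm_smul, norm_smul, hun, Real.norm_of_nonneg (by linarith), Real.norm_of_nonneg (by norm_num)]
  linarith

lemma norm_zC_le (hh : 0 < H.h) (hi : ‖H.vi‖ = 1) (hf : ‖H.vf‖ = 1)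
    (h0 : toQuat H.vi + toQuat H.vf ≠ 0) : ‖H.zC‖ ≤ 1 := by
  rw [norm_zC hh hi hf h0]
  have := norm_sub_le (toQuat H.vf) (toQuat H.vi)
  rw [norm_toQuat, norm_toQuat, hi, hf] at this
  linarith

/-- The CC point is close to the vertex `2h u` of the ellipse when `ν / μ` is small, and `u` is
close to `v_i`. -/
lemma IsCC.norm_symI_sub_le {φ₀ φ₂ : ℝ} (h : H.IsCC φ₀ φ₂) (hh : 0 < H.h) (hi : ‖H.vi‖ = 1)
    (hf : ‖H.vf‖ = 1) (h0 : toQuat H.vi + toQuat H.vf ≠ 0) (hU : 0 < H.projU) :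
    ‖symI (H.A0 φ₀) (H.B2 φ₂) - (2 * H.h) • toQuat H.vi‖ ≤
      2 * H.h * (‖toQuat H.vf - toQuat H.vi‖ + 2 * (|H.projZ| / H.projU)) := by
  rw [h.symI_eq hh hi hf]
  set μ := H.projU
  set ν := H.projZ
  set R := √(μ ^ 2 + ν ^ 2) with hR
  have hR0 : μ ≤ R := Real.le_sqrt_of_sq_le (by nlinarith [sq_nonneg ν])
  have hR1 : R ≤ μ + |ν| := by
    rw [hR, Real.sqrt_le_left (by positivity)]
    nlinarith [sq_abs ν, abs_nonneg ν]
  have hRp : 0 < R := hU.trans_le hR0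
  have e : (2 * H.h / R) • (μ • H.uC + ν • H.zC) - (2 * H.h) • toQuat H.vi
      = (2 * H.h) • ((μ / R) • (H.uC - toQuat H.vi) + (μ / R - 1) • toQuat H.vi
        + (ν / R) • H.zC) := by
    rw [show 2 * H.h / R = 2 * H.h * R⁻¹ from rfl, show μ / R = μ * R⁻¹ from rfl,
      show ν / R = ν * R⁻¹ from rfl]
    module
  have hνR : |ν| / R ≤ |ν| / μ := by gcongr
  have h1 : ‖(μ / R) • (H.uC - toQuat H.vi)‖ ≤ ‖toQuat H.vf - toQuat H.vi‖ := by
    rw [norm_smul, Real.norm_of_nonneg (by positivity)]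
    have : μ / R ≤ 1 := (div_le_one hRp).2 hR0
    have h2 := norm_uC_sub_le hh hi hf h0
    nlinarith [norm_nonneg (H.uC - toQuat H.vi)]
  have h2 : ‖(μ / R - 1) • toQuat H.vi‖ ≤ |ν| / μ := by
    rw [norm_smul, norm_toQuat, hi, mul_one, Real.norm_eq_abs]
    refine le_trans ?_ hνR
    rw [show μ / R - 1 = -((R - μ) / R) by field_simp; ring, abs_neg, abs_div, abs_of_pos hRp,
      abs_of_nonneg (by linarith)]
    gcongr
    linarith
  have h3 : ‖(ν / R) • H.zC‖ ≤ |ν| / μ := by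
    rw [norm_smul, Real.norm_eq_abs, abs_div, abs_of_pos hRp]
    have := norm_zC_le hh hi hf h0
    calc |ν| / R * ‖H.zC‖ ≤ |ν| / R * 1 := by gcongr
      _ ≤ _ := by rw [mul_one]; exact hνR
  rw [e, norm_smul, Real.norm_of_nonneg (by positivity)]
  gcongr
  refine (norm_add_le _ _).trans ?_
  linarith [norm_add_le ((μ / R) • (H.uC - toQuat H.vi)) ((μ / R - 1) • toQuat H.vi)]

/-- Bound for `projZ` when the chord deviates from the tangent in the direction of its
derivative. -/
lemma abs_projZ_le (hh : 0 < H.h) (hi : ‖H.vi‖ = 1) (hf : ‖H.vf‖ = 1)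
    (h0 : toQuat H.vi + toQuat H.vf ≠ 0) {a b B : ℝ} (hB : 0 ≤ B)
    (hd : ‖H.Δp - a • toQuat H.vi - b • (toQuat H.vf - toQuat H.vi)‖
      ≤ B * ‖toQuat H.vf - toQuat H.vi‖) : |H.projZ| ≤ 6 * B := by
  have hz := norm_zC hh hi hf h0
  -- `z` is orthogonal to both end tangents, so any combination of them may be subtracted from the
  -- chord.
  have h1 : inner ℝ H.wC H.zC
      = 3 * inner ℝ (H.Δp - a • toQuat H.vi - b • (toQuat H.vf - toQuat H.vi)) H.zC := by
    rw [wC, di, df]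
    simp only [inner_sub_left, inner_add_left, real_inner_smul_left, inner_vi_zC hh hi hf,
      inner_vf_zC hh hi hf]
    ring
  have h2 := abs_real_inner_le_norm
    (H.Δp - a • toQuat H.vi - b • (toQuat H.vf - toQuat H.vi)) H.zC
  rw [projZ, h1, abs_div, abs_of_nonneg (sq_nonneg ‖H.zC‖)]
  -- The bound contains `‖v_f - v_i‖ = 2 ‖z‖`, which cancels the denominator `‖z‖²`. The case `z =
  -- 0` is covered.
  refine div_le_of_le_mul₀ (by positivity) (by positivity) ?_
  rw [abs_mul, abs_of_pos (by norm_num : (0 : ℝ) < 3)]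
  have h3 : ‖H.Δp - a • toQuat H.vi - b • (toQuat H.vf - toQuat H.vi)‖ * ‖H.zC‖
      ≤ B * (2 * ‖H.zC‖) * ‖H.zC‖ := by
    gcongr
    rw [hz]
    linarith
  nlinarith

lemma le_projU (hh : 0 < H.h) (hi : ‖H.vi‖ = 1) (hf : ‖H.vf‖ = 1)
    (h0 : toQuat H.vi + toQuat H.vf ≠ 0) :
    2 * H.h - 4 * H.h * ‖toQuat H.vf - toQuat H.vi‖ - 3 * ‖H.Δp - (2 * H.h) • toQuat H.vi‖
      ≤ H.projU := by
  set V := toQuat H.vi with hV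
  set W := toQuat H.vf with hW
  have hVn : ‖V‖ = 1 := by simpa [hV]
  have hun : ‖H.uC‖ = 1 := norm_uC hh hi hf h0
  have hus : ‖H.uC - V‖ ≤ ‖W - V‖ := norm_uC_sub_le hh hi hf h0
  have e : H.wC = (2 * H.h) • V + ((3 : ℝ) • (H.Δp - (2 * H.h) • V) - (2 * H.h) • (W - V)) := by
    rw [wC, di, df]; module
  have h1 : inner ℝ V H.uC = 1 + inner ℝ V (H.uC - V) := by
    rw [inner_sub_right, real_inner_self_eq_norm_sq, hVn]; ring
  have h2 := abs_le.1 (abs_real_inner_le_norm V (H.uC - V))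
  rw [hVn, one_mul] at h2
  have h3 := abs_le.1 (abs_real_inner_le_norm
    ((3 : ℝ) • (H.Δp - (2 * H.h) • V) - (2 * H.h) • (W - V)) H.uC)
  rw [hun, mul_one] at h3
  have h4 := norm_sub_le ((3 : ℝ) • (H.Δp - (2 * H.h) • V)) ((2 * H.h) • (W - V))
  rw [norm_smul, norm_smul, Real.norm_of_nonneg (by norm_num : (0 : ℝ) ≤ 3),
    Real.norm_of_nonneg (by linarith : 0 ≤ 2 * H.h)] at h4
  rw [projU, e, inner_add_left, real_inner_smul_left, h1]
  nlinarith [h2.1, h3.1]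

end HermiteData

/-- The scaled coefficients for a family of data. -/
noncomputable def scaledBiarc {ι : Type*} {l : Filter ι} {s : ι → ℝ} (hs : Tendsto s l (𝓝 0))
    (pos : ∀ i, 0 < s i) (H : ι → HermiteData) (φ₀ φ₂ : ι → ℝ) (T k c : ℍ[ℝ])
    (hk : k.re = 0) (hc : c.re = 0) (hh : ∀ i, (H i).h = s i / 2)
    (hi : ∀ i, ‖(H i).vi‖ = 1) (hf : ∀ i, ‖(H i).vf‖ = 1)
    (h0 : ∀ i, toQuat (H i).vi + toQuat (H i).vf ≠ 0)
    (hT : ∀ i, toQuat (H i).vi = T)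
    (hT₁ : Ord l s 3 (fun i => toQuat (H i).vf - (T + s i • k + s i ^ 2 • c)))
    (hΔ : Ord l s 3 (fun i => (s i)⁻¹ • (H i).Δp - (T + (s i / 2) • k + (s i ^ 2 / 3) • c)))
    (hw : Ord l s 2 (fun i => toQuat (H i).wi - k))
    (hU : ∀ i, s i / 2 ≤ (H i).projU) {C : ℝ} (hZ : ∀ i, |(H i).projZ| ≤ C * s i ^ 2)
    (hCC : ∀ i, (H i).IsCC (φ₀ i) (φ₂ i)) : ScaledBiarc l s :=
  have hh0 : ∀ i, 0 < (H i).h := fun i => by rw [hh]; linarith [pos i]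
  have hU0 : ∀ i, 0 < (H i).projU := fun i => lt_of_lt_of_le (by linarith [pos i]) (hU i)
  have hZU : ∀ i, |(H i).projZ| / (H i).projU ≤ 2 * C * s i := fun i => by
    rw [div_le_iff₀ (hU0 i)]
    refine (hZ i).trans ?_
    have hC : 0 ≤ C := by
      have := (abs_nonneg _).trans (hZ i)
      exact nonneg_of_mul_nonneg_left this (pow_pos (pos i) 2)
    have := mul_le_mul_of_nonneg_left (hU i) (mul_nonneg hC (pos i).le)
    nlinarith
  have norm_P : ∀ i, ‖(√(H i).h)⁻¹ • (H i).A0 (φ₀ i)‖ = 1 := fun i => by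
    apply norm_eq_one_of_sq
    rw [sq, norm_scaled_mul (hh0 i), ← sq, HermiteData.norm_sq_A0 (hh0 i) (hi i),
      inv_mul_cancel₀ (hh0 i).ne']
  have prodI_P : ∀ i, prodI ((√(H i).h)⁻¹ • (H i).A0 (φ₀ i)) ((√(H i).h)⁻¹ • (H i).A0 (φ₀ i))
      = T := fun i => by
    rw [prodI_scaled (hh0 i), HermiteData.prodI_A0, smul_smul, inv_mul_cancel₀ (hh0 i).ne',
      one_smul, hT]
  have prodI_Q : ∀ i, prodI ((√(H i).h)⁻¹ • (H i).B2 (φ₂ i)) ((√(H i).h)⁻¹ • (H i).B2 (φ₂ i))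
      = toQuat (H i).vf := fun i => by
    rw [prodI_scaled (hh0 i), HermiteData.prodI_B2, smul_smul, inv_mul_cancel₀ (hh0 i).ne',
      one_smul]
  have T₁_one : Ord l s 1 (fun i => toQuat (H i).vf - T) :=
    (((hT₁.mono hs (show 1 ≤ 3 by norm_num)).add ((ord_self (s := s)).smul (ord_const k))).add
      (((ord_pow (s := s) 2).smul (ord_const c)).mono hs (show 1 ≤ 2 by norm_num))).congr
      fun i => by abel
  have Q_ord : Ord l s 1 (fun i => (√(H i).h)⁻¹ • (H i).B2 (φ₂ i)
      - (√(H i).h)⁻¹ • (H i).A0 (φ₀ i)) := by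
    -- Both components of `Q - P` are `O(s)`: the first because the CC point is near `2h v_i`, the
    -- second because `ν / μ = O(s)`.
    refine ord_of_symI norm_P ?_ ?_
    · have hg : Ord l s 1 (fun i => ‖toQuat (H i).vf - T‖ + 4 * C * s i) :=
        (T₁_one.norm_left).add ((ord_self (s := s)).const_smul (4 * C))
      refine hg.trans_le 2 (Eventually.of_forall fun i => ?_)
      have h1 := (hCC i).norm_symI_sub_le (hh0 i) (hi i) (hf i) (h0 i) (hU0 i)
      have h2 : symI ((√(H i).h)⁻¹ • (H i).B2 (φ₂ i) - (√(H i).h)⁻¹ • (H i).A0 (φ₀ i))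
          ((√(H i).h)⁻¹ • (H i).A0 (φ₀ i)) = (H i).h⁻¹ •
          (symI ((H i).A0 (φ₀ i)) ((H i).B2 (φ₂ i)) - (2 * (H i).h) • toQuat (H i).vi) := by
        have hAA : symI ((H i).A0 (φ₀ i)) ((H i).A0 (φ₀ i)) = (2 * (H i).h) • toQuat (H i).vi := by
          rw [symI, HermiteData.prodI_A0]; module
        rw [← smul_sub, symI_scaled (hh0 i), symI_sub_left, symI_comm ((H i).B2 (φ₂ i)), hAA]
      rw [h2, norm_smul, norm_inv, Real.norm_of_nonneg (hh0 i).le, inv_mul_le_iff₀ (hh0 i)]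
      refine h1.trans ?_
      rw [hT]
      have h3 : ‖toQuat (H i).vf - T‖ + 2 * (|(H i).projZ| / (H i).projU)
          ≤ ‖‖toQuat (H i).vf - T‖ + 4 * C * s i‖ :=
        le_trans (by linarith [hZU i]) (le_abs_self _)
      have := mul_le_mul_of_nonneg_left h3 (hh0 i).le
      linarith
    · refine Ord.of_le (2 * C) (Eventually.of_forall fun i => ?_)
      have h1 := (hCC i).inner_sq_mul_le (hh0 i) (hi i) (hf i) (h0 i) (hU0 i)
      have h2 : inner ℝ ((H i).A0 (φ₀ i)) ((H i).A0 (φ₀ i) * qI) = 0 := by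
        rw [inner_eq]; simp; ring
      rw [← smul_sub, inner_scaled (hh0 i), inner_sub_left, h2, sub_zero, norm_mul, norm_inv,
        Real.norm_of_nonneg (hh0 i).le, inv_mul_le_iff₀ (hh0 i), pow_one, abs_of_pos (pos i),
        Real.norm_eq_abs]
      rw [← le_div_iff₀ (hU0 i), mul_div_assoc] at h1
      exact h1.trans (mul_le_mul_of_nonneg_left (hZU i) (hh0 i).le)
  have E_ord : Ord l s 2 (fun i => (√(H i).h)⁻¹ • (H i).EH (φ₀ i) (φ₂ i)) := by
    -- This is the defect bounding `E`, rewritten with `symI P Q = T + T₁ - (Q - P) i (Q - P)*`. The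
    -- orders zero and one of `6 (T + T₁) - 12 Δ` cancel, leaving `2 s² c` and remainders.
    have hg : Ord l s 2 (fun i => (6 : ℝ) • (T + toQuat (H i).vf)
        - (12 : ℝ) • ((s i)⁻¹ • (H i).Δp)
        - (2 : ℝ) • prodI ((√(H i).h)⁻¹ • (H i).B2 (φ₂ i) - (√(H i).h)⁻¹ • (H i).A0 (φ₀ i))
          ((√(H i).h)⁻¹ • (H i).B2 (φ₂ i) - (√(H i).h)⁻¹ • (H i).A0 (φ₀ i))) := by
      have h2 := (ord_pow (l := l) (s := s) 2).smul (ord_const c)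
      refine (((((hT₁.mono hs (show 2 ≤ 3 by norm_num)).const_smul (6 : ℝ)).sub
        ((hΔ.mono hs (show 2 ≤ 3 by norm_num)).const_smul (12 : ℝ))).add
        (h2.const_smul (2 : ℝ))).sub ((Q_ord.prodI Q_ord).const_smul (2 : ℝ))).congr fun i => ?_
      module
    refine hg.trans_le 1 ?_
    have h3 := (Q_ord.tendsto hs).norm
    rw [norm_zero] at h3
    filter_upwards [h3.eventually_le_const (show (0 : ℝ) < 1 by norm_num)] with i h4
    set P := (√(H i).h)⁻¹ • (H i).A0 (φ₀ i) with hP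
    set Q := (√(H i).h)⁻¹ • (H i).B2 (φ₂ i) with hQ
    have h5 : 1 ≤ ‖P + Q‖ := by
      have := norm_sub_norm_le ((2 : ℝ) • P) (P - Q)
      rw [norm_smul, norm_P, show (2 : ℝ) • P - (P - Q) = P + Q by module, norm_sub_rev] at this
      norm_num at this
      linarith
    have h6 := (hCC i).norm_EH_mul_le
    have h7 : (6 : ℝ) • (T + toQuat (H i).vf) - (12 : ℝ) • ((s i)⁻¹ • (H i).Δp)
        - (2 : ℝ) • prodI (Q - P) (Q - P) = (H i).h⁻¹ •
        ((4 * (H i).h) • (toQuat (H i).vi + toQuat (H i).vf)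
        + (2 : ℝ) • symI ((H i).A0 (φ₀ i)) ((H i).B2 (φ₂ i)) - (6 : ℝ) • (H i).Δp) := by
      have h8 : prodI (Q - P) (Q - P) = T + toQuat (H i).vf - symI P Q := by
        rw [← prodI_P i, ← prodI_Q i, ← hP, ← hQ]
        simp only [symI, prodI_sub_left, prodI_sub_right]
        abel
      have h9 : (s i)⁻¹ = (1 / 2) * (H i).h⁻¹ := by rw [hh]; field_simp
      have h10 : (H i).h⁻¹ • ((4 * (H i).h) • (toQuat (H i).vi + toQuat (H i).vf))
          = (4 : ℝ) • (T + toQuat (H i).vf) := by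
        rw [smul_smul, hT, show (H i).h⁻¹ * (4 * (H i).h) = 4 by
          have := (hh0 i).ne'; field_simp]
      rw [h8, hP, hQ, symI_scaled (hh0 i), h9, smul_sub (H i).h⁻¹, smul_add (H i).h⁻¹, h10]
      module
    rw [one_mul, h7, norm_smul (H i).h⁻¹, norm_inv, Real.norm_of_nonneg (hh0 i).le]
    have h11 := mul_le_mul_of_nonneg_left h6 (inv_nonneg.2 (hh0 i).le)
    rw [← norm_scaled_mul (hh0 i), smul_add] at h11
    refine le_trans ?_ h11
    exact le_mul_of_one_le_right (norm_nonneg _) h5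
  have hG : ∀ i, (√(H i).h)⁻¹ • (H i).A0 (φ₀ i)
      - (8 : ℝ) • ((√(H i).h)⁻¹ • (H i).A1 (φ₀ i) (φ₂ i))
      + (7 : ℝ) • ((√(H i).h)⁻¹ • (H i).B2 (φ₂ i))
      = (√(H i).h)⁻¹ • (H i).G (φ₀ i) (φ₂ i) := fun i => by
    rw [HermiteData.G]; module
  have hA2H : ∀ i, (1 / 2 : ℝ) • ((√(H i).h)⁻¹ • (H i).A0 (φ₀ i)
      + (√(H i).h)⁻¹ • (H i).B2 (φ₂ i)) - (1 / 4 : ℝ) • ((√(H i).h)⁻¹ • (H i).EH (φ₀ i) (φ₂ i))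
      = (√(H i).h)⁻¹ • (H i).A2H (φ₀ i) (φ₂ i) := fun i => by
    rw [HermiteData.A2H_eq]; module
  have hadd : ∀ (i : ι) (x y : ℍ[ℝ]), (√(H i).h)⁻¹ • x + (1 / 40 : ℝ) • ((√(H i).h)⁻¹ • y)
      = (√(H i).h)⁻¹ • (x + (1 / 40 : ℝ) • y) := fun i x y => by module
  { tendsto := hs
    T := T
    k := k
    c := c
    hk := hk
    hc := hc
    pos := pos
    P := fun i => (√(H i).h)⁻¹ • (H i).A0 (φ₀ i)
    Q := fun i => (√(H i).h)⁻¹ • (H i).B2 (φ₂ i)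
    E := fun i => (√(H i).h)⁻¹ • (H i).EH (φ₀ i) (φ₂ i)
    a₁ := fun i => (√(H i).h)⁻¹ • (H i).A1 (φ₀ i) (φ₂ i)
    a₂ := fun i => (√(H i).h)⁻¹ • (H i).A2 (φ₀ i) (φ₂ i)
    w := fun i => toQuat (H i).wi
    T₁ := fun i => toQuat (H i).vf
    Δ := fun i => (s i)⁻¹ • (H i).Δp
    norm_P := norm_P
    prodI_P := prodI_P
    prodI_Q := prodI_Q
    T₁_ord := hT₁
    Δ_ord := hΔ
    w_ord := hw
    Q_ord := Q_ord
    E_ord := E_ord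
    symI_a₁ := fun i => by
      rw [symI_scaled (hh0 i), HermiteData.symI_A1 (hh0 i) (hi i), HermiteData.dvec, hT, smul_smul,
        smul_smul, show (H i).h⁻¹ * 2 * ((H i).h / 4) = 1 / 2 by
          have := (hh0 i).ne'; field_simp; norm_num, hh]
      module
    inner_a₁ := fun i => by
      rw [inner_scaled (hh0 i), HermiteData.inner_A1 (hh0 i) (hi i), HermiteData.A1H_eq,
        ← inner_scaled (hh0 i)]
      congr 1
      module
    prodI_a₂ := fun i => by
      have hsh : s i = 2 * (H i).h := by rw [hh]; ring
      have hc2 : (2 : ℝ) • ((s i)⁻¹ • (H i).Δp) - (1 / 5 : ℝ) • (toQuat (H i).vf + T)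
          - (1 / 20 : ℝ) • ((s i / 2) • toQuat (H i).wi + (4 : ℝ) • T) = (H i).h⁻¹ • (H i).c := by
        have h1 : (H i).h⁻¹ * (H i).h = 1 := inv_mul_cancel₀ (hh0 i).ne'
        rw [HermiteData.c, hT, hsh, mul_inv]
        have e1 : (H i).h⁻¹ • ((H i).Δp - ((H i).h / 5) • (toQuat (H i).vf + T)
            - (1 / 20 : ℝ) • (((H i).h ^ 2) • toQuat (H i).wi + (4 * (H i).h) • T))
            = (H i).h⁻¹ • (H i).Δp - (((H i).h⁻¹ * (H i).h) / 5) • (toQuat (H i).vf + T)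
            - (1 / 20 : ℝ) • (((H i).h⁻¹ * (H i).h * (H i).h) • toQuat (H i).wi
              + (4 * ((H i).h⁻¹ * (H i).h)) • T) := by module
        rw [e1, h1]
        module
      rw [hG, hadd, prodI_scaled (hh0 i), prodI_scaled (hh0 i), symI_scaled (hh0 i),
        prodI_scaled (hh0 i), hc2, HermiteData.prodI_A2, HermiteData.b]
      module
    norm_a₂ := fun i => by
      rw [hG, hA2H, hadd, hadd, ← smul_sub, prodI_scaled (hh0 i), prodI_scaled (hh0 i),
        ← smul_sub, norm_scaled_mul (hh0 i), norm_smul, norm_inv, Real.norm_of_nonneg (hh0 i).le]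
      exact mul_le_mul_of_nonneg_left (HermiteData.norm_A2_sub_mul_le _ _)
        (inv_nonneg.2 (hh0 i).le) }

end PHBiarc

namespace PHBiarc

open Filter Asymptotics Topology Set

/-! ### From hodographs to curves -/

/-- Mean value inequality for the error. Both parameters are free, so the error can be anchored at
either end of an arc. -/
lemma norm_sub_sub_sub_le {h a B : ℝ} (hh : 0 < h) {x x' r r' : ℝ → E3}
    (hx : ∀ τ, HasDerivAt x (x' τ) τ)
    (hr : ∀ u ∈ Icc a (a + h), HasDerivWithinAt r (r' u) (Icc a (a + h)) u)
    (hb : ∀ τ ∈ Icc (0 : ℝ) 1, ‖h⁻¹ • x' τ - r' (a + τ * h)‖ ≤ B)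
    {τ σ : ℝ} (hτ : τ ∈ Icc (0 : ℝ) 1) (hσ : σ ∈ Icc (0 : ℝ) 1) :
    ‖(x τ - r (a + τ * h)) - (x σ - r (a + σ * h))‖ ≤ h * B := by
  have hmaps : MapsTo (fun τ : ℝ => a + τ * h) (Icc 0 1) (Icc a (a + h)) := fun τ hτ =>
    ⟨by nlinarith [hτ.1], by nlinarith [hτ.2]⟩
  have hd : ∀ t ∈ Icc (0 : ℝ) 1, HasDerivWithinAt (fun τ => x τ - r (a + τ * h))
      (x' t - h • r' (a + t * h)) (Icc 0 1) t := by
    intro t ht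
    have h1 : HasDerivWithinAt (fun τ : ℝ => a + τ * h) h (Icc 0 1) t := by
      simpa using (((hasDerivAt_id t).mul_const h).const_add a).hasDerivWithinAt
    exact (hx t).hasDerivWithinAt.sub ((hr _ (hmaps ht)).scomp t h1 hmaps)
  have hB : ∀ t ∈ Icc (0 : ℝ) 1, ‖x' t - h • r' (a + t * h)‖ ≤ h * B := by
    intro t ht
    rw [show x' t - h • r' (a + t * h) = h • (h⁻¹ • x' t - r' (a + t * h)) by
      rw [smul_sub, smul_smul, mul_inv_cancel₀ hh.ne', one_smul], norm_smul,
      Real.norm_of_nonneg hh.le]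
    exact mul_le_mul_of_nonneg_left (hb t ht) hh.le
  refine ((convex_Icc 0 1).norm_image_sub_le_of_norm_hasDerivWithin_le hd hB hσ hτ).trans ?_
  have h0 : 0 ≤ h * B := (norm_nonneg _).trans (hB τ hτ)
  refine mul_le_of_le_one_right h0 ?_
  rw [Real.norm_eq_abs, abs_le]
  constructor <;> linarith [hτ.1, hτ.2, hσ.1, hσ.2]

lemma HermiteData.iteratedDerivWithin_biarc {H : HermiteData} (hh : 0 < H.h) (φ₀ φ₂ : ℝ) :
    iteratedDerivWithin 2 (H.biarc φ₀ φ₂) (Icc H.ui H.uf) H.uf =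
      (H.h⁻¹ * H.h⁻¹) •
        vecPart ((2 : ℝ) • symI (H.B2 φ₂ - H.B1 φ₀ φ₂) (H.B2 φ₂)) := by
  have huf : H.uf = H.ui + 2 * H.h := by rw [HermiteData.h]; ring
  have hum : H.um < H.uf := by rw [huf, HermiteData.um]; linarith
  have hlt : H.ui < H.uf := by rw [huf]; linarith
  have hlin : ∀ u, HasDerivAt (fun u : ℝ => (u - H.um) / H.h) H.h⁻¹ u := fun u => by
    simpa using ((hasDerivAt_id u).sub_const H.um).div_const H.h
  set x := bezier5 (ctrlFinal (toQuat H.pf) (H.B0 φ₀ φ₂) (H.B1 φ₀ φ₂) (H.B2 φ₂)) with hx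
  set x' : ℝ → E3 := fun τ => vecPart (prodI (preimage (H.B0 φ₀ φ₂) (H.B1 φ₀ φ₂) (H.B2 φ₂) τ)
    (preimage (H.B0 φ₀ φ₂) (H.B1 φ₀ φ₂) (H.B2 φ₂) τ)) with hx'
  have hd1 : ∀ u, HasDerivAt (fun u => x ((u - H.um) / H.h)) (H.h⁻¹ • x' ((u - H.um) / H.h)) u :=
    fun u => (hasDerivAt_ctrlFinal _ _ _ _ _).scomp u (hlin u)
  have hone : (H.uf - H.um) / H.h = 1 := by
    rw [huf, HermiteData.um]; field_simp; ring
  have hd2 : HasDerivAt (fun u => H.h⁻¹ • x' ((u - H.um) / H.h))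
      (H.h⁻¹ • H.h⁻¹ • vecPart ((2 : ℝ) • symI (H.B2 φ₂ - H.B1 φ₀ φ₂) (H.B2 φ₂))) H.uf := by
    have h1 : HasDerivAt x' (vecPart ((2 : ℝ) • symI (H.B2 φ₂ - H.B1 φ₀ φ₂) (H.B2 φ₂)))
        ((H.uf - H.um) / H.h) := by
      rw [hone]
      exact hasDerivAt_hodograph_one _ _ _
    exact (h1.scomp H.uf (hlin H.uf)).const_smul H.h⁻¹
  have huniq := uniqueDiffOn_Icc hlt
  have hmem : H.uf ∈ Icc H.ui H.uf := right_mem_Icc.2 hlt.le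
  -- Near the right end only the second arc is active, so smoothness at the joint is irrelevant
  -- here.
  have heq : H.biarc φ₀ φ₂ =ᶠ[𝓝[Icc H.ui H.uf] H.uf] fun u => x ((u - H.um) / H.h) := by
    refine Filter.Eventually.filter_mono nhdsWithin_le_nhds ?_
    filter_upwards [lt_mem_nhds hum] with u hu
    rw [HermiteData.biarc, if_neg (not_le.2 hu)]
  rw [heq.iteratedDerivWithin_eq (heq.eq_of_nhdsWithin hmem), iteratedDerivWithin_succ,
    iteratedDerivWithin_one, derivWithin_congr (f := fun u => H.h⁻¹ • x' ((u - H.um) / H.h))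
      (fun u hu => (hd1 u).hasDerivWithinAt.derivWithin (huniq u hu))
      ((hd1 _).hasDerivWithinAt.derivWithin (huniq _ hmem)),
    hd2.hasDerivWithinAt.derivWithin (huniq _ hmem), smul_smul]

/-- Along `comap s (𝓝 0)` a big-O statement is a bound uniform over all indices with small `s`,
whatever else they contain. -/
lemma exists_forall_norm_le {ι E : Type*} [NormedAddCommGroup E] {s : ι → ℝ} (pos : ∀ i, 0 < s i)
    {n : ℕ} {f : ι → E} (hf : Ord (comap s (𝓝 0)) s n f) :
    ∃ C δ : ℝ, 0 ≤ C ∧ 0 < δ ∧ ∀ i, s i ≤ δ → ‖f i‖ ≤ C * s i ^ n := by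
  obtain ⟨C, hC0, hC⟩ := IsBigO.exists_nonneg hf
  obtain ⟨δ, hδ, h⟩ := Metric.eventually_nhds_iff.1 (eventually_comap.1 hC.bound)
  refine ⟨C, δ / 2, hC0, half_pos hδ, fun i hi => ?_⟩
  have := h (y := s i) (by
    rw [Real.dist_eq, sub_zero, abs_of_pos (pos i)]; linarith) i rfl
  simpa [abs_of_pos (pos i)] using this

/-! ### Expansions of the sampled curve -/

section Curve

variable {L : ℝ} {r : ℝ → E3}

lemma exists_taylor_position (hL : 0 < L) (hr : ContDiffOn ℝ 10 r (Icc 0 L)) :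
    ∃ C, ∀ x ∈ Icc 0 L, ‖r x - r 0 - (x • derivWithin r (Icc 0 L) 0
      + (x ^ 2 / 2) • iteratedDerivWithin 2 r (Icc 0 L) 0
      + (x ^ 3 / 6) • iteratedDerivWithin 3 r (Icc 0 L) 0)‖ ≤ C * x ^ 4 := by
  obtain ⟨C, hC⟩ := exists_taylor hL 0 3 (r := r) (hr.of_le (by norm_cast))
  refine ⟨C, fun x hx => (le_of_eq ?_).trans (hC x hx)⟩
  simp only [Finset.sum_range_succ, Finset.sum_range_zero, Nat.factorial, zero_add,
    iteratedDerivWithin_zero, iteratedDerivWithin_one, add_zero]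
  congr 1
  push_cast
  module

lemma exists_taylor_velocity (hL : 0 < L) (hr : ContDiffOn ℝ 10 r (Icc 0 L)) :
    ∃ C, ∀ x ∈ Icc 0 L, ‖derivWithin r (Icc 0 L) x - (derivWithin r (Icc 0 L) 0
      + x • iteratedDerivWithin 2 r (Icc 0 L) 0
      + (x ^ 2 / 2) • iteratedDerivWithin 3 r (Icc 0 L) 0)‖ ≤ C * x ^ 3 := by
  obtain ⟨C, hC⟩ := exists_taylor hL 1 2 (r := r) (hr.of_le (by norm_cast))
  refine ⟨C, fun x hx => (le_of_eq ?_).trans (hC x hx)⟩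
  simp only [Finset.sum_range_succ, Finset.sum_range_zero, Nat.factorial, zero_add,
    iteratedDerivWithin_one, Nat.reduceAdd]
  congr 1
  push_cast
  module

lemma exists_taylor_acceleration (hL : 0 < L) (hr : ContDiffOn ℝ 10 r (Icc 0 L)) :
    ∃ C, ∀ x ∈ Icc 0 L, ‖iteratedDerivWithin 2 r (Icc 0 L) x
      - (iteratedDerivWithin 2 r (Icc 0 L) 0
      + x • iteratedDerivWithin 3 r (Icc 0 L) 0)‖ ≤ C * x ^ 2 := by
  obtain ⟨C, hC⟩ := exists_taylor hL 2 1 (r := r) (hr.of_le (by norm_cast))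
  refine ⟨C, fun x hx => (le_of_eq ?_).trans (hC x hx)⟩
  simp only [Finset.sum_range_succ, Finset.sum_range_zero, Nat.factorial, zero_add,
    Nat.reduceAdd]
  congr 1
  push_cast
  module

lemma sampledData_h (Δs : ℝ) (w : E3) : (sampledData r L Δs w).h = Δs / 2 := by
  simp [HermiteData.h, sampledData]

lemma sampledData_Δp (Δs : ℝ) (w : E3) :
    (sampledData r L Δs w).Δp = toQuat (r Δs - r 0) := by
  rw [toQuat_sub]; rfl

/-- For small intervals the reference curve of the sampled data is well defined. -/
lemma exists_forall_projU_projZ (hL : 0 < L) (hr : ContDiffOn ℝ 10 r (Icc 0 L))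
    (harc : ∀ s ∈ Icc 0 L, ‖derivWithin r (Icc 0 L) s‖ = 1)
    (hflat : (∃ k : ℕ, 2 ≤ k ∧ k ≤ 9 ∧ iteratedDerivWithin k r (Icc 0 L) 0 ≠ 0) ∨
      (∃ ρ ∈ Ioc 0 L, ∀ s ∈ Icc 0 ρ, r s = r 0 + s • derivWithin r (Icc 0 L) 0)) :
    ∃ C δ : ℝ, 0 < δ ∧ δ ≤ L ∧ ∀ Δs, 0 < Δs → Δs ≤ δ → ∀ w : E3,
      toQuat (sampledData r L Δs w).vi + toQuat (sampledData r L Δs w).vf ≠ 0 ∧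
      Δs / 2 ≤ (sampledData r L Δs w).projU ∧
      |(sampledData r L Δs w).projZ| ≤ C * Δs ^ 2 := by
  obtain ⟨C, ε, c, hε, hεL, hC⟩ := exists_norm_sub_smul_le hL hr hflat
  obtain ⟨M₀, hM₀⟩ := exists_taylor hL 0 1 (r := r) (hr.of_le (by norm_cast))
  obtain ⟨M₁, hM₁⟩ := exists_taylor hL 1 0 (r := r) (hr.of_le (by norm_cast))
  simp only [Finset.sum_range_succ, Finset.sum_range_zero, Nat.factorial, zero_add,
    iteratedDerivWithin_zero, iteratedDerivWithin_one, add_zero, pow_zero, pow_one,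
    Nat.cast_one, inv_one, one_mul, one_smul, mul_one, Nat.reduceAdd] at hM₀ hM₁
  set M := max (max M₀ M₁) 0 with hM
  have hMn : 0 ≤ M := le_max_right _ _
  -- For these `s` the estimate `projU ≥ s - 5 M s²` of `le_projU` exceeds `s / 2`, and the tangents
  -- turn too little to be opposite.
  refine ⟨6 * max C 0, min ε (1 / (14 * (M + 1))), lt_min hε (by positivity),
    (min_le_left _ _).trans hεL, fun s hs hsδ w => ?_⟩
  have hsε := hsδ.trans (min_le_left _ _)
  have hsM : s * (14 * (M + 1)) ≤ 1 := by
    have := hsδ.trans (min_le_right _ _)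
    rwa [le_div_iff₀ (by positivity)] at this
  have hsL : s ∈ Icc 0 L := ⟨hs.le, hsε.trans hεL⟩
  set H := sampledData r L s w with hH
  have hh : H.h = s / 2 := sampledData_h s w
  have hh0 : 0 < H.h := by rw [hh]; linarith
  have hi : ‖H.vi‖ = 1 := harc 0 ⟨le_rfl, hL.le⟩
  have hf : ‖H.vf‖ = 1 := harc s hsL
  have hΔ : H.Δp = toQuat (r s - r 0) := sampledData_Δp s w
  have hV : ‖toQuat H.vf - toQuat H.vi‖ ≤ M * s := by
    rw [← toQuat_sub, norm_toQuat]
    refine (hM₁ s hsL).trans ?_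
    gcongr
    exact (le_max_right _ _).trans (le_max_left _ _)
  have hP : ‖H.Δp - (2 * H.h) • toQuat H.vi‖ ≤ M * s ^ 2 := by
    rw [hΔ, ← toQuat_smul, ← toQuat_sub, norm_toQuat, hh, mul_div_cancel₀ s two_ne_zero, sub_sub]
    refine (hM₀ s hsL).trans ?_
    gcongr
    exact (le_max_left _ _).trans (le_max_left _ _)
  have h0 : toQuat H.vi + toQuat H.vf ≠ 0 := by
    intro h
    have h1 : toQuat H.vf - toQuat H.vi = -((2 : ℝ) • toQuat H.vi) := by
      rw [eq_neg_of_add_eq_zero_right h]; module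
    rw [h1, norm_neg, norm_smul, norm_toQuat, hi] at hV
    norm_num at hV
    nlinarith
  refine ⟨h0, ?_, ?_⟩
  · refine le_trans ?_ (HermiteData.le_projU hh0 hi hf h0)
    rw [hh] at hP ⊢
    have h1 := mul_le_mul_of_nonneg_left hV hs.le
    have h2 := mul_le_mul_of_nonneg_left hsM hs.le
    nlinarith
  · have h1 := hC s hs hsε
    rw [mul_assoc]
    refine HermiteData.abs_projZ_le hh0 hi hf h0 (a := s) (b := c * s) (by positivity) ?_
    rw [hΔ, ← toQuat_sub, ← toQuat_smul, ← toQuat_smul, ← toQuat_sub, ← toQuat_sub, norm_toQuat,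
      norm_toQuat]
    exact h1.trans (mul_le_mul_of_nonneg_right
      (mul_le_mul_of_nonneg_right (le_max_left _ _) (sq_nonneg s)) (norm_nonneg _))

end Curve

end PHBiarc

namespace PHBiarc

open Filter Asymptotics Topology Set

/-! ### Uniform bounds over all admissible data, and the proposition. -/

lemma norm_vecPart_sub_le (q : ℍ[ℝ]) (v : E3) : ‖vecPart q - v‖ ≤ ‖q - toQuat v‖ := by
  have := norm_vecPart_le (q - toQuat v)
  rwa [vecPart_sub, vecPart_toQuat] at this

lemma preimage_scaled {h : ℝ} (hh : 0 < h) (X Y Z : ℍ[ℝ]) (τ : ℝ) :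
    prodI (preimage ((√h)⁻¹ • X) ((√h)⁻¹ • Y) ((√h)⁻¹ • Z) τ)
      (preimage ((√h)⁻¹ • X) ((√h)⁻¹ • Y) ((√h)⁻¹ • Z) τ)
      = h⁻¹ • prodI (preimage X Y Z τ) (preimage X Y Z τ) := by
  rw [preimage_smul, prodI_scaled hh]

lemma sub_model_sub_sub_model (X Y U k c : ℍ[ℝ]) (a b : ℝ) :
    X - (U + (a * b) • k + (a ^ 2 * b ^ 2) • c) - (Y - (U + (a * b) • k + (a * b) ^ 2 • c))
      = X - Y := by
  rw [mul_pow]; abel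

/-- Uniform bounds for the hodographs and for the second derivative at the right end. -/
lemma exists_hodograph_bounds {L : ℝ} (hL : 0 < L) {r : ℝ → E3}
    (hr : ContDiffOn ℝ 10 r (Icc 0 L))
    (harc : ∀ s ∈ Icc 0 L, ‖derivWithin r (Icc 0 L) s‖ = 1)
    (hflat : (∃ k : ℕ, 2 ≤ k ∧ k ≤ 9 ∧ iteratedDerivWithin k r (Icc 0 L) 0 ≠ 0) ∨
      (∃ ρ ∈ Ioc 0 L, ∀ s ∈ Icc 0 ρ, r s = r 0 + s • derivWithin r (Icc 0 L) 0))
    (K : ℝ) :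
    ∃ C δ : ℝ, 0 < δ ∧ δ ≤ L ∧ ∀ Δs : ℝ, 0 < Δs → Δs ≤ δ →
      ∀ w : E3, ‖w - iteratedDerivWithin 2 r (Icc 0 L) 0‖ ≤ K * Δs ^ 2 →
        (∃ φ₀ φ₂ : ℝ, (sampledData r L Δs w).IsCC φ₀ φ₂) ∧
        ∀ φ₀ φ₂ : ℝ, (sampledData r L Δs w).IsCC φ₀ φ₂ →
          (∀ τ ∈ Icc (0 : ℝ) 1,
            ‖(Δs / 2)⁻¹ • vecPart (prodI
                (preimage ((sampledData r L Δs w).A0 φ₀) ((sampledData r L Δs w).A1 φ₀ φ₂)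
                  ((sampledData r L Δs w).A2 φ₀ φ₂) τ)
                (preimage ((sampledData r L Δs w).A0 φ₀) ((sampledData r L Δs w).A1 φ₀ φ₂)
                  ((sampledData r L Δs w).A2 φ₀ φ₂) τ))
              - derivWithin r (Icc 0 L) (τ * (Δs / 2))‖ ≤ C * Δs ^ 3) ∧
          (∀ τ ∈ Icc (0 : ℝ) 1,
            ‖(Δs / 2)⁻¹ • vecPart (prodI
                (preimage ((sampledData r L Δs w).B0 φ₀ φ₂) ((sampledData r L Δs w).B1 φ₀ φ₂)
                  ((sampledData r L Δs w).B2 φ₂) τ)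
                (preimage ((sampledData r L Δs w).B0 φ₀ φ₂) ((sampledData r L Δs w).B1 φ₀ φ₂)
                  ((sampledData r L Δs w).B2 φ₂) τ))
              - derivWithin r (Icc 0 L) (Δs / 2 + τ * (Δs / 2))‖ ≤ C * Δs ^ 3) ∧
          ‖((Δs / 2)⁻¹ * (Δs / 2)⁻¹) • vecPart ((2 : ℝ) • symI ((sampledData r L Δs w).B2 φ₂
                - (sampledData r L Δs w).B1 φ₀ φ₂) ((sampledData r L Δs w).B2 φ₂))
              - iteratedDerivWithin 2 r (Icc 0 L) Δs‖ ≤ C * Δs ^ 2 := by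
  obtain ⟨CZ, δ₀, hδ₀, hδ₀L, hUZ⟩ := exists_forall_projU_projZ hL hr harc hflat
  obtain ⟨C₀, hC₀⟩ := exists_taylor_position hL hr
  obtain ⟨C₁, hC₁⟩ := exists_taylor_velocity hL hr
  obtain ⟨C₂, hC₂⟩ := exists_taylor_acceleration hL hr
  set S := Icc 0 L with hS
  set D := derivWithin r S with hD
  set r₂ := iteratedDerivWithin 2 r S 0 with hr₂
  set r₃ := iteratedDerivWithin 3 r S 0 with hr₃
  -- An index is a tuple of `Δs`, a second derivative, two CC angles and a curve parameter, so the
  -- constants obtained do not depend on any of them.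
  let ι := {a : ℝ × E3 × ℝ × ℝ × ℝ // 0 < a.1 ∧ a.1 ≤ δ₀ ∧ ‖a.2.1 - r₂‖ ≤ K * a.1 ^ 2 ∧
    (sampledData r L a.1 a.2.1).IsCC a.2.2.1 a.2.2.2.1 ∧ a.2.2.2.2 ∈ Icc (0 : ℝ) 1}
  let s : ι → ℝ := fun i => i.1.1
  let l : Filter ι := comap s (𝓝 0)
  let τ : ι → ℝ := fun i => i.1.2.2.2.2
  let H : ι → HermiteData := fun i => sampledData r L i.1.1 i.1.2.1
  have hs : Tendsto s l (𝓝 0) := tendsto_comap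
  have pos : ∀ i, 0 < s i := fun i => i.2.1
  have hsL : ∀ i, s i ∈ S := fun i => ⟨i.2.1.le, i.2.2.1.trans hδ₀L⟩
  have hτ : ∀ i, τ i ∈ Icc (0 : ℝ) 1 := fun i => i.2.2.2.2.2
  have hh : ∀ i, (H i).h = s i / 2 := fun i => sampledData_h _ _
  have hvel : ∀ {σ : ι → ℝ}, (∀ i, σ i ∈ Icc 0 (s i)) →
      Ord l s 3 (fun i => toQuat (D (σ i)) -
        (toQuat (D 0) + σ i • toQuat r₂ + σ i ^ 2 • ((1 / 2 : ℝ) • toQuat r₃))) := by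
    intro σ hσ
    refine Ord.of_le (max C₁ 0) (Eventually.of_forall fun i => ?_)
    have h1 := hC₁ (σ i) ⟨(hσ i).1, (hσ i).2.trans (hsL i).2⟩
    rw [smul_smul, mul_one_div, ← toQuat_smul, ← toQuat_smul, ← toQuat_add, ← toQuat_add,
      ← toQuat_sub, norm_toQuat, abs_of_pos (pos i)]
    refine h1.trans ?_
    have h2 := (hσ i).1
    calc C₁ * σ i ^ 3 ≤ max C₁ 0 * σ i ^ 3 := by gcongr; exact le_max_left _ _
      _ ≤ _ := by gcongr; exact (hσ i).2
  have hΔ : Ord l s 3 (fun i => (s i)⁻¹ • (H i).Δp - (toQuat (D 0) + (s i / 2) • toQuat r₂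
      + (s i ^ 2 / 3) • ((1 / 2 : ℝ) • toQuat r₃))) := by
    refine Ord.of_le C₀ (Eventually.of_forall fun i => ?_)
    have h1 := hC₀ (s i) (hsL i)
    have hp := pos i
    have h2 : (s i)⁻¹ • (H i).Δp - (toQuat (D 0) + (s i / 2) • toQuat r₂
        + (s i ^ 2 / 3) • ((1 / 2 : ℝ) • toQuat r₃)) =
        toQuat ((s i)⁻¹ • (r (s i) - r 0 - (s i • D 0 + (s i ^ 2 / 2) • r₂
          + (s i ^ 3 / 6) • r₃))) := by
      rw [show (H i).Δp = toQuat (r (s i) - r 0) from sampledData_Δp _ _]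
      simp only [smul_smul, ← toQuat_smul, ← toQuat_add, ← toQuat_sub]
      have e1 : (s i)⁻¹ * (s i ^ 2 / 2) = s i / 2 := by field_simp
      have e2 : (s i)⁻¹ * (s i ^ 3 / 6) = s i ^ 2 / 3 * (1 / 2) := by field_simp; norm_num
      rw [smul_sub (s i)⁻¹ (r (s i) - r 0), smul_add, smul_add, smul_smul, smul_smul, smul_smul,
        inv_mul_cancel₀ hp.ne', one_smul, e1, e2]
    rw [h2, norm_toQuat, norm_smul, norm_inv, Real.norm_of_nonneg hp.le, abs_of_pos hp,
      inv_mul_le_iff₀ hp]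
    refine h1.trans (le_of_eq ?_)
    ring
  have hw : Ord l s 2 (fun i => toQuat (H i).wi - toQuat r₂) := by
    refine Ord.of_le K (Eventually.of_forall fun i => ?_)
    rw [← toQuat_sub, norm_toQuat, abs_of_pos (pos i)]
    exact i.2.2.2.1
  let B := scaledBiarc hs pos H (fun i => i.1.2.2.1) (fun i => i.1.2.2.2.1) (toQuat (D 0))
    (toQuat r₂) ((1 / 2 : ℝ) • toQuat r₃) rfl (by simp) hh
    (fun i => harc 0 ⟨le_rfl, hL.le⟩) (fun i => harc _ (hsL i))
    (fun i => (hUZ _ i.2.1 i.2.2.1 _).1) (fun i => rfl)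
    (hvel (σ := s) fun i => ⟨(pos i).le, le_rfl⟩) hΔ hw
    (fun i => (hUZ _ i.2.1 i.2.2.1 _).2.1) (fun i => (hUZ _ i.2.1 i.2.2.1 _).2.2)
    (fun i => i.2.2.2.2.1)
  -- The hodograph and `r'` are both compared with the Taylor polynomial, which then cancels.
  have b1 := (B.prodI_first hτ).sub (hvel (σ := fun i => τ i / 2 * s i) fun i =>
    ⟨mul_nonneg (by linarith [(hτ i).1]) (pos i).le,
      mul_le_of_le_one_left (pos i).le (by linarith [(hτ i).2])⟩)
  have b2 := (B.prodI_second hτ).sub (hvel (σ := fun i => (1 + τ i) / 2 * s i) fun i =>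
    ⟨mul_nonneg (by linarith [(hτ i).1]) (pos i).le,
      mul_le_of_le_one_left (pos i).le (by linarith [(hτ i).2])⟩)
  obtain ⟨M₁, δ₁, hM₁, hδ₁, h1⟩ := exists_forall_norm_le pos b1
  obtain ⟨M₂, δ₂, hM₂, hδ₂, h2⟩ := exists_forall_norm_le pos b2
  obtain ⟨M₃, δ₃, hM₃, hδ₃, h3⟩ := exists_forall_norm_le pos B.symI_last
  set M := max (max M₁ M₂) (4 * M₃ + C₂)
  refine ⟨M, min δ₀ (min δ₁ (min δ₂ δ₃)), lt_min hδ₀ (lt_min hδ₁ (lt_min hδ₂ hδ₃)),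
    (min_le_left _ _).trans hδ₀L,
    fun Δs hΔs hΔδ w hwK => ?_⟩
  have hd₀ : Δs ≤ δ₀ := hΔδ.trans (min_le_left _ _)
  have hd₁ : Δs ≤ δ₁ := hΔδ.trans ((min_le_right _ _).trans (min_le_left _ _))
  have hd₂ : Δs ≤ δ₂ :=
    hΔδ.trans ((min_le_right _ _).trans ((min_le_right _ _).trans (min_le_left _ _)))
  have hd₃ : Δs ≤ δ₃ :=
    hΔδ.trans ((min_le_right _ _).trans ((min_le_right _ _).trans (min_le_right _ _)))
  have hMle₁ : M₁ ≤ M := (le_max_left _ _).trans (le_max_left _ _)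
  have hMle₂ : M₂ ≤ M := (le_max_right _ _).trans (le_max_left _ _)
  have hΔL : Δs ∈ S := ⟨hΔs.le, hd₀.trans hδ₀L⟩
  have hΔ2 : 0 < Δs / 2 := by linarith
  obtain ⟨g0, gU, gZ⟩ := hUZ Δs hΔs hd₀ w
  refine ⟨HermiteData.exists_isCC (by rw [sampledData_h]; linarith) (harc 0 ⟨le_rfl, hL.le⟩)
    (harc _ hΔL) g0 (by linarith), fun φ₀ φ₂ hCC => ⟨fun t ht => ?_, fun t ht => ?_, ?_⟩⟩
  · let i : ι := ⟨(Δs, w, φ₀, φ₂, t), hΔs, hd₀, hwK, hCC, ht⟩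
    have h5 := preimage_scaled (h := (sampledData r L Δs w).h) (by rw [sampledData_h]; exact hΔ2)
      ((sampledData r L Δs w).A0 φ₀) ((sampledData r L Δs w).A1 φ₀ φ₂)
      ((sampledData r L Δs w).A2 φ₀ φ₂) t
    rw [← vecPart_smul, show (Δs / 2)⁻¹ = (sampledData r L Δs w).h⁻¹ by rw [sampledData_h], ← h5]
    refine (norm_vecPart_sub_le _ _).trans (le_trans (le_of_eq ?_) ((h1 i hd₁).trans
      (mul_le_mul_of_nonneg_right (hMle₁) (pow_pos hΔs 3).le)))
    rw [show t * (Δs / 2) = t / 2 * Δs by ring]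
    exact congrArg norm (sub_model_sub_sub_model _ _ (toQuat (D 0)) (toQuat r₂)
      ((1 / 2 : ℝ) • toQuat r₃) (t / 2) Δs).symm
  · let i : ι := ⟨(Δs, w, φ₀, φ₂, t), hΔs, hd₀, hwK, hCC, ht⟩
    have h5 := preimage_scaled (h := (sampledData r L Δs w).h) (by rw [sampledData_h]; exact hΔ2)
      ((sampledData r L Δs w).B0 φ₀ φ₂) ((sampledData r L Δs w).B1 φ₀ φ₂)
      ((sampledData r L Δs w).B2 φ₂) t
    rw [← vecPart_smul, show (Δs / 2)⁻¹ = (sampledData r L Δs w).h⁻¹ by rw [sampledData_h], ← h5,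
      HermiteData.B1, HermiteData.B0, smul_sub, smul_comm _ (2 : ℝ)]
    refine (norm_vecPart_sub_le _ _).trans (le_trans (le_of_eq ?_) ((h2 i hd₂).trans
      (mul_le_mul_of_nonneg_right (hMle₂) (pow_pos hΔs 3).le)))
    rw [show Δs / 2 + t * (Δs / 2) = (1 + t) / 2 * Δs by ring]
    exact congrArg norm (sub_model_sub_sub_model _ _ (toQuat (D 0)) (toQuat r₂)
      ((1 / 2 : ℝ) • toQuat r₃) ((1 + t) / 2) Δs).symm
  -- The curve parameter plays no role here; zero is a filler.
  · let i : ι := ⟨(Δs, w, φ₀, φ₂, 0), hΔs, hd₀, hwK, hCC, ⟨le_rfl, zero_le_one⟩⟩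
    have h4 := h3 i hd₃
    set Y := (√(sampledData r L Δs w).h)⁻¹ • (sampledData r L Δs w).B2 φ₂ with hY
    set X := (√(sampledData r L Δs w).h)⁻¹ • (sampledData r L Δs w).B1 φ₀ φ₂ with hX
    have h5 : symI (Y - X) Y = (Δs / 2)⁻¹ • symI ((sampledData r L Δs w).B2 φ₂
        - (sampledData r L Δs w).B1 φ₀ φ₂) ((sampledData r L Δs w).B2 φ₂) := by
      have := symI_scaled (h := (sampledData r L Δs w).h) (by rw [sampledData_h]; exact hΔ2)
        ((sampledData r L Δs w).B2 φ₂ - (sampledData r L Δs w).B1 φ₀ φ₂)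
        ((sampledData r L Δs w).B2 φ₂)
      rw [smul_sub, ← hX, ← hY, show (sampledData r L Δs w).h⁻¹ = (Δs / 2)⁻¹ by
        rw [sampledData_h]] at this
      exact this
    have h6 : ‖symI (Y - X) Y - ((Δs / 4) • toQuat r₂
        + (Δs ^ 2 / 2) • ((1 / 2 : ℝ) • toQuat r₃))‖ ≤ M₃ * Δs ^ 3 := by
      refine (le_of_eq ?_).trans h4
      rw [hX, HermiteData.B1, smul_sub, smul_comm _ (2 : ℝ)]
      rfl
    -- Undoing both scalings leaves the factor `4 / Δs`, which lowers the third-order error to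
    -- second order.
    have h7 : ((Δs / 2)⁻¹ * (Δs / 2)⁻¹) • vecPart ((2 : ℝ) • symI ((sampledData r L Δs w).B2 φ₂
        - (sampledData r L Δs w).B1 φ₀ φ₂) ((sampledData r L Δs w).B2 φ₂))
        - (r₂ + Δs • r₃) = (4 / Δs) • vecPart (symI (Y - X) Y - ((Δs / 4) • toQuat r₂
        + (Δs ^ 2 / 2) • ((1 / 2 : ℝ) • toQuat r₃))) := by
      rw [h5]
      simp only [vecPart_sub, vecPart_add, vecPart_smul, vecPart_toQuat, smul_sub, smul_add,
        smul_smul]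
      have e1 : 4 / Δs * (Δs / 4) = 1 := by field_simp
      have e2 : 4 / Δs * (Δs ^ 2 / 2 * (1 / 2)) = Δs := by field_simp; norm_num
      have e3 : (Δs / 2)⁻¹ * (Δs / 2)⁻¹ * 2 = 4 / Δs * (Δs / 2)⁻¹ := by field_simp; norm_num
      rw [e1, e2, e3, one_smul]
    have h8 : ‖(4 / Δs) • vecPart (symI (Y - X) Y - ((Δs / 4) • toQuat r₂
        + (Δs ^ 2 / 2) • ((1 / 2 : ℝ) • toQuat r₃)))‖ ≤ 4 * M₃ * Δs ^ 2 := by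
      rw [norm_smul, Real.norm_of_nonneg (by positivity)]
      calc 4 / Δs * _ ≤ 4 / Δs * (M₃ * Δs ^ 3) := by
            gcongr
            exact (norm_vecPart_le _).trans h6
        _ = 4 * M₃ * Δs ^ 2 := by field_simp
    rw [← h7] at h8
    have h9 := hC₂ Δs hΔL
    rw [norm_sub_rev] at h9
    refine (norm_sub_le_norm_sub_add_norm_sub _ (r₂ + Δs • r₃) _).trans ((add_le_add h8 h9).trans ?_)
    rw [← add_mul]
    exact mul_le_mul_of_nonneg_right (le_max_right _ _) (sq_nonneg Δs)

end PHBiarc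

theorem proposition2 (L : ℝ) (hL : 0 < L) (r : ℝ → PHBiarc.E3)
    (hr : ContDiffOn ℝ 10 r (Set.Icc 0 L))
    (harc : ∀ s ∈ Set.Icc 0 L, ‖derivWithin r (Set.Icc 0 L) s‖ = 1)
    (hflat : (∃ k : ℕ, 2 ≤ k ∧ k ≤ 9 ∧ iteratedDerivWithin k r (Set.Icc 0 L) 0 ≠ 0) ∨
      (∃ ρ ∈ Set.Ioc 0 L, ∀ s ∈ Set.Icc 0 ρ,
        r s = r 0 + s • derivWithin r (Set.Icc 0 L) 0))
    (K : ℝ) :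
    ∃ C δ : ℝ, 0 < δ ∧ δ ≤ L ∧ ∀ Δs : ℝ, 0 < Δs → Δs ≤ δ →
      ∀ w : PHBiarc.E3, ‖w - iteratedDerivWithin 2 r (Set.Icc 0 L) 0‖ ≤ K * Δs ^ 2 →
        (∃ φ₀ φ₂ : ℝ, (PHBiarc.sampledData r L Δs w).IsCC φ₀ φ₂) ∧
        ∀ φ₀ φ₂ : ℝ, (PHBiarc.sampledData r L Δs w).IsCC φ₀ φ₂ →
          (∀ t ∈ Set.Icc (0 : ℝ) 1,
            ‖(PHBiarc.sampledData r L Δs w).biarc φ₀ φ₂ (t * Δs) - r (t * Δs)‖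
              ≤ C * Δs ^ 4) ∧
          ‖iteratedDerivWithin 2 ((PHBiarc.sampledData r L Δs w).biarc φ₀ φ₂)
                (Set.Icc 0 Δs) Δs
              - iteratedDerivWithin 2 r (Set.Icc 0 L) Δs‖ ≤ C * Δs ^ 2 := by
  obtain ⟨C, δ, hδ, hδL, hmain⟩ := PHBiarc.exists_hodograph_bounds hL hr harc hflat K
  refine ⟨max C 0, δ, hδ, hδL, fun Δs hΔs hΔδ w hw => ⟨(hmain Δs hΔs hΔδ w hw).1,
    fun φ₀ φ₂ hCC => ?_⟩⟩
  obtain ⟨h1, h2, h3⟩ := (hmain Δs hΔs hΔδ w hw).2 φ₀ φ₂ hCC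
  set H := PHBiarc.sampledData r L Δs w with hH
  have hh : H.h = Δs / 2 := PHBiarc.sampledData_h Δs w
  have hh0 : 0 < H.h := by rw [hh]; linarith
  have hum : H.um = Δs / 2 := by
    rw [PHBiarc.HermiteData.um, hh]; exact zero_add _
  have hdr : ∀ u ∈ Set.Icc 0 L,
      HasDerivWithinAt r (derivWithin r (Set.Icc 0 L) u) (Set.Icc 0 L) u := fun u hu =>
    (hr.differentiableOn (by norm_num) u hu).hasDerivWithinAt
  have hC : Δs / 2 * (C * Δs ^ 3) ≤ max C 0 * Δs ^ 4 := by
    have e1 : C * Δs ^ 4 ≤ max C 0 * Δs ^ 4 := by gcongr; exact le_max_left _ _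
    have e2 : 0 ≤ max C 0 * Δs ^ 4 := by positivity
    nlinarith
  refine ⟨fun t ht => ?_, ?_⟩
  · rw [PHBiarc.HermiteData.biarc, hum, hh]
    split_ifs with hu
    · have hsub : Set.Icc 0 (0 + Δs / 2) ⊆ Set.Icc 0 L := Set.Icc_subset_Icc le_rfl (by linarith)
      have hτ : 2 * t ∈ Set.Icc (0 : ℝ) 1 := ⟨by linarith [ht.1], by nlinarith⟩
      -- The first arc is anchored at `p_i`; the second, below, at `p_f`. No matching at the joint
      -- is needed for the estimate.
      have h4 := PHBiarc.norm_sub_sub_sub_le (a := 0) (r := r) (by linarith : 0 < Δs / 2)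
        (fun τ => PHBiarc.hasDerivAt_ctrlInitial (PHBiarc.toQuat H.pi) (H.A0 φ₀) (H.A1 φ₀ φ₂)
          (H.A2 φ₀ φ₂) τ)
        (fun u hu => (hdr u (hsub hu)).mono hsub)
        (fun τ hτ => by simpa using h1 τ hτ) hτ (Set.left_mem_Icc.2 zero_le_one)
      have e1 : (t * Δs - H.ui) / (Δs / 2) = 2 * t := by
        rw [show H.ui = 0 from rfl]; field_simp; ring
      have e2 : PHBiarc.vecPart (PHBiarc.ctrlInitial (PHBiarc.toQuat H.pi) (H.A0 φ₀) (H.A1 φ₀ φ₂)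
          (H.A2 φ₀ φ₂) 0) = r 0 := PHBiarc.vecPart_toQuat _
      rw [PHBiarc.bezier5_zero, e2, zero_mul, add_zero, sub_self, sub_zero, zero_add,
        show 2 * t * (Δs / 2) = t * Δs by ring] at h4
      rw [e1]
      exact h4.trans hC
    · have hsub : Set.Icc (Δs / 2) (Δs / 2 + Δs / 2) ⊆ Set.Icc 0 L :=
        Set.Icc_subset_Icc (by linarith) (by linarith)
      have hτ : 2 * t - 1 ∈ Set.Icc (0 : ℝ) 1 := ⟨by nlinarith [not_le.1 hu], by linarith [ht.2]⟩
      have h4 := PHBiarc.norm_sub_sub_sub_le (a := Δs / 2) (r := r) (by linarith : 0 < Δs / 2)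
        (fun τ => PHBiarc.hasDerivAt_ctrlFinal (PHBiarc.toQuat H.pf) (H.B0 φ₀ φ₂) (H.B1 φ₀ φ₂)
          (H.B2 φ₂) τ)
        (fun u hu => (hdr u (hsub hu)).mono hsub)
        (fun τ hτ => h2 τ hτ) hτ (Set.right_mem_Icc.2 zero_le_one)
      have e1 : (t * Δs - Δs / 2) / (Δs / 2) = 2 * t - 1 := by
        field_simp
      have e2 : PHBiarc.vecPart (PHBiarc.ctrlFinal (PHBiarc.toQuat H.pf) (H.B0 φ₀ φ₂) (H.B1 φ₀ φ₂)
          (H.B2 φ₂) 5) = r Δs := PHBiarc.vecPart_toQuat _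
      rw [PHBiarc.bezier5_one, e2, one_mul, add_halves, sub_self, sub_zero,
        show Δs / 2 + (2 * t - 1) * (Δs / 2) = t * Δs by ring] at h4
      rw [e1]
      exact h4.trans hC
  · have h4 := PHBiarc.HermiteData.iteratedDerivWithin_biarc hh0 φ₀ φ₂
    rw [hh, show H.ui = 0 from rfl, show H.uf = Δs from rfl] at h4
    rw [h4]
    refine h3.trans ?_
    gcongr
    exact le_max_left _ _
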